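/- Let $\mathcal L$ be a first-order language containing a symbol for an order and a binary function symbol $+$, and let $T$ be a complete (in particular consistent) o-minimal $\mathcal L$-theory extending the theory of densely ordered groups (dense linear order without end points, together with a group operation $+$ whose translations preserve the order); o-minimal means that in every model of $T$ each subset of the universe that is definable with parameters is a finite union of points and open intervals with end points in the model or $\pm\infty$. Let $\mathcal L_e$ be $\mathcal L$ augmented by a unary predicate $P$ and a binary predicate $E$, and let $T_e$ be the $\mathcal L_e$-theory consisting of $T$ and axiom schemata expressing: 1. $P$ is dense, and $P$ is $\operatorname{dcl}_T$-independent, that is, no $p\in P$ is $\mathcal L$-definable over $P\setminus\{p\}$; 2. $E\subseteq P^2$ is an equivalence relation on $P$; 3. each equivalence class of $E$ is dense in $P$. Let $T_{e,\infty}$ be $T_e$ together with axioms expressing that $E$ has infinitely many equivalence classes and, for each integer $n\ge 1$, let $T_{e,n}$ be $T_e$ together with a sentence expressing that $E$ has exactly $n$ equivalence classes. For an expansion $\mathcal N$ of a dense linear order $(N,<)$ without end points, the open core $\mathcal N^\circ$ is the structure $(N,(U))$, where $U$ ranges over all open subsets (for the order topology and its products) of all the powers $N^k$ that are definable in $\mathcal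 N$ with parameters. Two structures with the same universe are interdefinable if the same sets, of all arities, are definable with parameters in both. A theory $T$ is an open core of a theory $T^*$ extending the theory of dense linear orders without end points if for every $\mathcal N\models T^*$ there is $\mathcal M\models T$ such that $\mathcal N^\circ$ is interdefinable with $\mathcal M$. Then: (a) $T_{e,\infty}$ is complete (in particular consistent), and $T$ is an open core of $T_{e,\infty}$; (b) for every integer $n\ge 1$, $T_{e,n}$ is complete, and $T$ is an open core of $T_{e,n}$; (c) every complete $\mathcal L_e$-theory extending $T_e$ has the same consequences as $T_{e,p}$ for some $p\in\{1,2,3,\dots\}\cup\{\infty\}$. -/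

import Mathlib

open FirstOrder

universe u v u' v' w

namespace OpenCore

open FirstOrder.Language

/-! ### Structures with an order symbol -/

section Structures

variable (L : FirstOrder.Language.{u, v}) [L.IsOrdered] (M : Type w) [L.Structure M]

/-- The strict order that the order symbol `≤` of `L` induces on an `L`-structure:
`a < b` means `a ≤ b` and not `b ≤ a`. -/
def Lt (a b : M) : Prop :=
  Structure.RelMap (leSymb : L.Relations 2) ![a, b] ∧
    ¬ Structure.RelMap (leSymb : L.Relations 2) ![b, a]

/-- The order topology of an `L`-structure, generated by the open rays. -/
@[reducible]
def orderTop : TopologicalSpace M :=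
  TopologicalSpace.generateFrom
    {s : Set M | ∃ a : M, s = {b | Lt L M a b} ∨ s = {b | Lt L M b a}}

/-- A subset of `M ^ n` is open if it is so in the product of the order topologies. -/
def IsOpenPow {n : ℕ} (U : Set (Fin n → M)) : Prop :=
  letI := orderTop L M
  IsOpen U

/-- A point, or an open interval with end points in `M ∪ {-∞, +∞}`. -/
def IsPointOrInterval (s : Set M) : Prop :=
  (∃ a, s = {a}) ∨ s = Set.univ ∨ (∃ a, s = {x | Lt L M a x}) ∨ (∃ b, s = {x | Lt L M x b}) ∨
    ∃ a b, s = {x | Lt L M a x ∧ Lt L M x b}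

/-- Every subset of `M` that is definable with parameters is a finite union of points and
open intervals. -/
def IsOMinimalStructure : Prop :=
  ∀ s : Set M, (Set.univ : Set M).Definable₁ L s →
    ∃ F : Set (Set M), F.Finite ∧ (∀ I ∈ F, IsPointOrInterval L M I) ∧ s = ⋃₀ F

/-- The language of the open core of `M`: an `n`-ary relation symbol for every open subset of
`M ^ n` that is definable with parameters. -/
def coreLanguage : FirstOrder.Language.{0, w} where
  Functions := fun _ => Empty
  Relations := fun n =>
    {U : Set (Fin n → M) // IsOpenPow L M U ∧ (Set.univ : Set M).Definable L U}

/-- The open core of `M`: the same universe, each symbol being interpreted by itself. -/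
instance coreStructure : (coreLanguage L M).Structure M where
  funMap := fun f => Empty.elim f
  RelMap := fun U x => x ∈ U.1

end Structures

/-- Two structures with the same universe are interdefinable if they have the same definable
sets of all arities; definable means definable with parameters. -/
def Interdefinable (L : FirstOrder.Language.{u, v}) (L' : FirstOrder.Language.{u', v'}) (M : Type w)
    [L.Structure M] [L'.Structure M] : Prop :=
  ∀ (n : ℕ) (s : Set (Fin n → M)),
    (Set.univ : Set M).Definable L s ↔ (Set.univ : Set M).Definable L' s

/-! ### Theories -/

/-- `T₁` extends `T₀`: each sentence of `T₀` is a consequence of `T₁`. -/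
def Extends {L : FirstOrder.Language.{u, v}} (T₁ T₀ : L.Theory) : Prop :=
  ∀ φ ∈ T₀, T₁ ⊨ᵇ φ

/-- All models of `T` are o-minimal. -/
def IsOMinimal {L : FirstOrder.Language.{u, v}} [L.IsOrdered] (T : L.Theory) : Prop :=
  ∀ M : Theory.ModelType.{u, v, max u v} T, IsOMinimalStructure L M

/-- `T` is an open core of `T'`: for every model `N` of `T'` there is a model of `T`, with the
same universe as `N`, that is interdefinable with the open core of `N`. The models `N` range over
the universe `Type w`. -/
def IsOpenCoreOf {L : FirstOrder.Language.{u, v}} {L' : FirstOrder.Language.{u', v'}} [L'.IsOrdered]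
    (T : L.Theory) (T' : L'.Theory) : Prop :=
  ∀ (N : Type w) [Nonempty N] [L'.Structure N], N ⊨ T' →
    ∃ _ : L.Structure N, N ⊨ T ∧ Interdefinable (coreLanguage L' N) L N

section OrderedGroups

variable {L : FirstOrder.Language.{u, v}} [L.IsOrdered] (add : L.Functions 2)

/-- `(x + y) + z = x + (y + z)` -/
def addAssocSentence : L.Sentence :=
  ∀' ∀' ∀' (add.apply₂ (add.apply₂ (&0) (&1)) (&2) =' add.apply₂ (&0) (add.apply₂ (&1) (&2)))

/-- There is a two-sided neutral element for which every element has a two-sided inverse. -/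
def addZeroNegSentence : L.Sentence :=
  ∃' ∀' ((add.apply₂ (&0) (&1) =' &1) ⊓ (add.apply₂ (&1) (&0) =' &1) ⊓
    ∃' ((add.apply₂ (&1) (&2) =' &0) ⊓ (add.apply₂ (&2) (&1) =' &0)))

/-- If `x ≤ y` then `x + z ≤ y + z` and `z + x ≤ z + y`. -/
def addMonoSentence : L.Sentence :=
  ∀' ∀' ∀' ((&0).le &1 ⟹ ((add.apply₂ (&0) (&2)).le (add.apply₂ (&1) (&2)) ⊓
    (add.apply₂ (&2) (&0)).le (add.apply₂ (&2) (&1))))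

/-- The theory of densely ordered groups: dense linear orders without end points, with a group
operation whose translations preserve the order. -/
def denselyOrderedGroupTheory : L.Theory :=
  L.dlo ∪ {addAssocSentence add, addZeroNegSentence add, addMonoSentence add}

end OrderedGroups

/-! ### The language `L_e` and the theories `T_e`, `T_{e,n}`, `T_{e,∞}` -/

/-- The new relation symbols: `P` is unary and `E` is binary. -/
inductive PERel : ℕ → Type
  | P : PERel 1
  | E : PERel 2

/-- The language with the symbols `P` and `E` only. -/
def peLanguage : FirstOrder.Language.{0, 0} := ⟨fun _ => Empty, PERel⟩

/-- The language `L_e`: `L` augmented by `P` and `E`. -/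
abbrev Le (L : FirstOrder.Language.{u, v}) : FirstOrder.Language.{u, v} := L.sum peLanguage

section Te

variable (L : FirstOrder.Language.{u, v})

instance leIsOrdered [L.IsOrdered] : (Le L).IsOrdered := ⟨Sum.inl leSymb⟩

/-- The symbol `P` of `L_e`. -/
def symP : (Le L).Relations 1 := Sum.inr PERel.P

/-- The symbol `E` of `L_e`. -/
def symE : (Le L).Relations 2 := Sum.inr PERel.E

variable {L}

/-- The atomic formula `P t`. -/
abbrev fP {α : Type} {k : ℕ} (t : (Le L).Term (α ⊕ Fin k)) : (Le L).BoundedFormula α k :=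
  (symP L).boundedFormula₁ t

/-- The atomic formula `E t₁ t₂`. -/
abbrev fE {α : Type} {k : ℕ} (t₁ t₂ : (Le L).Term (α ⊕ Fin k)) : (Le L).BoundedFormula α k :=
  (symE L).boundedFormula₂ t₁ t₂

section Order

variable (L) [L.IsOrdered]

/-- `P` is dense: every interval `(x₀, x₁)` with `x₀ < x₁` contains an element of `P`. -/
def denseSentence : (Le L).Sentence :=
  ∀' ∀' ((&0).lt &1 ⟹ ∃' (fP &2 ⊓ ((&0).lt &2 ⊓ (&2).lt &1)))

/-- Every equivalence class of `E` is dense in `P`: if `x₀` is in `P` and the interval `(x₁, x₂)`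
meets `P`, then this interval meets the class of `x₀`. -/
def denseClassesSentence : (Le L).Sentence :=
  ∀' ∀' ∀' (fP &0 ⟹ (∃' (fP &3 ⊓ ((&1).lt &3 ⊓ (&3).lt &2))) ⟹
    ∃' (fE &0 &3 ⊓ ((&1).lt &3 ⊓ (&3).lt &2)))

end Order

/-- For an `L`-formula `φ(x₀, …, xₙ)`: if `x₀, …, xₙ` are in `P` and `x₀` is different from
`x₁, …, xₙ`, then `x₀` is not the unique `z` with `φ(z, x₁, …, xₙ)`. -/
noncomputable def indepSentence {n : ℕ} (φ : L.Formula (Fin (n + 1))) : (Le L).Sentence :=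
  let ψ : (Le L).Formula (Fin (n + 1)) := (LHom.sumInl : L →ᴸ Le L).onFormula φ
  let inP : (Le L).Formula (Fin (n + 1)) :=
    Formula.iInf fun i : Fin (n + 1) => (symP L).formula₁ (Term.var i)
  let distinct : (Le L).Formula (Fin (n + 1)) :=
    Formula.iInf fun i : Fin n => ((Term.var (0 : Fin (n + 1))).equal (Term.var i.succ)).not
  let unique : (Le L).Formula (Fin (n + 1)) :=
    Formula.iAlls Unit
      ((ψ.relabel (Fin.cons (Sum.inr ()) fun i : Fin n => Sum.inl i.succ :
          Fin (n + 1) → Fin (n + 1) ⊕ Unit)).imp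
        ((Term.var (Sum.inr ())).equal (Term.var (Sum.inl 0))))
  Formula.iAlls (Fin (n + 1))
    (Formula.relabel Sum.inr ((inP ⊓ distinct).imp (ψ ⊓ unique).not))

variable (L) in
/-- `P` is `dcl_T`-independent: no element of `P` is in the definable closure (in the language
`L`) of the other elements of `P`. -/
def indepAxioms : (Le L).Theory :=
  {σ | ∃ (n : ℕ) (φ : L.Formula (Fin (n + 1))), σ = indepSentence φ}

variable (L) in
/-- `E ⊆ P²`, and `E` is an equivalence relation on `P`. -/
def equivAxioms : (Le L).Theory :=
  {∀' ∀' (fE &0 &1 ⟹ (fP &0 ⊓ fP &1)),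
   ∀' (fP &0 ⟹ fE &0 &0),
   ∀' ∀' (fE &0 &1 ⟹ fE &1 &0),
   ∀' ∀' ∀' (fE &0 &1 ⟹ fE &1 &2 ⟹ fE &0 &2)}

variable (L) in
/-- The formula saying that `x₀, …, xₙ₋₁` are in `P` and pairwise not `E`-equivalent. -/
noncomputable def inequivFormula (n : ℕ) : (Le L).Formula (Fin n) :=
  (Formula.iInf fun i : Fin n => (symP L).formula₁ (Term.var i)) ⊓
    Formula.iInf fun p : {p : Fin n × Fin n // p.1 ≠ p.2} =>
      ((symE L).formula₂ (Term.var p.1.1) (Term.var p.1.2)).not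

variable (L) in
/-- `E` has at least `n` equivalence classes. -/
noncomputable def atLeastSentence (n : ℕ) : (Le L).Sentence :=
  Formula.iExs (Fin n) (Formula.relabel Sum.inr (inequivFormula L n))

variable [L.IsOrdered] (T : L.Theory)

/-- The theory `T_e`. -/
def Te : (Le L).Theory :=
  (LHom.sumInl : L →ᴸ Le L).onTheory T ∪ {denseSentence L} ∪ indepAxioms L ∪ equivAxioms L ∪
    {denseClassesSentence L}

/-- The theory `T_{e,∞}`: `T_e`, and `E` has infinitely many classes. -/
def TeInf : (Le L).Theory :=
  Te T ∪ {σ | ∃ n : ℕ, σ = atLeastSentence L n}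

/-- The theory `T_{e,n}`: `T_e`, and `E` has exactly `n` classes. -/
def TeN (n : ℕ) : (Le L).Theory :=
  Te T ∪ {atLeastSentence L n ⊓ (atLeastSentence L (n + 1)).not}

end Te

end OpenCore

/-! In an o-minimal structure definable closure satisfies exchange (`exchange`), and a point outside
`dcl A` is interior to every `A`-definable set containing it (`exists_nhd_of_notMem_dcl`). So an
`L`-type of a non-definable point is approximated by intervals, and it can be realized together with
any condition satisfiable in every interval (`exists_realization`).

Completeness is a back-and-forth argument between finite free families: those over which the
remaining elements of `P` stay independent. For such families the `L`-type, the traces of `P` and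
`E`, and the number of classes determine the whole `L_e`-type (`Matching.realize_iff`). A point to
be added is of one of three kinds. In `P`: density of the classes gives a partner. Definable over
the family and `P`: the finitely many elements of `P` involved are added first, and then the same
definition is used. Neither: a partner exists because a sum of `k + 1` new elements of `P` is not
definable from the family and `k` elements of `P`, and such sums occur in every interval
(`exists_sum`); addition is used only here. The empty families match as soon as the numbers of
classes agree.

Consistency comes from an ultrapower of `T` in which every interval has as many points as the model;
a transfinite recursion then puts points of every class into all intervals while keeping them
independent (`exists_teModel_atLeast_iff`).

For the open core, two inclusions are needed. A tuple independent over a model and `P` has its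
`L_e`-type determined by its `L`-type over the model. An open `L_e`-definable set is a union of
boxes with such generic corners, so by compactness it is `L`-definable (`exists_formula_of_open`).
Conversely, a tuple in an `L`-definable set splits into an independent part and functions of it that
are continuous there, so it lies in a definable difference of two open sets inside the given set
(`exists_open_diff`); by compactness finitely many such differences exhaust the set. -/

namespace OpenCore

open FirstOrder.Language

/-! ### Formulas in named variables. -/

section Formulas

variable {L : FirstOrder.Language.{u, v}} {α β : Type*}

/-- Existential quantification over one variable. -/
noncomputable def ex1 (φ : L.Formula (α ⊕ Unit)) : L.Formula α := φ.iExs Unit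

/-- Universal quantification over one variable. -/
noncomputable def all1 (φ : L.Formula (α ⊕ Unit)) : L.Formula α := φ.iAlls Unit

/-- The formula `x = y`. -/
def eqF (x y : α) : L.Formula α := (Term.var x).equal (Term.var y)

/-- The formula `x < y`. -/
def ltF [L.IsOrdered] (x y : α) : L.Formula α :=
  (leSymb : L.Relations 2).formula₂ (Term.var x) (Term.var y) ⊓
    ((leSymb : L.Relations 2).formula₂ (Term.var y) (Term.var x)).not

/-- The formula saying that the last variable is the unique solution of `φ`. -/
noncomputable def uniqF (φ : L.Formula (α ⊕ Unit)) : L.Formula (α ⊕ Unit) :=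
  φ ⊓ all1 ((φ.relabel (Sum.map Sum.inl id)).imp (eqF (Sum.inr ()) (Sum.inl (Sum.inr ()))))

variable {M : Type w} [L.Structure M]

@[simp]
theorem realize_ex1 {φ : L.Formula (α ⊕ Unit)} {v : α → M} :
    (ex1 φ).Realize v ↔ ∃ z, φ.Realize (Sum.elim v fun _ => z) := by
  simp only [ex1, Formula.realize_iExs]
  exact ⟨fun ⟨i, hi⟩ => ⟨i (), hi⟩, fun ⟨z, hz⟩ => ⟨fun _ => z, hz⟩⟩

@[simp]
theorem realize_all1 {φ : L.Formula (α ⊕ Unit)} {v : α → M} :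
    (all1 φ).Realize v ↔ ∀ z, φ.Realize (Sum.elim v fun _ => z) := by
  simp only [all1, Formula.realize_iAlls]
  exact ⟨fun h z => h fun _ => z, fun h i => h (i ())⟩

@[simp]
theorem realize_eqF {x y : α} {v : α → M} : (eqF x y : L.Formula α).Realize v ↔ v x = v y := by
  simp [eqF]

@[simp]
theorem realize_ltF [L.IsOrdered] [LinearOrder M] [L.OrderedStructure M] {x y : α} {v : α → M} :
    (ltF x y : L.Formula α).Realize v ↔ v x < v y := by
  simp only [ltF, Formula.realize_inf, Formula.realize_not, Formula.realize_rel₂, relMap_leSymb]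
  simpa using le_of_lt

theorem lt_iff [L.IsOrdered] [LinearOrder M] [L.OrderedStructure M] {a b : M} :
    Lt L M a b ↔ a < b := by
  simp only [Lt, relMap_leSymb]
  simpa using le_of_lt

@[simp]
theorem realize_uniqF {φ : L.Formula (α ⊕ Unit)} {v : α → M} {z : M} :
    (uniqF φ).Realize (Sum.elim v fun _ => z) ↔ ∀ y, φ.Realize (Sum.elim v fun _ => y) ↔ y = z := by
  have h (y : M) : Sum.elim (Sum.elim v fun _ : Unit => z) (fun _ : Unit => y) ∘
      Sum.map Sum.inl id = Sum.elim v fun _ => y := by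
    ext (_ | _) <;> rfl
  simp only [uniqF, Formula.realize_inf, realize_all1, Formula.realize_imp,
    Formula.realize_relabel, h, realize_eqF, Sum.elim_inr, Sum.elim_inl]
  refine ⟨fun ⟨h1, h2⟩ y => ⟨h2 y, fun e => e ▸ h1⟩, fun h1 => ⟨(h1 z).2 rfl, fun y => (h1 y).1⟩⟩

/-- Only finitely many variables occur in `φ`. The variables in `κ` are kept, and `ψ` is chosen
before the structure, so one replacement serves all structures. -/
theorem exists_finite_support {B : Type*} {κ : Type*} [Finite κ] (φ : L.Formula (B ⊕ κ)) :
    ∃ (n : ℕ) (b : Fin n → B) (ψ : L.Formula (Fin n ⊕ κ)), ∀ (M : Type w) [L.Structure M]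
      (v : B → M) (x : κ → M), φ.Realize (Sum.elim v x) ↔ ψ.Realize (Sum.elim (v ∘ b) x) := by
  classical
  let s : Finset B := φ.freeVarFinset.preimage Sum.inl Sum.inl_injective.injOn
  let e : Fin s.card ≃ s := s.equivFin.symm
  let g : φ.freeVarFinset → Fin s.card ⊕ κ := fun a =>
    match a with
    | ⟨Sum.inl b, hb⟩ => Sum.inl (e.symm ⟨b, by simpa [s] using hb⟩)
    | ⟨Sum.inr k, _⟩ => Sum.inr k
  refine ⟨s.card, fun i => e i, BoundedFormula.restrictFreeVar φ g, fun M _ v x => ?_⟩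
  symm
  refine BoundedFormula.realize_restrictFreeVar (Sum.elim v x) ?_
  rintro ⟨b | k, h⟩
  · simp [g]
  · simp [g]

end Formulas

/-! ### Definable closure as a closure operator. -/

section Dcl

variable (L : FirstOrder.Language.{u, v}) {M : Type w} [L.Structure M]

/-- The definable closure of `A`. -/
def dcl (A : Set M) : Set M :=
  {b | ∃ (n : ℕ) (a : Fin n → M) (φ : L.Formula (Fin n ⊕ Unit)), (∀ i, a i ∈ A) ∧
    ∀ z, φ.Realize (Sum.elim a fun _ => z) ↔ z = b}

variable {L} {A B : Set M} {b c : M} {ι : Type*}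

theorem mem_dcl_of_formula {a : ι → M} (ha : ∀ i, a i ∈ A) (φ : L.Formula (ι ⊕ Unit))
    (h : ∀ z, φ.Realize (Sum.elim a fun _ => z) ↔ z = b) : b ∈ dcl L A := by
  obtain ⟨n, g, ψ, hψ⟩ := exists_finite_support φ
  exact ⟨n, a ∘ g, ψ, fun i => ha _, fun z => by rw [← hψ M, h]⟩

theorem mem_dcl_range {a : ι → M} :
    b ∈ dcl L (Set.range a) ↔
      ∃ φ : L.Formula (ι ⊕ Unit), ∀ z, φ.Realize (Sum.elim a fun _ => z) ↔ z = b := by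
  refine ⟨fun ⟨n, x, φ, hx, hφ⟩ => ?_, fun ⟨φ, hφ⟩ => mem_dcl_of_formula (by simp) φ hφ⟩
  choose g hg using hx
  refine ⟨φ.relabel (Sum.map g id), fun z => ?_⟩
  rw [Formula.realize_relabel, ← hφ z]
  have : Sum.elim a (fun _ : Unit => z) ∘ Sum.map g id = Sum.elim x fun _ => z := by
    ext (i | _) <;> simp [hg]
  rw [this]

theorem dcl_mono (h : A ⊆ B) : dcl L A ⊆ dcl L B :=
  fun _ ⟨n, a, φ, ha, hφ⟩ => ⟨n, a, φ, fun i => h (ha i), hφ⟩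

variable (L) in
theorem subset_dcl (A : Set M) : A ⊆ dcl L A := fun a ha =>
  mem_dcl_of_formula (a := fun _ : Unit => a) (fun _ => ha) (eqF (Sum.inr ()) (Sum.inl ()))
    fun z => by simp

theorem dcl_subset_dcl (h : B ⊆ dcl L A) : dcl L B ⊆ dcl L A := by
  rintro b ⟨n, x, φ, hx, hφ⟩
  have hx' (i) : ∃ θ : L.Formula (A ⊕ Unit), ∀ z,
      θ.Realize (Sum.elim Subtype.val fun _ => z) ↔ z = x i := by
    rw [← mem_dcl_range, Subtype.range_coe]
    exact h (hx i)
  choose θ hθ using hx'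
  let ψ : L.Formula ((A ⊕ Unit) ⊕ Fin n) :=
    (Formula.iInf fun i => (θ i).relabel (Sum.elim (Sum.inl ∘ Sum.inl) fun _ => Sum.inr i)) ⊓
      φ.relabel (Sum.elim Sum.inr (Sum.inl ∘ Sum.inr))
  refine mem_dcl_of_formula (a := Subtype.val) (fun i : A => i.2) (ψ.iExs (Fin n)) fun z => ?_
  have h1 (y : Fin n → M) (i) : Sum.elim (Sum.elim (Subtype.val : A → M) fun _ : Unit => z) y ∘
      (Sum.elim (Sum.inl ∘ Sum.inl) fun _ : Unit => Sum.inr i) =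
        Sum.elim Subtype.val fun _ => y i := by
    ext (_ | _) <;> rfl
  have h2 (y : Fin n → M) : Sum.elim (Sum.elim (Subtype.val : A → M) fun _ : Unit => z) y ∘
      (Sum.elim Sum.inr (Sum.inl ∘ Sum.inr)) = Sum.elim y fun _ => z := by
    ext (_ | _) <;> rfl
  simp only [ψ, Formula.realize_iExs, Formula.realize_inf, Formula.realize_iInf,
    Formula.realize_relabel, h1, h2, hθ]
  constructor
  · rintro ⟨y, hy, hz⟩
    obtain rfl : y = x := funext hy
    exact (hφ z).1 hz
  · exact fun hz => ⟨x, fun _ => rfl, (hφ z).2 hz⟩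

theorem exists_finite_of_mem_dcl (h : b ∈ dcl L A) : ∃ s ⊆ A, s.Finite ∧ b ∈ dcl L s := by
  obtain ⟨n, a, φ, ha, hφ⟩ := h
  exact ⟨Set.range a, by rintro _ ⟨i, rfl⟩; exact ha i, Set.finite_range a, n, a, φ,
    fun i => ⟨i, rfl⟩, hφ⟩

theorem mem_dcl_range_union {a : ι → M} :
    b ∈ dcl L (Set.range a ∪ B) ↔ ∃ (n : ℕ) (p : Fin n → M), (∀ i, p i ∈ B) ∧
      ∃ φ : L.Formula ((ι ⊕ Fin n) ⊕ Unit),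
        ∀ z, φ.Realize (Sum.elim (Sum.elim a p) fun _ => z) ↔ z = b := by
  constructor
  · intro h
    obtain ⟨s, hs, hfin, hb⟩ := exists_finite_of_mem_dcl h
    obtain ⟨n, p, hp⟩ := (hfin.inter_of_left B).fin_embedding
    refine ⟨n, p, fun i => ?_, ?_⟩
    · have : p i ∈ s ∩ B := hp ▸ ⟨i, rfl⟩
      exact this.2
    · rw [← mem_dcl_range, Set.Sum.elim_range]
      refine dcl_mono (fun x hx => ?_) hb
      rcases hs hx with h | h
      · exact Or.inl h
      · exact Or.inr (hp ▸ ⟨hx, h⟩)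
  · rintro ⟨n, p, hp, φ, hφ⟩
    refine mem_dcl_of_formula (a := Sum.elim a p) ?_ φ hφ
    rintro (i | i)
    · exact Or.inl ⟨i, rfl⟩
    · exact Or.inr (hp i)

theorem mem_dcl_insert (h : c ∈ dcl L (insert b A)) (hb : b ∈ dcl L A) : c ∈ dcl L A :=
  dcl_subset_dcl (Set.insert_subset hb (subset_dcl L A)) h

/-- That `φ` defines `b` over `a` is itself expressed by the formula `uniqF φ`, which elementary
embeddings preserve and reflect. -/
theorem image_mem_dcl_iff {N : Type*} [L.Structure N] (i : M ↪ₑ[L] N) {a : ι → M} :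
    i b ∈ dcl L (Set.range (i ∘ a)) ↔ b ∈ dcl L (Set.range a) := by
  rw [mem_dcl_range, mem_dcl_range]
  refine exists_congr fun φ => ?_
  have h1 := i.map_formula (uniqF φ) (Sum.elim a fun _ => b)
  have h2 : i ∘ Sum.elim a (fun _ : Unit => b) = Sum.elim (i ∘ a) fun _ => i b := by
    ext (_ | _) <;> rfl
  rw [h2, realize_uniqF, realize_uniqF] at h1
  exact h1

/-- The existence of a unique solution is a formula over `M`, so it has a witness in `M`, whose
image must be the given point. -/
theorem dcl_image_subset {N : Type*} [L.Structure N] (i : M ↪ₑ[L] N) :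
    dcl L (Set.range i) ⊆ Set.range i := by
  intro c hc
  obtain ⟨φ, hφ⟩ := mem_dcl_range.1 hc
  have h1 := i.map_formula (ex1 (uniqF φ)) id
  simp only [realize_ex1, Function.comp_id, realize_uniqF] at h1
  obtain ⟨z, hz⟩ := h1.1 ⟨c, hφ⟩
  refine ⟨z, ?_⟩
  have h2 := i.map_formula φ (Sum.elim id fun _ => z)
  rw [hz] at h2
  have h3 : i ∘ Sum.elim id (fun _ : Unit => z) = Sum.elim i fun _ => i z := by
    ext (_ | _) <;> rfl
  rw [h3, hφ] at h2
  exact h2.2 rfl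

theorem image_mem_dcl_image_iff {N : Type*} [L.Structure N] (i : M ↪ₑ[L] N) :
    i b ∈ dcl L (i '' A) ↔ b ∈ dcl L A := by
  have := image_mem_dcl_iff i (b := b) (a := (Subtype.val : A → M))
  rwa [Set.range_comp, Subtype.range_coe] at this

end Dcl

/-- Nonempty dense linear orders without end points. -/
class IsDLO (M : Type*) [LinearOrder M] : Prop extends
    DenselyOrdered M, NoMinOrder M, NoMaxOrder M where
  nonempty : Nonempty M

/-- O-minimal structures whose order symbol is interpreted by the given linear order. -/
class IsOMin (L : FirstOrder.Language.{u, v}) [L.IsOrdered] (M : Type w) [L.Structure M]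
    [LinearOrder M] : Prop extends L.OrderedStructure M where
  omin : IsOMinimalStructure L M

/-! ### Definable sets and exchange in o-minimal structures. -/

section OMinimal

variable {L : FirstOrder.Language.{u, v}} [L.IsOrdered] {M : Type w} [L.Structure M]
  [LinearOrder M] [IsOMin L M] {ι : Type*}

/-- The set defined by a formula in one free variable, with parameters. -/
def solSet (φ : L.Formula (ι ⊕ Unit)) (a : ι → M) : Set M :=
  {x | φ.Realize (Sum.elim a fun _ => x)}

theorem exists_intervals (φ : L.Formula (ι ⊕ Unit)) (a : ι → M) :
    ∃ F : Set (Set M), F.Finite ∧ (∀ I ∈ F, (∃ x, I = {x}) ∨ I = Set.univ ∨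
      (∃ x, I = Set.Ioi x) ∨ (∃ x, I = Set.Iio x) ∨ ∃ x y, I = Set.Ioo x y) ∧
      solSet φ a = ⋃₀ F := by
  have h : (Set.univ : Set M).Definable₁ L (solSet φ a) := by
    rw [Set.Definable₁, Set.definable_iff_exists_formula_sum]
    refine ⟨φ.relabel (Sum.map (fun i => ⟨a i, trivial⟩) fun _ => 0), ?_⟩
    ext x
    simp only [solSet, Formula.realize_relabel, Set.mem_ofPred_eq]
    have : (Sum.elim (fun i : (Set.univ : Set M) => (i : M)) x ∘
        Sum.map (fun i => ⟨a i, trivial⟩) fun _ : Unit => 0) = Sum.elim a fun _ => x 0 := by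
      ext (_ | _) <;> rfl
    rw [this]
  obtain ⟨F, hF, hI, hs⟩ := IsOMin.omin _ h
  refine ⟨F, hF, fun I hIF => ?_, hs⟩
  have := hI I hIF
  simp only [IsPointOrInterval, lt_iff] at this
  exact this

/-- Each nonempty bounded piece of the decomposition has its point or right end point as supremum,
and a finite union has the maximum of these. -/
theorem exists_isLUB [IsDLO M] (φ : L.Formula (ι ⊕ Unit)) (a : ι → M)
    (hne : (solSet φ a).Nonempty) (hbdd : BddAbove (solSet φ a)) : ∃ s, IsLUB (solSet φ a) s := by
  obtain ⟨F, hF, hI, hs⟩ := exists_intervals φ a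
  rw [hs] at hne hbdd ⊢
  have key : ∀ G : Set (Set M), G.Finite → G ⊆ F → (⋃₀ G).Nonempty → ∃ s, IsLUB (⋃₀ G) s := by
    intro G hG
    induction G, hG using Set.Finite.induction_on with
    | empty => simp
    | @insert I G hIG hfin ih =>
      intro hsub hne
      have hIF := hsub (Set.mem_insert _ _)
      have hsubG : G ⊆ F := (Set.subset_insert _ _).trans hsub
      rw [Set.sUnion_insert]
      have hbI : BddAbove I := hbdd.mono (Set.subset_sUnion_of_mem hIF)
      have h1 : I.Nonempty → ∃ s, IsLUB I s := by
        intro hn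
        rcases hI I hIF with ⟨x, rfl⟩ | rfl | ⟨x, rfl⟩ | ⟨x, rfl⟩ | ⟨x, y, rfl⟩
        · exact ⟨x, isLUB_singleton⟩
        · exact absurd hbI not_bddAbove_univ
        · exact absurd hbI (not_bddAbove_Ioi x)
        · exact ⟨x, isLUB_Iio⟩
        · exact ⟨y, isLUB_Ioo (Set.nonempty_Ioo.1 hn)⟩
      rcases I.eq_empty_or_nonempty with rfl | hn
      · rw [Set.empty_union]
        rw [Set.sUnion_insert, Set.empty_union] at hne
        exact ih hsubG hne
      · obtain ⟨s, hs⟩ := h1 hn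
        rcases (⋃₀ G).eq_empty_or_nonempty with h | h
        · exact ⟨s, by rwa [h, Set.union_empty]⟩
        · obtain ⟨t, ht⟩ := ih hsubG h
          exact ⟨_, hs.union ht⟩
  exact key F hF subset_rfl hne

/-- The formula saying that all points of a neighbourhood of the last variable satisfy `φ`. -/
noncomputable def nhdF (φ : L.Formula (ι ⊕ Unit)) : L.Formula (ι ⊕ Unit) :=
  ex1 (ex1 (ltF (Sum.inl (Sum.inr ())) (Sum.inl (Sum.inl (Sum.inr ()))) ⊓
    ltF (Sum.inl (Sum.inl (Sum.inr ()))) (Sum.inr ()) ⊓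
    all1 ((ltF (Sum.inl (Sum.inl (Sum.inr ()))) (Sum.inr ())).imp
      ((ltF (Sum.inr ()) (Sum.inl (Sum.inr ()))).imp
        (φ.relabel (Sum.map (Sum.inl ∘ Sum.inl ∘ Sum.inl) id))))))

theorem realize_nhdF {φ : L.Formula (ι ⊕ Unit)} {a : ι → M} {x : M} :
    (nhdF φ).Realize (Sum.elim a fun _ => x) ↔
      ∃ c d, c < x ∧ x < d ∧ ∀ z, c < z → z < d → φ.Realize (Sum.elim a fun _ => z) := by
  have h (c d z : M) : Sum.elim (Sum.elim (Sum.elim (Sum.elim a fun _ : Unit => x)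
      fun _ : Unit => c) fun _ : Unit => d) (fun _ : Unit => z) ∘
        Sum.map (Sum.inl ∘ Sum.inl ∘ Sum.inl) id = Sum.elim a fun _ => z := by
    ext (_ | _) <;> rfl
  simp only [nhdF, realize_ex1, Formula.realize_inf, realize_ltF, Sum.elim_inl, Sum.elim_inr,
    realize_all1, Formula.realize_imp, Formula.realize_relabel, h, and_assoc]

/-- Points of the open pieces of the decomposition are interior, so a non-interior point must be one
of the finitely many singleton pieces. -/
theorem finite_solSet_diff_nhdF [IsDLO M] (φ : L.Formula (ι ⊕ Unit)) (a : ι → M) :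
    (solSet (φ ⊓ (nhdF φ).not) a).Finite := by
  obtain ⟨F, hF, hI, hs⟩ := exists_intervals φ a
  refine (hF.preimage (f := fun x : M => ({x} : Set M))
    Set.singleton_injective.injOn).subset fun x hx => ?_
  simp only [solSet, Set.mem_ofPred_eq, Formula.realize_inf, Formula.realize_not,
    realize_nhdF] at hx
  obtain ⟨hx, hn⟩ := hx
  have hx' : x ∈ ⋃₀ F := hs ▸ hx
  obtain ⟨I, hIF, hxI⟩ := hx'
  have hsub : ∀ z ∈ I, φ.Realize (Sum.elim a fun _ => z) := fun z hz => by
    have : z ∈ ⋃₀ F := ⟨I, hIF, hz⟩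
    rw [← hs] at this
    exact this
  obtain ⟨l, hl⟩ := exists_lt x
  obtain ⟨r, hr⟩ := exists_gt x
  rcases hI I hIF with ⟨y, rfl⟩ | rfl | ⟨y, rfl⟩ | ⟨y, rfl⟩ | ⟨y, z, rfl⟩
  · obtain rfl : x = y := hxI
    exact hIF
  · exact (hn ⟨l, r, hl, hr, fun z _ _ => hsub z trivial⟩).elim
  · exact (hn ⟨y, r, hxI, hr, fun z h _ => hsub z h⟩).elim
  · exact (hn ⟨l, y, hl, hxI, fun z _ h => hsub z h⟩).elim
  · exact (hn ⟨y, z, hxI.1, hxI.2, fun z h h' => hsub z ⟨h, h'⟩⟩).elim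

/-- The order makes a finite definable set rigid: each element is either the least one or the
successor of an element with fewer predecessors. -/
theorem solSet_subset_dcl_of_finite {φ : L.Formula (ι ⊕ Unit)} {a : ι → M}
    (hfin : (solSet φ a).Finite) : solSet φ a ⊆ dcl L (Set.range a) := by
  have key : ∀ n : ℕ, ∀ c ∈ solSet φ a, (solSet φ a ∩ Set.Iio c).ncard = n →
      c ∈ dcl L (Set.range a) := by
    intro n
    induction n using Nat.strong_induction_on with
    | _ n ih =>
      intro c hc hn
      by_cases he : (solSet φ a ∩ Set.Iio c).Nonempty
      · obtain ⟨p, ⟨hp, hpc⟩, hmax⟩ := (hfin.inter_of_left (Set.Iio c)).exists_maximal he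
        have hpd : p ∈ dcl L (Set.range a) := by
          refine ih _ ?_ p hp rfl
          rw [← hn]
          refine Set.ncard_lt_ncard ?_ (hfin.inter_of_left _)
          refine ⟨fun x hx => ⟨hx.1, hx.2.trans hpc⟩, fun h => ?_⟩
          exact lt_irrefl p (h ⟨hp, hpc⟩).2
        refine mem_dcl_insert (b := p) ?_ hpd
        refine mem_dcl_of_formula (a := Sum.elim a fun _ : Unit => p) ?_
          ((φ.relabel (Sum.map Sum.inl id)) ⊓ ltF (Sum.inl (Sum.inr ())) (Sum.inr ()) ⊓
            all1 ((φ.relabel (Sum.map (Sum.inl ∘ Sum.inl) id)).imp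
              ((ltF (Sum.inl (Sum.inl (Sum.inr ()))) (Sum.inr ())).imp
                (ltF (Sum.inr ()) (Sum.inl (Sum.inr ()))).not))) fun z => ?_
        · rintro (i | _)
          · exact Or.inr ⟨i, rfl⟩
          · exact Or.inl rfl
        have h1 : Sum.elim (Sum.elim a fun _ : Unit => p) (fun _ : Unit => z) ∘
            Sum.map Sum.inl id = Sum.elim a fun _ => z := by
          ext (_ | _) <;> rfl
        have h2 (y) : Sum.elim (Sum.elim (Sum.elim a fun _ : Unit => p) fun _ : Unit => z)
            (fun _ : Unit => y) ∘ Sum.map (Sum.inl ∘ Sum.inl) id = Sum.elim a fun _ => y := by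
          ext (_ | _) <;> rfl
        simp only [Formula.realize_inf, Formula.realize_relabel, h1, realize_ltF, Sum.elim_inl,
          Sum.elim_inr, realize_all1, Formula.realize_imp, h2, Formula.realize_not, not_lt]
        have hc2 : ∀ y ∈ solSet φ a, p < y → c ≤ y := by
          intro y hy hpy
          by_contra hlt
          exact absurd (hmax ⟨hy, not_le.1 hlt⟩ hpy.le) (not_le.2 hpy)
        constructor
        · rintro ⟨⟨hz, hpz⟩, hmin⟩
          exact le_antisymm (hmin c hc hpc) (hc2 z hz hpz)
        · rintro rfl
          exact ⟨⟨hc, hpc⟩, hc2⟩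
      · refine mem_dcl_of_formula (a := a) (fun i => ⟨i, rfl⟩)
          (φ ⊓ all1 ((φ.relabel (Sum.map Sum.inl id)).imp
              (ltF (Sum.inr ()) (Sum.inl (Sum.inr ()))).not)) fun z => ?_
        have h1 (y) : Sum.elim (Sum.elim a fun _ : Unit => z) (fun _ : Unit => y) ∘
            Sum.map Sum.inl id = Sum.elim a fun _ => y := by
          ext (_ | _) <;> rfl
        simp only [Formula.realize_inf, Formula.realize_relabel, h1, realize_ltF, Sum.elim_inl,
          Sum.elim_inr, realize_all1, Formula.realize_imp, Formula.realize_not, not_lt]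
        have hc2 : ∀ y ∈ solSet φ a, c ≤ y := fun y hy => by
          by_contra hlt
          exact he ⟨y, hy, not_le.1 hlt⟩
        constructor
        · rintro ⟨hz, hmin⟩
          exact le_antisymm (hmin c hc) (hc2 z hz)
        · rintro rfl
          exact ⟨hc, hc2⟩
  exact fun c hc => key _ c hc rfl

/-- A point outside the definable closure of `A` is an interior point of each `A`-definable set
to which it belongs. -/
theorem exists_nhd_of_notMem_dcl [IsDLO M] {A : Set M} {b : M} (hb : b ∉ dcl L A)
    (φ : L.Formula (ι ⊕ Unit)) {a : ι → M} (ha : ∀ i, a i ∈ A)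
    (h : φ.Realize (Sum.elim a fun _ => b)) :
    ∃ c d, c < b ∧ b < d ∧ ∀ z, c < z → z < d → φ.Realize (Sum.elim a fun _ => z) := by
  rw [← realize_nhdF]
  by_contra hn
  -- Otherwise `b` belongs to the finite `a`-definable set of non-interior points, all of which are
  -- definable.
  refine hb (dcl_mono ?_ (solSet_subset_dcl_of_finite (finite_solSet_diff_nhdF φ a) ?_))
  · rintro _ ⟨i, rfl⟩
    exact ha i
  · simp only [solSet, Set.mem_ofPred_eq, Formula.realize_inf, Formula.realize_not]
    exact ⟨h, hn⟩

/-- A definable function that is locally constant on an interval is constant. -/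
theorem eq_of_locally_constant [IsDLO M] {θ : L.Formula ((ι ⊕ Unit) ⊕ Unit)} {a : ι → M}
    {f : M → M} {x y : M} (hxy : x ≤ y)
    (hf : ∀ t, x ≤ t → t ≤ y → ∃ c d, c < t ∧ t < d ∧ ∀ s, c < s → s < d → ∀ z,
      θ.Realize (Sum.elim (Sum.elim a fun _ => s) fun _ => z) ↔ z = f t) : f x = f y := by
  have hft : ∀ t, x ≤ t → t ≤ y → ∀ z,
      θ.Realize (Sum.elim (Sum.elim a fun _ => t) fun _ => z) ↔ z = f t := by
    intro t h1 h2
    obtain ⟨c, d, hc, hd, h⟩ := hf t h1 h2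
    exact h t hc hd
  -- The points `t` of `[x, y]` such that the function equals `f x` on all of `[x, t]`. By local
  -- constancy at the supremum `s`, the value there is `f x`, and the set would extend beyond `s` if
  -- `s < y`.
  let ψ : L.Formula ((ι ⊕ Fin 3) ⊕ Unit) :=
    (ltF (Sum.inr ()) (Sum.inl (Sum.inr 0))).not ⊓ (ltF (Sum.inl (Sum.inr 1)) (Sum.inr ())).not ⊓
      all1 ((ltF (Sum.inr ()) (Sum.inl (Sum.inl (Sum.inr 0)))).not.imp
        ((ltF (Sum.inl (Sum.inr ())) (Sum.inr ())).not.imp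
          (θ.relabel (Sum.elim (Sum.elim (Sum.inl ∘ Sum.inl ∘ Sum.inl) Sum.inr)
            fun _ => Sum.inl (Sum.inl (Sum.inr 2))))))
  have hS (t) : t ∈ solSet ψ (Sum.elim a ![x, y, f x]) ↔
      x ≤ t ∧ t ≤ y ∧ ∀ s, x ≤ s → s ≤ t →
        θ.Realize (Sum.elim (Sum.elim a fun _ => s) fun _ => f x) := by
    have h (s : M) : Sum.elim (Sum.elim (Sum.elim a ![x, y, f x]) fun _ : Unit => t)
        (fun _ : Unit => s) ∘ (Sum.elim (Sum.elim (Sum.inl ∘ Sum.inl ∘ Sum.inl) Sum.inr)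
            fun _ : Unit => Sum.inl (Sum.inl (Sum.inr 2))) =
        Sum.elim (Sum.elim a fun _ : Unit => s) fun _ : Unit => f x := by
      ext ((_ | _) | _) <;> rfl
    simp [solSet, ψ, Formula.realize_inf, Formula.realize_not, realize_ltF, realize_all1,
      Formula.realize_imp, Formula.realize_relabel, h, and_assoc]
  have hx : x ∈ solSet ψ (Sum.elim a ![x, y, f x]) := by
    rw [hS]
    refine ⟨le_rfl, hxy, fun s h1 h2 => ?_⟩
    obtain rfl := le_antisymm h1 h2
    exact (hft _ le_rfl hxy _).2 rfl
  obtain ⟨s, hs⟩ := exists_isLUB ψ (Sum.elim a ![x, y, f x]) ⟨x, hx⟩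
    ⟨y, fun t ht => ((hS t).1 ht).2.1⟩
  have hxs : x ≤ s := hs.1 hx
  have hsy : s ≤ y := hs.2 fun t ht => ((hS t).1 ht).2.1
  obtain ⟨c, d, hc, hd, hcd⟩ := hf s hxs hsy
  obtain ⟨t, ht, hct, hts⟩ := hs.exists_between hc
  obtain ⟨hxt, hty, hall⟩ := (hS t).1 ht
  have hfs : f x = f s := by
    have := hall t hxt le_rfl
    rwa [hcd t hct (hts.trans_lt hd)] at this
  rcases hsy.eq_or_lt with rfl | hlt
  · exact hfs
  · obtain ⟨r, hr1, hr2⟩ := exists_between (lt_min hlt hd)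
    refine absurd (hs.1 ((hS r).2 ⟨hxs.trans hr1.le, hr2.le.trans (min_le_left _ _),
      fun q hq1 hq2 => ?_⟩)) (not_le.2 hr1)
    rcases le_or_gt q t with h | h
    · exact hall q hq1 h
    · rw [hcd q (hct.trans h) (hq2.trans_lt (hr2.trans_le (min_le_right _ _)))]
      exact hfs

/-- Write `c = f b` with `f` definable over `A`. If `b` is not definable over `A` and `c`, it is
interior to the fibre over `c`, so `f` is constant near `b`. The points of local constancy form
finitely many intervals and points, with one value of `f` on each. So `c` lies in a finite
`A`-definable set of values, hence in `dcl L A`. -/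
theorem exchange [IsDLO M] {A : Set M} {b c : M} (hc : c ∈ dcl L (insert b A))
    (hcA : c ∉ dcl L A) : b ∈ dcl L (insert c A) := by
  by_contra hb
  have hins : insert b A = Set.range (Sum.elim (Subtype.val : A → M) fun _ : Unit => b) := by
    rw [Set.Sum.elim_range]
    simp
  rw [hins, mem_dcl_range] at hc
  obtain ⟨φ, hφ⟩ := hc
  let θ := uniqF φ
  have hθ (x z : M) : θ.Realize (Sum.elim (Sum.elim (Subtype.val : A → M) fun _ : Unit => x)
      fun _ => z) ↔
      ∀ y, φ.Realize (Sum.elim (Sum.elim (Subtype.val : A → M) fun _ => x) fun _ => y) ↔ y = z :=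
    realize_uniqF
  have hθu {x z z' : M} (h : θ.Realize (Sum.elim (Sum.elim (Subtype.val : A → M)
      fun _ : Unit => x) fun _ => z)) (h' : θ.Realize (Sum.elim (Sum.elim (Subtype.val : A → M)
      fun _ : Unit => x) fun _ => z')) : z = z' := by
    rw [hθ] at h h'
    exact (h' z).1 ((h z).2 rfl)
  -- the set of pairs `(c, x)` such that the function has the value `c` near `x`
  let σ : L.Formula ((A ⊕ Unit) ⊕ Unit) :=
    nhdF (θ.relabel (Sum.elim (Sum.elim (Sum.inl ∘ Sum.inl) Sum.inr) fun _ => Sum.inl (Sum.inr ())))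
  have hrel (x z : M) : Sum.elim (Sum.elim (Subtype.val : A → M) fun _ : Unit => z)
      (fun _ : Unit => x) ∘
      (Sum.elim (Sum.elim (Sum.inl ∘ Sum.inl) Sum.inr) fun _ : Unit => Sum.inl (Sum.inr ())) =
      Sum.elim (Sum.elim (Subtype.val : A → M) fun _ : Unit => x) fun _ : Unit => z := by
    ext ((_ | _) | _) <;> rfl
  have hσ (x z : M) : σ.Realize (Sum.elim (Sum.elim (Subtype.val : A → M) fun _ => z)
      fun _ => x) ↔ ∃ l r, l < x ∧ x < r ∧ ∀ y, l < y → y < r →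
        θ.Realize (Sum.elim (Sum.elim (Subtype.val : A → M) fun _ : Unit => y) fun _ => z) := by
    simp only [σ, realize_nhdF, Formula.realize_relabel, hrel]
  have hσc : σ.Realize (Sum.elim (Sum.elim (Subtype.val : A → M) fun _ => c) fun _ => b) := by
    have := exists_nhd_of_notMem_dcl hb (θ.relabel (Sum.elim (Sum.elim (Sum.inl ∘ Sum.inl) Sum.inr)
      fun _ => Sum.inl (Sum.inr ()))) (a := Sum.elim (Subtype.val : A → M) fun _ => c) (by
        rintro (i | _)
        · exact Or.inr i.2
        · exact Or.inl rfl) (by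
        rw [Formula.realize_relabel, hrel, hθ]
        exact hφ)
    simpa only [hσ, Formula.realize_relabel, hrel] using this
  -- the values of the function at such points form a finite set
  let τ : L.Formula (A ⊕ Unit) := ex1 σ
  have hτ (z : M) : z ∈ solSet τ (Subtype.val : A → M) ↔
      ∃ x, σ.Realize (Sum.elim (Sum.elim (Subtype.val : A → M) fun _ => z) fun _ => x) := by
    simp [solSet, τ]
  have hfin : (solSet τ (Subtype.val : A → M)).Finite := by
    let ρ : L.Formula (A ⊕ Unit) :=
      ex1 (σ.relabel (Sum.elim (Sum.elim (Sum.inl ∘ Sum.inl) Sum.inr)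
          fun _ => Sum.inl (Sum.inr ())))
    have hρ (x : M) : x ∈ solSet ρ (Subtype.val : A → M) ↔
        ∃ z, σ.Realize (Sum.elim (Sum.elim (Subtype.val : A → M) fun _ => z) fun _ => x) := by
      have h1 (z : M) : Sum.elim (Sum.elim (Subtype.val : A → M) fun _ : Unit => x)
        (fun _ : Unit => z) ∘
        (Sum.elim (Sum.elim (Sum.inl ∘ Sum.inl) Sum.inr) fun _ : Unit => Sum.inl (Sum.inr ())) =
        Sum.elim (Sum.elim (Subtype.val : A → M) fun _ : Unit => z) fun _ : Unit => x := by
        ext ((_ | _) | _) <;> rfl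
      simp only [solSet, ρ, realize_ex1, Formula.realize_relabel, h1, Set.mem_ofPred_eq]
    choose! f hf using fun x => (hρ x).1
    have hfu {x z} (h : σ.Realize (Sum.elim (Sum.elim (Subtype.val : A → M) fun _ => z)
        fun _ => x)) : z = f x := by
      have h' := hf x ((hρ x).2 ⟨z, h⟩)
      rw [hσ] at h h'
      obtain ⟨l, r, hl, hr, h⟩ := h
      obtain ⟨l', r', hl', hr', h'⟩ := h'
      exact hθu (h x hl hr) (h' x hl' hr')
    have hconst {x y : M} (hxy : x ≤ y) (hI : ∀ t, x ≤ t → t ≤ y →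
        t ∈ solSet ρ (Subtype.val : A → M)) : f x = f y := by
      refine eq_of_locally_constant (θ := θ) (a := (Subtype.val : A → M)) hxy fun t h1 h2 => ?_
      obtain ⟨l, r, hl, hr, h⟩ := (hσ _ _).1 (hf t (hI t h1 h2))
      refine ⟨l, r, hl, hr, fun s hs1 hs2 z => ⟨fun hz => hθu hz (h s hs1 hs2), ?_⟩⟩
      rintro rfl
      exact h s hs1 hs2
    obtain ⟨F, hF, hI, hs⟩ := exists_intervals ρ (Subtype.val : A → M)
    have hsubset : solSet τ (Subtype.val : A → M) ⊆ ⋃ I ∈ F, f '' I := by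
      intro z hz
      obtain ⟨x, hx⟩ := (hτ z).1 hz
      have hxρ := (hρ x).2 ⟨z, hx⟩
      rw [hs] at hxρ
      obtain ⟨I, hIF, hxI⟩ := hxρ
      exact Set.mem_biUnion hIF ⟨x, hxI, (hfu hx).symm⟩
    refine (hF.biUnion fun I hIF => ?_).subset hsubset
    refine Set.Subsingleton.finite ?_
    have hsub : I ⊆ solSet ρ (Subtype.val : A → M) := hs ▸ Set.subset_sUnion_of_mem hIF
    have hord : I.OrdConnected := by
      rcases hI I hIF with ⟨x, rfl⟩ | rfl | ⟨x, rfl⟩ | ⟨x, rfl⟩ | ⟨x, y, rfl⟩ <;> infer_instance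
    rintro _ ⟨x, hx, rfl⟩ _ ⟨y, hy, rfl⟩
    rcases le_total x y with h | h
    · exact hconst h fun t h1 h2 => hsub (hord.out hx hy ⟨h1, h2⟩)
    · exact (hconst h fun t h1 h2 => hsub (hord.out hy hx ⟨h1, h2⟩)).symm
  have hmem := solSet_subset_dcl_of_finite hfin ((hτ c).2 ⟨b, hσc⟩)
  rw [Subtype.range_coe] at hmem
  exact hcA hmem

end OMinimal

/-! ### Ultrapowers and compactness. -/

section Compactness

variable {L : FirstOrder.Language.{u, v}}

/-- The diagonal embedding of a structure into an ultrapower. -/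
noncomputable def diagonal (M : Type w) [Nonempty M] [L.Structure M] {I : Type*}
    (U : Ultrafilter I) : M ↪ₑ[L] (U : Filter I).Product fun _ => M where
  toFun m := ((fun _ => m : I → M) : (U : Filter I).Product fun _ => M)
  map_formula' n φ x := by
    have := Ultraproduct.realize_formula_cast (M := fun _ : I => M) (u := U) φ (fun i _ => x i)
    simp only [Filter.eventually_const] at this
    exact this

/-- Compactness: a set of formulas with parameters in `N` that is finitely satisfiable in `N` is
realized in an elementary extension of `N`. -/
theorem exists_elementary_extension {N : Type w} [Nonempty N] [L.Structure N] {α : Type}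
    (S : Set (L.Formula (N ⊕ α)))
    (hS : ∀ s : Finset (L.Formula (N ⊕ α)), (s : Set _) ⊆ S →
      ∃ x : α → N, ∀ φ ∈ s, φ.Realize (Sum.elim id x)) :
    ∃ (N' : Type (max u v w)) (_ : L.Structure N') (i : N ↪ₑ[L] N') (x : α → N'),
      ∀ φ ∈ S, φ.Realize (Sum.elim i x) := by
  classical
  -- Refining `atTop` puts into `U`, for each formula in `S`, the set of all `s` that contain it;
  -- the chosen realizations for the sets `s` then give a point of the ultrapower that satisfies all
  -- of `S`.
  let U : Ultrafilter (Finset S) := Ultrafilter.of Filter.atTop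
  have hS' (s : Finset S) : ∃ x : α → N, ∀ φ ∈ s, φ.1.Realize (Sum.elim id x) := by
    obtain ⟨x, hx⟩ := hS (s.map (Function.Embedding.subtype _)) (by
      intro φ hφ
      obtain ⟨ψ, -, rfl⟩ := Finset.mem_map.1 hφ
      exact ψ.2)
    exact ⟨x, fun φ hφ => hx _ (Finset.mem_map_of_mem _ hφ)⟩
  choose x hx using hS'
  refine ⟨(U : Filter (Finset S)).Product fun _ => N, inferInstance, diagonal N U,
    fun k => ((fun s => x s k : Finset S → N) : (U : Filter (Finset S)).Product fun _ => N),
    fun φ hφ => ?_⟩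
  have h1 := (Ultraproduct.realize_formula_cast (M := fun _ : Finset S => N) (u := U) φ
    (Sum.elim (fun n _ => n) fun k s => x s k)).2 (by
      have h2 : ∀ᶠ s in (U : Filter (Finset S)), {(⟨φ, hφ⟩ : S)} ≤ s :=
        Filter.Eventually.filter_mono (Ultrafilter.of_le _) (Filter.eventually_ge_atTop _)
      filter_upwards [h2] with s hs
      have h3 := hx s ⟨φ, hφ⟩ (hs (Finset.mem_singleton_self _))
      convert h3 using 1
      ext (_ | _) <;> rfl)
  refine Eq.mp (congrArg φ.Realize (funext ?_)) h1
  rintro (_ | _) <;> rfl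

end Compactness

/-! ### Models of `T` in all universes and their orders. -/

section Models

variable {L : FirstOrder.Language.{u, v}}

/-- Complete o-minimal theories that extend the theory of densely ordered groups. -/
structure IsGood [L.IsOrdered] (add : L.Functions 2) (T : L.Theory) : Prop where
  complete : T.IsComplete
  group : Extends T (denselyOrderedGroupTheory add)
  omin : IsOMinimal T

theorem model_of_extends {T T' : L.Theory} (h : Extends T T')
    (M : Type w) [Nonempty M] [L.Structure M] [M ⊨ T] : M ⊨ T' :=
  ⟨fun φ hφ => (h φ hφ).realize_sentence M⟩

theorem realize_ltF_iff [L.IsOrdered] {M : Type w} [L.Structure M] {α : Type*}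
    {x y : α} {v : α → M} : (ltF x y : L.Formula α).Realize v ↔ Lt L M (v x) (v y) := by
  simp [ltF, Lt]

/-- A model has a small elementary substructure containing given elements. -/
theorem exists_small_elementary {T : L.Theory} (M : Type w) [Nonempty M] [L.Structure M] [M ⊨ T]
    {n : ℕ} (b : Fin n → M) : ∃ (K : Theory.ModelType.{u, v, max u v} T) (i : K ↪ₑ[L] M)
      (b' : Fin n → K), i ∘ b' = b := by
  -- The Skolem hull of a finite tuple is bounded by the size of the language, so it can be moved to
  -- the universe `max u v`.
  let S := (Substructure.closure (L.sum L.skolem₁) (Set.range b)).elementarySkolem₁Reduct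
  have hS : Small.{max u v} S := by
    rw [Substructure.coeSort_elementarySkolem₁Reduct]
    infer_instance
  let e := equivShrink S
  let := e.inducedStructure (L := L)
  let j : S ≃[L] Shrink.{max u v} S := e.inducedStructureEquiv
  let i : Shrink.{max u v} S ↪ₑ[L] M := S.subtype.comp j.symm.toElementaryEmbedding
  have : Nonempty S := S.elementarilyEquivalent.symm.nonempty
  have : Nonempty (Shrink.{max u v} S) := e.symm.nonempty
  have : (Shrink.{max u v} S) ⊨ T := (i.theory_model_iff T).2 inferInstance
  refine ⟨Theory.ModelType.of T (Shrink.{max u v} S), i, fun k => e ⟨b k, ?_⟩, ?_⟩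
  · exact Substructure.subset_closure ⟨k, rfl⟩
  · ext k
    change ((e.symm (e ⟨b k, _⟩) : S) : M) = b k
    simp

/-- `IsOMinimal` only speaks of models in one universe. The finitely many parameters of a definable
set lie in a small elementary substructure; the decomposition found there is expressed by a formula
with parameters and passes to `M`. -/
theorem isOMinimalStructure_of_model [L.IsOrdered] {T : L.Theory} (hT : IsOMinimal T)
    (M : Type w) [Nonempty M] [L.Structure M] [M ⊨ T] : IsOMinimalStructure L M := by
  intro s hs
  rw [Set.Definable₁, Set.definable_iff_exists_formula_sum] at hs
  obtain ⟨φ, hφ⟩ := hs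
  obtain ⟨n, b, ψ, hψ⟩ := exists_finite_support φ
  obtain ⟨K, i, b', hb⟩ := exists_small_elementary (T := T) M (fun k => (b k : M))
  have hs (x : M) : x ∈ s ↔ ψ.Realize (Sum.elim (i ∘ b') fun _ => x) := by
    rw [hb]
    have h1 := Set.ext_iff.1 hφ fun _ => x
    simp only [Set.mem_ofPred_eq] at h1
    exact h1.trans (hψ M _ _)
  have hdef : (Set.univ : Set K).Definable₁ L
      {x : K | ψ.Realize (Sum.elim b' fun _ => x)} := by
    rw [Set.Definable₁, Set.definable_iff_exists_formula_sum]
    refine ⟨ψ.relabel (Sum.map (fun k => ⟨b' k, trivial⟩) id), ?_⟩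
    ext x
    simp only [Formula.realize_relabel, Set.mem_ofPred_eq]
    have : Sum.elim (fun y : (Set.univ : Set K) => (y : K)) x ∘
        Sum.map (fun k => ⟨b' k, trivial⟩) id = Sum.elim b' fun _ => x 0 := by
      ext (_ | k)
      · rfl
      · simp [Subsingleton.elim k 0]
    rw [this]
  obtain ⟨F, hF, hI, hFs⟩ := hT K _ hdef
  have hχ (I : F) : ∃ χ : L.Formula (K ⊕ Unit),
      (∀ x, x ∈ I.1 ↔ χ.Realize (Sum.elim id fun _ => x)) ∧
      IsPointOrInterval L M {x | χ.Realize (Sum.elim i fun _ => x)} := by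
    rcases hI I I.2 with ⟨a, h⟩ | h | ⟨a, h⟩ | ⟨a, h⟩ | ⟨a, a', h⟩
    · exact ⟨eqF (Sum.inr ()) (Sum.inl a), fun x => by simp [h], Or.inl ⟨i a, by ext; simp⟩⟩
    · exact ⟨⊤, fun x => by simp [h], Or.inr (Or.inl (by ext; simp))⟩
    · exact ⟨ltF (Sum.inl a) (Sum.inr ()), fun x => by simp [h, realize_ltF_iff],
        Or.inr (Or.inr (Or.inl ⟨i a, by ext; simp [realize_ltF_iff]⟩))⟩
    · exact ⟨ltF (Sum.inr ()) (Sum.inl a), fun x => by simp [h, realize_ltF_iff],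
        Or.inr (Or.inr (Or.inr (Or.inl ⟨i a, by ext; simp [realize_ltF_iff]⟩)))⟩
    · exact ⟨ltF (Sum.inl a) (Sum.inr ()) ⊓ ltF (Sum.inr ()) (Sum.inl a'),
        fun x => by simp [h, realize_ltF_iff],
        Or.inr (Or.inr (Or.inr (Or.inr ⟨i a, i a', by ext; simp [realize_ltF_iff]⟩)))⟩
  choose χ hχ1 hχ2 using hχ
  have := hF.to_subtype
  refine ⟨Set.range fun I : F => {x | (χ I).Realize (Sum.elim i fun _ => x)},
    Set.finite_range _, ?_, ?_⟩
  · rintro _ ⟨I, rfl⟩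
    exact hχ2 I
  · let ξ : L.Formula K := all1 ((ψ.relabel (Sum.map b' fun _ => ())).iff (Formula.iSup χ))
    have e1 (x : K) : Sum.elim id (fun _ : Unit => x) ∘ Sum.map b' (fun _ : Fin 1 => ()) =
        Sum.elim b' fun _ => x := by
      ext (_ | _) <;> rfl
    have e2 (x : M) : Sum.elim i (fun _ : Unit => x) ∘ Sum.map b' (fun _ : Fin 1 => ()) =
        Sum.elim (i ∘ b') fun _ => x := by
      ext (_ | _) <;> rfl
    have h1 := i.map_formula ξ id
    simp only [ξ, realize_all1, Formula.realize_iff, Formula.realize_relabel, Function.comp_id,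
      e1, e2, Formula.realize_iSup] at h1
    have h2 := h1.2 fun x => by
      have := Set.ext_iff.1 hFs x
      simp only [Set.mem_ofPred_eq, Set.mem_sUnion] at this
      rw [this]
      constructor
      · rintro ⟨I, hI, hx⟩
        exact ⟨⟨I, hI⟩, (hχ1 ⟨I, hI⟩ x).1 hx⟩
      · rintro ⟨I, hx⟩
        exact ⟨I, I.2, (hχ1 I x).2 hx⟩
    ext x
    rw [hs, h2]
    simp

theorem exists_linearOrder [L.IsOrdered] {add : L.Functions 2} {T : L.Theory} (hT : IsGood add T)
    (M : Type w) [Nonempty M] [L.Structure M] [M ⊨ T] :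
    ∃ _ : LinearOrder M, IsOMin L M ∧ IsDLO M := by
  classical
  have h1 : M ⊨ L.dlo := (model_of_extends hT.group M).mono Set.subset_union_left
  let lo : LinearOrder M := L.linearOrderOfModels M
  have ho : L.OrderedStructure M := inferInstanceAs (@OrderedStructure L M _ (L.leOfStructure M) _)
  have hd : DenselyOrdered M := denselyOrdered_of_dlo L M
  have ht : NoTopOrder M := noTopOrder_of_dlo L M
  have hb : NoBotOrder M := noBotOrder_of_dlo L M
  exact ⟨lo, ⟨isOMinimalStructure_of_model hT.omin M⟩,
    { NoBotOrder.to_noMinOrder M, NoTopOrder.to_noMaxOrder M with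
    nonempty := inferInstance }⟩

/-- The operation of an ordered group. -/
def op (add : L.Functions 2) {M : Type w} [L.Structure M] (x y : M) : M :=
  Structure.funMap add ![x, y]

/-- The formula `x = y + z`. -/
def opF {α : Type*} (add : L.Functions 2) (x y z : α) : L.Formula α :=
  (Term.var x).equal (add.apply₂ (Term.var y) (Term.var z))

@[simp]
theorem realize_opF {α : Type*} {add : L.Functions 2} {M : Type w} [L.Structure M] {x y z : α}
    {v : α → M} : (opF add x y z).Realize v ↔ v x = op add (v y) (v z) := by
  simp [opF, op]

/-! ### Cancellation and translations. -/

section Group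

variable [L.IsOrdered] {add : L.Functions 2} {T : L.Theory} (hT : IsGood add T)
  {M : Type w} [Nonempty M] [L.Structure M] [M ⊨ T]
include hT

theorem op_assoc (x y z : M) : op add (op add x y) z = op add x (op add y z) := by
  have h1 := (model_of_extends hT.group M).realize_of_mem (addAssocSentence add) (by
    simp [denselyOrderedGroupTheory])
  simp [addAssocSentence, Sentence.Realize, Formula.Realize, Fin.snoc] at h1
  exact h1 x y z

theorem exists_zero_neg : ∃ e : M, ∀ x : M, op add e x = x ∧ op add x e = x ∧
    ∃ y, op add x y = e ∧ op add y x = e := by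
  have h1 := (model_of_extends hT.group M).realize_of_mem (addZeroNegSentence add) (by
    simp [denselyOrderedGroupTheory])
  simp [addZeroNegSentence, Sentence.Realize, Formula.Realize, Fin.snoc] at h1
  simpa [op, and_assoc] using h1

theorem op_mono [LinearOrder M] [L.OrderedStructure M] {x y : M} (h : x ≤ y) (z : M) :
    op add x z ≤ op add y z := by
  have h1 := (model_of_extends hT.group M).realize_of_mem (addMonoSentence add) (by
    simp [denselyOrderedGroupTheory])
  simp [addMonoSentence, Sentence.Realize, Formula.Realize, Fin.snoc] at h1
  exact (h1 x y z h).1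

theorem op_right_cancel {x y z : M} (h : op add x z = op add y z) : x = y := by
  obtain ⟨e, he⟩ := exists_zero_neg hT (M := M)
  obtain ⟨z', hz, -⟩ := (he z).2.2
  have := congrArg (fun t => op add t z') h
  simpa only [op_assoc hT, hz, (he _).2.1] using this

theorem op_left_cancel {x y z : M} (h : op add z x = op add z y) : x = y := by
  obtain ⟨e, he⟩ := exists_zero_neg hT (M := M)
  obtain ⟨z', -, hz⟩ := (he z).2.2
  have := congrArg (fun t => op add z' t) h
  simpa only [← op_assoc hT, hz, (he _).1] using this

theorem exists_translate [LinearOrder M] [L.OrderedStructure M] {a b : M} (h : a < b) (s : M) :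
    ∃ c d, c < d ∧ ∀ z, c < z → z < d → a < op add z s ∧ op add z s < b := by
  obtain ⟨e, he⟩ := exists_zero_neg hT (M := M)
  obtain ⟨s', hs, hs'⟩ := (he s).2.2
  have hlt : ∀ {x y : M} (z : M), x < y → op add x z < op add y z := fun z hxy =>
    (op_mono hT hxy.le z).lt_of_ne fun h => hxy.ne (op_right_cancel hT h)
  have hc (x : M) : op add (op add x s') s = x := by rw [op_assoc hT, hs', (he x).2.1]
  refine ⟨op add a s', op add b s', hlt s' h, fun z h1 h2 => ?_⟩
  have h3 := hlt s h1
  have h4 := hlt s h2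
  rw [hc] at h3 h4
  exact ⟨h3, h4⟩

end Group

end Models

/-! ### The predicates `P` and `E`, and the meaning of the axioms. -/

section Expansions

/-- The set named by `P`. -/
def setP (N : Type w) [peLanguage.Structure N] : Set N :=
  {x | @Structure.RelMap peLanguage N _ 1 PERel.P ![x]}

/-- The relation named by `E`. -/
def relE {N : Type w} [peLanguage.Structure N] (x y : N) : Prop :=
  @Structure.RelMap peLanguage N _ 2 PERel.E ![x, y]

/-- `E` has at least `n` classes. -/
def AtLeast (N : Type w) [peLanguage.Structure N] (n : ℕ) : Prop :=
  ∃ x : Fin n → N, (∀ i, x i ∈ setP N) ∧ ∀ i j, i ≠ j → ¬ relE (x i) (x j)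

variable {L : FirstOrder.Language.{u, v}}

/-- An `L`-formula as an `L_e`-formula. -/
abbrev liftF {α : Type*} (φ : L.Formula α) : (Le L).Formula α :=
  (LHom.sumInl : L →ᴸ Le L).onFormula φ

/-- The formula `P x`. -/
def memF {α : Type*} (x : α) : (Le L).Formula α := (symP L).formula₁ (Term.var x)

/-- The formula `E x y`. -/
def relF {α : Type*} (x y : α) : (Le L).Formula α := (symE L).formula₂ (Term.var x) (Term.var y)

/-- Every `L_e`-structure is the sum of its two reducts, so it can be replaced by one given by
separate `L`- and `P, E`-structures. -/
theorem exists_eq_sumStructure {N : Type w} (s : (Le L).Structure N) :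
    ∃ (a : L.Structure N) (b : peLanguage.Structure N),
      s = @Language.sumStructure L peLanguage N a b := by
  refine ⟨(LHom.sumInl : L →ᴸ Le L).reduct N, (LHom.sumInr : peLanguage →ᴸ Le L).reduct N, ?_⟩
  ext n f x
  · rcases f with f | f <;> rfl
  · rcases f with f | f <;> rfl

variable {N : Type w} [L.Structure N] [peLanguage.Structure N]

@[simp]
theorem realize_memF {α : Type*} {x : α} {v : α → N} :
    (memF x : (Le L).Formula α).Realize v ↔ v x ∈ setP N := by
  simp only [memF, Formula.realize_rel₁]
  exact Iff.rfl

@[simp]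
theorem realize_relF {α : Type*} {x y : α} {v : α → N} :
    (relF x y : (Le L).Formula α).Realize v ↔ relE (v x) (v y) := by
  simp only [relF, Formula.realize_rel₂]
  exact Iff.rfl

theorem relMap_symP {x : Fin 1 → N} : Structure.RelMap (symP L) x ↔ x 0 ∈ setP N := by
  have : x = ![x 0] := by ext i; simp [Subsingleton.elim i 0]
  rw [this]
  exact Iff.rfl

theorem relMap_symE {x : Fin 2 → N} : Structure.RelMap (symE L) x ↔ relE (x 0) (x 1) := by
  have : x = ![x 0, x 1] := by ext i; fin_cases i <;> rfl
  rw [this]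
  exact Iff.rfl

instance [L.IsOrdered] [LE N] [L.OrderedStructure N] : (Le L).OrderedStructure N :=
  ⟨fun x => relMap_leSymb (L := L) x⟩

theorem realize_atLeastSentence {n : ℕ} : N ⊨ atLeastSentence L n ↔ AtLeast N n := by
  simp only [atLeastSentence, inequivFormula, Sentence.Realize, Formula.realize_iExs,
    Formula.realize_relabel, Sum.elim_comp_inr, Formula.realize_inf, Formula.realize_iInf,
    Formula.realize_rel₁, Formula.realize_rel₂, Formula.realize_not, relMap_symP, relMap_symE,
    AtLeast, Subtype.forall, Prod.forall]
  exact Iff.rfl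

theorem realize_indepSentence {n : ℕ} {φ : L.Formula (Fin (n + 1))} :
    N ⊨ indepSentence φ ↔ ∀ v : Fin (n + 1) → N, (∀ i, v i ∈ setP N) →
      (∀ i : Fin n, v 0 ≠ v i.succ) →
        ¬ ∀ z, φ.Realize (Fin.cons z fun i => v i.succ) ↔ z = v 0 := by
  have h1 (v : Fin (n + 1) → N) (z : Unit → N) :
      (fun a => Sum.elim v z a) ∘ (Fin.cons (Sum.inr ()) fun i : Fin n => Sum.inl i.succ) =
        Fin.cons (z ()) fun i => v i.succ := by
    ext i
    refine Fin.cases ?_ (fun i => ?_) i <;> simp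
  have h2 (v : Fin (n + 1) → N) : (Fin.cons (v 0) fun i => v i.succ) = v := Fin.cons_self_tail v
  simp only [indepSentence, Sentence.Realize, Formula.realize_iAlls, Formula.realize_relabel,
    Formula.realize_imp, Formula.realize_inf, Formula.realize_iInf, Formula.realize_not,
    Formula.realize_rel₁, Formula.realize_equal, LHom.realize_onFormula, relMap_symP, h1]
  refine forall_congr' fun v => ?_
  have h3 : (fun a => Sum.elim (default : Empty → N) v a) ∘ Sum.inr = v := rfl
  simp only [h3, Term.realize_var, Matrix.cons_val_fin_one, and_imp, Sum.elim_inl, Sum.elim_inr]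
  refine imp_congr_right fun _ => imp_congr_right fun _ => not_congr ?_
  constructor
  · rintro ⟨h4, h5⟩ z
    refine ⟨fun h => h5 (fun _ => z) h, ?_⟩
    rintro rfl
    rwa [h2]
  · intro h4
    refine ⟨?_, fun z hz => (h4 _).1 hz⟩
    have := (h4 (v 0)).2 rfl
    rwa [h2] at this

theorem forall_indepSentence_iff : (∀ σ ∈ indepAxioms L, N ⊨ σ) ↔
    ∀ p ∈ setP N, p ∉ dcl L (setP N \ {p}) := by
  constructor
  · rintro h p hp ⟨n, a, φ, ha, hφ⟩
    have := realize_indepSentence.1 (h _ ⟨n, φ.relabel (Sum.elim Fin.succ fun _ => 0), rfl⟩)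
      (Fin.cons p a) (fun i => Fin.cases hp (fun i => (ha i).1) i) fun i h => (ha i).2 (by
        simpa using h.symm)
    refine this fun z => ?_
    rw [Formula.realize_relabel]
    have h2 : (Fin.cons z fun i : Fin n => (Fin.cons p a : Fin (n + 1) → N) i.succ) ∘
        (Sum.elim Fin.succ fun _ : Unit => 0) = Sum.elim a fun _ => z := by
      ext (_ | _) <;> simp
    rw [h2]
    exact hφ z
  · rintro h _ ⟨n, φ, rfl⟩
    rw [realize_indepSentence]
    intro v hv hne hφ
    refine h (v 0) (hv 0) (mem_dcl_of_formula (a := fun i : Fin n => v i.succ)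
      (fun i => ⟨hv _, fun h => hne i h.symm⟩)
      (φ.relabel (Fin.cons (Sum.inr ()) fun i => Sum.inl i)) fun z => ?_)
    rw [Formula.realize_relabel, ← hφ z]
    have h2 : (Sum.elim (fun i : Fin n => v i.succ) fun _ : Unit => z) ∘
        (Fin.cons (Sum.inr ()) fun i : Fin n => Sum.inl i) = Fin.cons z fun i => v i.succ := by
      ext i
      refine Fin.cases ?_ (fun i => ?_) i <;> simp
    rw [h2]

end Expansions

section Models

variable {L : FirstOrder.Language.{u, v}} [L.IsOrdered]

/-- The models of `T_e`. -/
structure IsTe (T : L.Theory) (N : Type w) [L.Structure N] [peLanguage.Structure N]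
    [LinearOrder N] : Prop where
  model : N ⊨ T
  dense : ∀ a b : N, a < b → ∃ p ∈ setP N, a < p ∧ p < b
  indep : ∀ p ∈ setP N, p ∉ dcl L (setP N \ {p})
  mem_of_relE : ∀ x y : N, relE x y → x ∈ setP N ∧ y ∈ setP N
  refl : ∀ x ∈ setP N, relE x x
  symm : ∀ x y : N, relE x y → relE y x
  trans : ∀ x y z : N, relE x y → relE y z → relE x z
  dense_class : ∀ p ∈ setP N, ∀ a b : N, a < b → ∃ q, relE p q ∧ a < q ∧ q < b

variable {T : L.Theory} {N : Type w} [L.Structure N] [peLanguage.Structure N] [LinearOrder N]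
  [L.OrderedStructure N]

theorem model_Te_iff : N ⊨ Te T ↔ IsTe T N := by
  have hT : N ⊨ (LHom.sumInl : L →ᴸ Le L).onTheory T ↔ N ⊨ T :=
    LHom.onTheory_model (LHom.sumInl : L →ᴸ Le L) T
  have hd : N ⊨ denseSentence L ↔ ∀ a b : N, a < b → ∃ p ∈ setP N, a < p ∧ p < b := by
    simp [denseSentence, Sentence.Realize, Formula.Realize, Fin.snoc, relMap_symP]
  have hc : N ⊨ denseClassesSentence L ↔ ∀ p a b : N, p ∈ setP N →
      (∃ q ∈ setP N, a < q ∧ q < b) → ∃ q, relE p q ∧ a < q ∧ q < b := by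
    simp [denseClassesSentence, Sentence.Realize, Formula.Realize, Fin.snoc, relMap_symP,
      relMap_symE]
  have he : N ⊨ equivAxioms L ↔ (∀ x y : N, relE x y → x ∈ setP N ∧ y ∈ setP N) ∧
      (∀ x ∈ setP N, relE x x) ∧ (∀ x y : N, relE x y → relE y x) ∧
      ∀ x y z : N, relE x y → relE y z → relE x z := by
    simp [equivAxioms, Sentence.Realize, Formula.Realize, Fin.snoc, relMap_symP,
      relMap_symE]
  rw [Te, Theory.model_union_iff, Theory.model_union_iff, Theory.model_union_iff,
    Theory.model_union_iff, Theory.model_singleton_iff, Theory.model_singleton_iff, hT, hd, hc, he,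
    Theory.model_iff (indepAxioms L), forall_indepSentence_iff]
  constructor
  · rintro ⟨⟨⟨⟨h1, h2⟩, h3⟩, h4, h5, h6, h7⟩, h8⟩
    -- As `P` is dense, every nonempty interval meets it, so density of a class in `P` is density in
    -- the model.
    exact ⟨h1, h2, h3, h4, h5, h6, h7, fun p hp a b hab => h8 p a b hp (h2 a b hab)⟩
  · intro h
    exact ⟨⟨⟨⟨h.model, h.dense⟩, h.indep⟩, h.mem_of_relE, h.refl, h.symm, h.trans⟩,
      fun p a b hp ⟨q, _, h1, h2⟩ => h.dense_class p hp a b (h1.trans h2)⟩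

end Models

/-! ### Bundled models of `T_e` and elementary embeddings. -/

section TeModels

variable {L : FirstOrder.Language.{u, v}} [L.IsOrdered]

/-- A model of `T_e`, with its order. -/
structure TeModel (T : L.Theory) where
  /-- The universe of the model. -/
  carrier : Type w
  [str : L.Structure carrier]
  [peStr : peLanguage.Structure carrier]
  [order : LinearOrder carrier]
  [omin : IsOMin L carrier]
  [dlo : IsDLO carrier]
  isTe : IsTe T carrier

variable {T : L.Theory}

instance : CoeSort (TeModel.{u, v, w} T) (Type w) := ⟨TeModel.carrier⟩

instance (N : TeModel.{u, v, w} T) : L.Structure N := N.str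
instance (N : TeModel.{u, v, w} T) : peLanguage.Structure N := N.peStr
instance (N : TeModel.{u, v, w} T) : LinearOrder N := N.order
instance (N : TeModel.{u, v, w} T) : IsOMin L N := N.omin
instance (N : TeModel.{u, v, w} T) : IsDLO N := N.dlo
instance (N : TeModel.{u, v, w} T) : Nonempty N := N.dlo.nonempty
instance (N : TeModel.{u, v, w} T) : N ⊨ T := N.isTe.model

variable {add : L.Functions 2}

/-- A structure that satisfies `T_e` gives a bundled model. -/
theorem exists_teModel (hT : IsGood add T) (N : Type w) [L.Structure N] [peLanguage.Structure N]
    [Nonempty N] (h : N ⊨ Te T) :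
    ∃ (_ : LinearOrder N) (_ : IsOMin L N) (_ : IsDLO N), IsTe T N := by
  have hT' : N ⊨ T := (LHom.onTheory_model (LHom.sumInl : L →ᴸ Le L) T).1
    (h.mono (fun φ hφ => Or.inl (Or.inl (Or.inl (Or.inl hφ)))))
  obtain ⟨lo, om, dlo⟩ := exists_linearOrder hT N
  exact ⟨lo, om, dlo, model_Te_iff.1 h⟩

section Embeddings

variable {M : TeModel.{u, v, w} T} {N : TeModel.{u, v, v'} T} (i : M ↪ₑ[Le L] N)

/-- The `L`-reduct of an `L_e`-elementary embedding. -/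
def reductEmb : M ↪ₑ[L] N where
  toFun := i
  map_formula' n φ x := by
    have := i.map_formula (liftF φ) x
    rwa [LHom.realize_onFormula, LHom.realize_onFormula] at this

theorem map_mem_setP {x : M} : i x ∈ setP N ↔ x ∈ setP M := by
  have := i.map_formula (memF ()) fun _ => x
  rw [realize_memF, realize_memF] at this
  exact this

theorem map_relE {x y : M} : relE (i x) (i y) ↔ relE x y := by
  have := i.map_formula (relF 0 1) ![x, y]
  rw [realize_relF, realize_relF] at this
  exact this

theorem map_lt {x y : M} : i x < i y ↔ x < y := by
  have := i.map_formula (ltF 0 1) ![x, y]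
  rw [realize_ltF, realize_ltF] at this
  exact this

include i in
theorem atLeast_iff {n : ℕ} : AtLeast N n ↔ AtLeast M n := by
  rw [← realize_atLeastSentence (L := L), ← realize_atLeastSentence (L := L), i.map_sentence]

end Embeddings

theorem exists_teModel_extension (hT : IsGood add T) {N : TeModel.{u, v, w} T} {α : Type}
    (S : Set ((Le L).Formula (N ⊕ α)))
    (hS : ∀ s : Finset ((Le L).Formula (N ⊕ α)), (s : Set _) ⊆ S →
      ∃ x : α → N, ∀ φ ∈ s, φ.Realize (Sum.elim id x)) :
    ∃ (N' : TeModel.{u, v, max u v w} T) (i : N ↪ₑ[Le L] N') (x : α → N'),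
      ∀ φ ∈ S, φ.Realize (Sum.elim i x) := by
  obtain ⟨N', str, i, x, hx⟩ := exists_elementary_extension S hS
  obtain ⟨s1, s2, rfl⟩ := exists_eq_sumStructure str
  have : Nonempty N' := ⟨i (Classical.arbitrary N)⟩
  obtain ⟨lo, om, dlo, h⟩ := exists_teModel hT N' ((i.theory_model_iff _).1 (model_Te_iff.2 N.isTe))
  exact ⟨⟨N', h⟩, i, x, hx⟩

/-! ### Families free from `P`. -/

section Free

variable {N : TeModel.{u, v, w} T}

/-- `A` is free from `P`: the elements of `P` outside `A` are independent over `A`. -/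
def IsFree (A : Set N) : Prop :=
  ∀ p ∈ setP N, p ∈ dcl L (A ∪ (setP N \ {p})) → p ∈ A

theorem isFree_empty : IsFree (∅ : Set N) := fun p hp h => by
  rw [Set.empty_union] at h
  exact (N.isTe.indep p hp h).elim

variable {A : Set N}

theorem IsFree.mem (h : IsFree A) {p : N} (hp : p ∈ setP N) (hd : p ∈ dcl L A) : p ∈ A :=
  h p hp (dcl_mono Set.subset_union_left hd)

theorem IsFree.insert_of_mem (h : IsFree A) {c : N} (hc : c ∈ setP N) : IsFree (insert c A) := by
  intro p hp hd
  by_cases hpc : p = c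
  · exact Or.inl hpc
  · refine Or.inr (h p hp (dcl_mono ?_ hd))
    rintro x ((rfl | hx) | hx)
    · exact Or.inr ⟨hc, fun h => hpc h.symm⟩
    · exact Or.inl hx
    · exact Or.inr hx

theorem IsFree.insert_of_mem_dcl (h : IsFree A) {c : N} (hc : c ∈ dcl L A) :
    IsFree (insert c A) := by
  intro p hp hd
  refine Or.inr (h p hp ?_)
  rw [Set.insert_union] at hd
  exact mem_dcl_insert hd (dcl_mono Set.subset_union_left hc)

/-- If adjoining `c` made some `p` outside `A` dependent on the rest of `P`, exchange would place
`c` in the closure of `A` and `P`. -/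
theorem IsFree.insert_of_notMem_dcl (h : IsFree A) {c : N} (hc : c ∉ dcl L (A ∪ setP N)) :
    IsFree (insert c A) := by
  intro p hp hd
  refine Or.inr ?_
  by_contra hpA
  rw [Set.insert_union] at hd
  refine hc (dcl_mono ?_ (exchange hd fun hd' => hpA (h p hp hd')))
  rintro x (rfl | hx | hx)
  · exact Or.inr hp
  · exact Or.inl hx
  · exact Or.inr hx.1

/-- A formula that expresses, for one `θ`, that a finite set is free. -/
noncomputable def freeF {ι : Type*} [Finite ι] {n : ℕ} (θ : L.Formula ((ι ⊕ Fin n) ⊕ Unit)) :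
    (Le L).Formula ι :=
  Formula.iAlls (Unit ⊕ Fin n)
    ((memF (Sum.inr (Sum.inl ())) ⊓ (Formula.iInf fun j => memF (Sum.inr (Sum.inr j))) ⊓
      (Formula.iInf fun j => (eqF (Sum.inr (Sum.inr j)) (Sum.inr (Sum.inl ()))).not) ⊓
      (liftF (uniqF θ)).relabel (Sum.elim (Sum.elim Sum.inl (Sum.inr ∘ Sum.inr))
        fun _ => Sum.inr (Sum.inl ()))).imp
    (Formula.iSup fun k : ι => eqF (Sum.inr (Sum.inl ())) (Sum.inl k)))

/-- For finite families freeness is a conjunction of `L_e`-formulas; this is what lets it pass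
through elementary embeddings. -/
theorem isFree_range_iff {ι : Type*} [Finite ι] {v : ι → N} :
    IsFree (Set.range v) ↔
      ∀ (n : ℕ) (θ : L.Formula ((ι ⊕ Fin n) ⊕ Unit)), (freeF θ).Realize v := by
  have h (n : ℕ) (y : Unit ⊕ Fin n → N) : Sum.elim v y ∘ (Sum.elim (Sum.elim Sum.inl
      (Sum.inr ∘ Sum.inr)) fun _ : Unit => Sum.inr (Sum.inl ())) =
        Sum.elim (Sum.elim v (y ∘ Sum.inr)) fun _ => y (Sum.inl ()) := by
    ext ((_ | _) | _) <;> rfl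
  simp only [freeF, Formula.realize_iAlls, Formula.realize_imp, Formula.realize_inf,
    Formula.realize_iInf, realize_memF, Formula.realize_not, realize_eqF, Formula.realize_relabel,
    LHom.realize_onFormula, Formula.realize_iSup, Sum.elim_inl, Sum.elim_inr]
  constructor
  · rintro hf n θ y ⟨⟨⟨h1, h2⟩, h3⟩, h4⟩
    rw [show (fun a => Sum.elim v y a) = Sum.elim v y from rfl, h, realize_uniqF] at h4
    obtain ⟨k, hk⟩ := hf (y (Sum.inl ())) h1
      (mem_dcl_range_union.2 ⟨n, y ∘ Sum.inr, fun j => ⟨h2 j, h3 j⟩, θ, h4⟩)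
    exact ⟨k, hk.symm⟩
  · intro hf p hp hd
    obtain ⟨n, q, hq, θ, hθ⟩ := mem_dcl_range_union.1 hd
    obtain ⟨k, hk⟩ := hf n θ (Sum.elim (fun _ => p) q)
      ⟨⟨⟨hp, fun j => (hq j).1⟩, fun j => (hq j).2⟩, by
        rw [show (fun a => Sum.elim v (Sum.elim (fun _ => p) q) a) =
          Sum.elim v (Sum.elim (fun _ => p) q) from rfl, h, realize_uniqF]
        exact hθ⟩
    exact ⟨k, hk.symm⟩

theorem isFree_range_comp_iff {ι : Type*} [Finite ι] {N' : TeModel.{u, v, v'} T}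
    (i : N ↪ₑ[Le L] N') {v : ι → N} : IsFree (Set.range (i ∘ v)) ↔ IsFree (Set.range v) := by
  simp only [isFree_range_iff, i.map_formula]

/-- A formula that expresses, for one `θ`, that the last variable is not definable over the other
variables and `P`. -/
noncomputable def genericF {ι : Type*} {n : ℕ} (θ : L.Formula ((ι ⊕ Fin n) ⊕ Unit)) :
    (Le L).Formula (ι ⊕ Unit) :=
  (Formula.iExs (Fin n) ((Formula.iInf fun j => memF (Sum.inr j)) ⊓
    (liftF (uniqF θ)).relabel (Sum.elim (Sum.elim (Sum.inl ∘ Sum.inl) Sum.inr)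
      fun _ => Sum.inl (Sum.inr ())))).not

theorem realize_genericF {ι : Type*} {n : ℕ} {θ : L.Formula ((ι ⊕ Fin n) ⊕ Unit)} {v : ι → N}
    {x : N} : (genericF θ).Realize (Sum.elim v fun _ => x) ↔ ¬ ∃ p : Fin n → N,
      (∀ j, p j ∈ setP N) ∧ ∀ z, θ.Realize (Sum.elim (Sum.elim v p) fun _ => z) ↔ z = x := by
  have h (p : Fin n → N) : Sum.elim (Sum.elim v fun _ : Unit => x) p ∘ (Sum.elim (Sum.elim
      (Sum.inl ∘ Sum.inl) Sum.inr) fun _ : Unit => Sum.inl (Sum.inr ())) =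
        Sum.elim (Sum.elim v p) fun _ => x := by
    ext ((_ | _) | _) <;> rfl
  simp only [genericF, Formula.realize_iExs, Formula.realize_inf,
    Formula.realize_iInf, realize_memF, Formula.realize_not, Formula.realize_relabel,
    LHom.realize_onFormula, Sum.elim_inr, h, realize_uniqF]

/-- Being undefinable over `P` and a family becomes a set of formulas, to which compactness applies.
-/
theorem notMem_dcl_iff {ι : Type*} {v : ι → N} {x : N} :
    x ∉ dcl L (Set.range v ∪ setP N) ↔ ∀ (n : ℕ) (θ : L.Formula ((ι ⊕ Fin n) ⊕ Unit)),
      (genericF θ).Realize (Sum.elim v fun _ => x) := by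
  simp only [realize_genericF, mem_dcl_range_union, not_exists, not_and]
  exact ⟨fun h n θ p hp => h n p hp θ, fun h n p hp θ => h n θ p hp⟩

end Free

/-! ### Points of intervals that need many elements of `P`. -/

section Codensity

section Op

variable {N : Type w} [L.Structure N] {A : Set N} {x y : N}

omit [L.IsOrdered] in
theorem mem_dcl_op (add : L.Functions 2) (hx : x ∈ dcl L A) (hy : y ∈ dcl L A) :
    op add x y ∈ dcl L A :=
  dcl_subset_dcl (B := {x, y}) (by rintro _ (rfl | rfl) <;> assumption)
    (mem_dcl_of_formula (a := ![x, y]) (by simp)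
      (opF add (Sum.inr ()) (Sum.inl 0) (Sum.inl 1)) fun z => by simp)

theorem mem_dcl_of_op_left [Nonempty N] [N ⊨ T] (hT : IsGood add T) (h : op add x y ∈ dcl L A)
    (hy : y ∈ dcl L A) : x ∈ dcl L A :=
  dcl_subset_dcl (B := {op add x y, y}) (by rintro _ (rfl | rfl) <;> assumption)
    (mem_dcl_of_formula (a := ![op add x y, y]) (by simp)
      (opF add (Sum.inl 0) (Sum.inr ()) (Sum.inl 1)) fun z => by
        simpa using ⟨fun h => (op_right_cancel hT h).symm, fun h => h ▸ rfl⟩)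

theorem mem_dcl_of_op_right [Nonempty N] [N ⊨ T] (hT : IsGood add T) (h : op add x y ∈ dcl L A)
    (hx : x ∈ dcl L A) : y ∈ dcl L A :=
  dcl_subset_dcl (B := {op add x y, x}) (by rintro _ (rfl | rfl) <;> assumption)
    (mem_dcl_of_formula (a := ![op add x y, x]) (by simp)
      (opF add (Sum.inl 0) (Sum.inl 1) (Sum.inr ())) fun z => by
        simpa using ⟨fun h => (op_left_cancel hT h).symm, fun h => h ▸ rfl⟩)

end Op

variable {N : TeModel.{u, v, w} T}

theorem exists_mem_setP_diff {F : Set N} (hF : F.Finite) :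
    ∀ {a b : N}, a < b → ∃ p ∈ setP N, p ∉ F ∧ a < p ∧ p < b := by
  induction F, hF using Set.Finite.induction_on with
  | empty =>
    intro a b hab
    obtain ⟨p, hp, h⟩ := N.isTe.dense a b hab
    exact ⟨p, hp, id, h⟩
  | @insert f F _ _ ih =>
    intro a b hab
    obtain ⟨p, hp, hpF, h1, h2⟩ := ih hab
    by_cases hpf : p = f
    · obtain ⟨q, hq, hqF, h3, h4⟩ := ih h1
      refine ⟨q, hq, ?_, h3, h4.trans h2⟩
      rintro (rfl | h)
      · exact h4.ne hpf.symm
      · exact hqF h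
    · refine ⟨p, hp, ?_, h1, h2⟩
      rintro (h | h)
      · exact hpf h
      · exact hpF h

/-- The point `x` is a sum of `k + 1` distinct elements of `P` outside `A`. A newly added `p` is
taken from a translate of the interval, so that `op add p x` falls in it. If the sum is definable
over `A` and `Q`, solving for `p` gives `p` in the closure of `A`, `Q` and the old summands;
freeness forces `p` into `Q`, and cancelling `p` leaves the shorter sum. -/
theorem exists_sum (hT : IsGood add T) {A : Set N} (hA : IsFree A) (hfin : A.Finite) (k : ℕ) :
    ∀ {a b : N}, a < b → ∃ x, a < x ∧ x < b ∧ ∃ s : Finset N,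
      s.card = k + 1 ∧ (s : Set N) ⊆ setP N ∧ x ∈ dcl L (s : Set N) ∧
        ∀ Q ⊆ setP N, x ∈ dcl L (A ∪ Q) → (s : Set N) ⊆ Q := by
  classical
  have key {p : N} {Q : Set N} (hp : p ∈ setP N) (hpA : p ∉ A) (hQ : Q ⊆ setP N)
      (h : p ∈ dcl L (A ∪ Q)) : p ∈ Q := by
    by_contra hpQ
    have hsub : Q ⊆ setP N \ {p} := fun x hx => ⟨hQ hx, fun h => hpQ (h ▸ hx)⟩
    exact hpA (hA p hp (dcl_mono (Set.union_subset_union_right _ hsub) h))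
  induction k with
  | zero =>
    intro a b hab
    obtain ⟨p, hp, hpA, h1, h2⟩ := exists_mem_setP_diff hfin hab
    refine ⟨p, h1, h2, {p}, rfl, by simpa using hp,
      subset_dcl L _ (by simp), fun Q hQ h => ?_⟩
    simpa using key hp hpA hQ h
  | succ k ih =>
    intro a b hab
    obtain ⟨x, -, -, s, hs, hsP, hxs, hx⟩ := ih hab
    obtain ⟨c, d, hcd, htr⟩ := exists_translate hT hab x
    obtain ⟨p, hp, hpA, h1, h2⟩ := exists_mem_setP_diff (hfin.union s.finite_toSet) hcd
    simp only [Set.mem_union, not_or] at hpA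
    refine ⟨op add p x, (htr p h1 h2).1, (htr p h1 h2).2, insert p s, ?_, ?_, ?_,
      fun Q hQ h => ?_⟩
    · rw [Finset.card_insert_of_notMem (by simpa using hpA.2), hs]
    · rw [Finset.coe_insert]
      exact Set.insert_subset hp hsP
    · rw [Finset.coe_insert]
      exact mem_dcl_op add (subset_dcl L _ (Set.mem_insert _ _))
        (dcl_mono (Set.subset_insert _ _) hxs)
    · have hpQ : p ∈ Q := by
        have h3 : p ∈ dcl L (A ∪ (Q ∪ s)) := mem_dcl_of_op_left hT
          (dcl_mono (Set.union_subset_union_right _ Set.subset_union_left) h)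
          (dcl_mono (Set.subset_union_right.trans Set.subset_union_right) hxs)
        exact (key hp hpA.1 (Set.union_subset hQ hsP) h3).resolve_right hpA.2
      rw [Finset.coe_insert]
      exact Set.insert_subset hpQ
        (hx Q hQ (mem_dcl_of_op_right hT h (subset_dcl L _ (Or.inr hpQ))))

/-- A sum of `k + 1` summands from `exists_sum` would have all of them among at most `k` elements `q
j`. -/
theorem exists_notMem_dcl (hT : IsGood add T) {A : Set N} (hA : IsFree A) (hfin : A.Finite) (k : ℕ)
    {a b : N} (hab : a < b) : ∃ x, a < x ∧ x < b ∧ ∀ n ≤ k, ∀ q : Fin n → N, (∀ j, q j ∈ setP N) →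
      x ∉ dcl L (A ∪ Set.range q) := by
  classical
  obtain ⟨x, h1, h2, s, hs, hsP, -, hx⟩ := exists_sum hT hA hfin k hab
  refine ⟨x, h1, h2, fun n hn q hq hd => ?_⟩
  have h3 := hx (Set.range q) (by rintro _ ⟨j, rfl⟩; exact hq j) hd
  have h4 : s ⊆ Finset.univ.image q := fun y hy => by
    obtain ⟨j, rfl⟩ := h3 hy
    exact Finset.mem_image_of_mem _ (Finset.mem_univ _)
  have h5 := (Finset.card_le_card h4).trans Finset.card_image_le
  rw [hs, Finset.card_univ, Fintype.card_fin] at h5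
  omega

end Codensity

end TeModels

/-! ### The back-and-forth system. -/

section BackAndForth

variable {L : FirstOrder.Language.{u, v}} [L.IsOrdered] {T : L.Theory} {add : L.Functions 2}

/-- Two families in models of `T_e` have the same `L`-type and the same relations `P` and `E`,
their ranges are free from `P`, and the models have the same number of classes. -/
structure Matching {M : TeModel.{u, v, w} T} {N : TeModel.{u, v, v'} T} {ι : Type*} (a : ι → M)
    (b : ι → N) : Prop where
  type : ∀ φ : L.Formula ι, φ.Realize a ↔ φ.Realize b
  mem : ∀ k, a k ∈ setP M ↔ b k ∈ setP N
  rel : ∀ k l, relE (a k) (a l) ↔ relE (b k) (b l)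
  free_left : IsFree (Set.range a)
  free_right : IsFree (Set.range b)
  atLeast : ∀ n, AtLeast M n ↔ AtLeast N n

section

variable {M : TeModel.{u, v, w} T} {N : TeModel.{u, v, v'} T} {ι : Type} {a : ι → M} {b : ι → N}

theorem Matching.symm (h : Matching a b) : Matching b a where
  type φ := (h.type φ).symm
  mem k := (h.mem k).symm
  rel k l := (h.rel k l).symm
  free_left := h.free_right
  free_right := h.free_left
  atLeast n := (h.atLeast n).symm

theorem Matching.comp [Finite ι] (h : Matching a b) {N' : TeModel.{u, v, u'} T}
    (i : N ↪ₑ[Le L] N') : Matching a (i ∘ b) where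
  type φ := (h.type φ).trans ((reductEmb i).map_formula φ b).symm
  mem k := (h.mem k).trans (map_mem_setP i).symm
  rel k l := (h.rel k l).trans (map_relE i).symm
  free_left := h.free_left
  free_right := (isFree_range_comp_iff i).2 h.free_right
  atLeast n := (h.atLeast n).trans (atLeast_iff i).symm

theorem range_sum_elim_unit {A : Type*} {κ : Type*} (x : κ → A) (y : A) :
    Set.range (Sum.elim x fun _ : Unit => y) = insert y (Set.range x) := by
  rw [Set.Sum.elim_range]
  simp

/-- A type over a matched family whose realizations are not definable is realized, together with
conditions that hold somewhere in each interval. -/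
theorem exists_realization (hT : IsGood add T)
    (htype : ∀ φ : L.Formula ι, φ.Realize a ↔ φ.Realize b)
    {c : M} (hc : c ∉ dcl L (Set.range a)) (D : Set ((Le L).Formula (N ⊕ Unit)))
    (hD : ∀ s : Finset ((Le L).Formula (N ⊕ Unit)), (s : Set _) ⊆ D → ∀ x y : N, x < y →
      ∃ d, x < d ∧ d < y ∧ ∀ ψ ∈ s, ψ.Realize (Sum.elim id fun _ => d)) :
    ∃ (N' : TeModel.{u, v, max u v v'} T) (i : N ↪ₑ[Le L] N') (d : N'),
      (∀ φ : L.Formula (ι ⊕ Unit), φ.Realize (Sum.elim a fun _ => c) ↔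
        φ.Realize (Sum.elim (i ∘ b) fun _ => d)) ∧
      ∀ ψ ∈ D, ψ.Realize (Sum.elim i fun _ => d) := by
  classical
  let S : Set ((Le L).Formula (N ⊕ Unit)) := {ψ | ∃ φ : L.Formula (ι ⊕ Unit),
    φ.Realize (Sum.elim a fun _ => c) ∧ ψ = (liftF φ).relabel (Sum.map b id)}
  obtain ⟨N', i, x, hx⟩ := exists_teModel_extension hT (S ∪ D) fun s hs => by
    have h1 (ψ : (Le L).Formula (N ⊕ Unit)) : ∃ φ : L.Formula (ι ⊕ Unit),
        φ.Realize (Sum.elim a fun _ => c) ∧ (ψ ∈ S → ψ = (liftF φ).relabel (Sum.map b id)) := by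
      by_cases h : ψ ∈ S
      · obtain ⟨φ, h1, h2⟩ := h
        exact ⟨φ, h1, fun _ => h2⟩
      · exact ⟨⊤, by simp, fun h' => (h h').elim⟩
    choose φ hφ1 hφ2 using h1
    -- As `c` is not definable, it is interior to `χ`. The existence of such an interior point is
    -- part of the type of the family, so `χ` contains an interval of `N`, where `hD` supplies a
    -- point satisfying the extra conditions.
    let χ : L.Formula (ι ⊕ Unit) := Formula.iInf fun ψ : s => φ ψ
    obtain ⟨l, r, hl, hr, hlr⟩ := exists_nhd_of_notMem_dcl hc χ (fun k => ⟨k, rfl⟩) (by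
      simp only [χ, Formula.realize_iInf]
      exact fun ψ => hφ1 ψ)
    have h2 := (htype (ex1 (nhdF χ))).1 (by
      rw [realize_ex1]
      exact ⟨c, realize_nhdF.2 ⟨l, r, hl, hr, hlr⟩⟩)
    rw [realize_ex1] at h2
    obtain ⟨d0, hd0⟩ := h2
    obtain ⟨l', r', hl', hr', h3⟩ := realize_nhdF.1 hd0
    obtain ⟨d, hd1, hd2, hd3⟩ := hD (s.filter (· ∈ D)) (by
      intro ψ hψ
      exact (Finset.mem_filter.1 hψ).2) l' r' (hl'.trans hr')
    refine ⟨fun _ => d, fun ψ hψ => ?_⟩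
    rcases hs hψ with h | h
    · rw [hφ2 ψ h, Formula.realize_relabel, LHom.realize_onFormula]
      have h4 := h3 d hd1 hd2
      simp only [χ, Formula.realize_iInf] at h4
      have h5 : Sum.elim id (fun _ : Unit => d) ∘ Sum.map b id = Sum.elim b fun _ => d := by
        ext (_ | _) <;> rfl
      rw [h5]
      exact h4 ⟨ψ, hψ⟩
    · exact hd3 ψ (Finset.mem_filter.2 ⟨hψ, h⟩)
  have h6 (φ : L.Formula (ι ⊕ Unit)) (h : φ.Realize (Sum.elim a fun _ => c)) :
      φ.Realize (Sum.elim (i ∘ b) fun _ => x ()) := by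
    have := hx _ (Or.inl ⟨φ, h, rfl⟩)
    rw [Formula.realize_relabel, LHom.realize_onFormula] at this
    have h5 : Sum.elim i x ∘ Sum.map b id = Sum.elim (i ∘ b) fun _ => x () := by
      ext (_ | _) <;> rfl
    rwa [h5] at this
  refine ⟨N', i, x (), fun φ => ⟨h6 φ, fun h => ?_⟩, fun ψ hψ => hx ψ (Or.inr hψ)⟩
  by_contra hn
  exact h6 φ.not hn h

/-- The conclusion of the extension step: a matching that extends a given one and whose left family
contains a given element. -/
def HasExtension {M : TeModel.{u, v, w} T} {N : TeModel.{u, v, v'} T} {ι : Type} (a : ι → M)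
    (b : ι → N) (C : Set M) : Prop :=
  ∃ (N' : TeModel.{u, v, v'} T) (i : N ↪ₑ[Le L] N') (κ : Type) (_ : Finite κ) (a' : κ → M)
    (b' : κ → N') (g : ι → κ), Matching a' b' ∧ a' ∘ g = a ∧ b' ∘ g = i ∘ b ∧ C ⊆ Set.range a'

/-- Take a maximal set `R` of indices whose values are in `P` and pairwise inequivalent. With `c`,
`M` has at least `R.card + 1` classes, hence so has `N`. If every element of `setP N` were
equivalent to some `b k`, it would be equivalent to some `b r` with `r` in `R`, against the
pigeonhole principle. -/
theorem exists_new_class [Finite ι] (h : Matching a b) {c : M} (hc : c ∈ setP M)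
    (hne : ∀ k, ¬ relE (a k) c) : ∃ q ∈ setP N, ∀ k, ¬ relE (b k) q := by
  classical
  by_contra! hcon
  have hfin : {R : Finset ι | (∀ k ∈ R, a k ∈ setP M) ∧
      ∀ k ∈ R, ∀ l ∈ R, k ≠ l → ¬ relE (a k) (a l)}.Finite := Set.toFinite _
  obtain ⟨R, ⟨hRP, hR⟩, hmax⟩ := hfin.exists_maximal ⟨∅, by simp⟩
  have hrep : ∀ k, a k ∈ setP M → ∃ r ∈ R, relE (a r) (a k) := by
    intro k hk
    by_contra! hk'
    have hkR : k ∉ R := fun hkR => hk' k hkR (M.isTe.refl _ hk)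
    have := hmax (y := insert k R) ⟨?_, ?_⟩ (Finset.subset_insert _ _)
    · exact hkR (this (Finset.mem_insert_self _ _))
    · intro l hl
      rcases Finset.mem_insert.1 hl with rfl | hl
      exacts [hk, hRP l hl]
    · intro l hl m hm hlm
      rcases Finset.mem_insert.1 hl with rfl | hl' <;>
        rcases Finset.mem_insert.1 hm with rfl | hm'
      · exact (hlm rfl).elim
      · exact fun h => hk' m hm' (M.isTe.symm _ _ h)
      · exact hk' l hl'
      · exact hR l hl' m hm' hlm
  have hM : AtLeast M (R.card + 1) := by
    refine ⟨Fin.cons c fun j => a (R.equivFin.symm j), fun j => ?_, fun j j' hjj => ?_⟩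
    · refine Fin.cases hc (fun j => ?_) j
      exact hRP _ (R.equivFin.symm j).2
    · revert hjj
      refine Fin.cases ?_ (fun j => ?_) j <;> refine Fin.cases ?_ (fun j' => ?_) j'
      · simp
      · intro _ h
        exact hne _ (M.isTe.symm _ _ h)
      · intro _ h
        exact hne _ h
      · intro hjj
        refine hR _ (R.equivFin.symm j).2 _ (R.equivFin.symm j').2 fun h => hjj ?_
        rw [R.equivFin.symm.injective (Subtype.ext h)]
  obtain ⟨x, hxP, hx⟩ := (h.atLeast _).1 hM
  have hf (j) : ∃ r : R, relE (b r) (x j) := by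
    obtain ⟨k, hk⟩ := hcon (x j) (hxP j)
    obtain ⟨r, hr, hrk⟩ := hrep k ((h.mem k).2 (N.isTe.mem_of_relE _ _ hk).1)
    exact ⟨⟨r, hr⟩, N.isTe.trans _ _ _ ((h.rel _ _).1 hrk) hk⟩
  choose f hf using hf
  have : ¬ Function.Injective f := fun hinj => by
    have := Fintype.card_le_of_injective f hinj
    simp at this
  rw [Function.not_injective_iff] at this
  obtain ⟨j, j', hjj, hne⟩ := this
  refine hx j j' hne (N.isTe.trans _ _ _ (N.isTe.symm _ _ (hf j)) ?_)
  rw [hjj]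
  exact hf j'

theorem hasExtension_trivial [Finite ι] (h : Matching a b) {C : Set M} (hC : C ⊆ Set.range a) :
    HasExtension a b C :=
  ⟨N, ElementaryEmbedding.refl _ _, ι, inferInstance, a, b, id, h, rfl, rfl, hC⟩

/-- A one-point extension of a matching; the new points are not in `P` unless their position
relative to `P` and `E` is given. -/
theorem Matching.cons (h : Matching a b) {c : M} {d : N}
    (htype : ∀ φ : L.Formula (ι ⊕ Unit), φ.Realize (Sum.elim a fun _ => c) ↔
      φ.Realize (Sum.elim b fun _ => d))
    (hmem : c ∈ setP M ↔ d ∈ setP N) (hrel : ∀ k, relE (a k) c ↔ relE (b k) d)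
    (hc : IsFree (insert c (Set.range a))) (hd : IsFree (insert d (Set.range b))) :
    Matching (Sum.elim a fun _ : Unit => c) (Sum.elim b fun _ : Unit => d) where
  type := htype
  mem := by
    rintro (k | _)
    exacts [h.mem k, hmem]
  rel := by
    rintro (k | _) (l | _)
    · exact h.rel k l
    · exact hrel k
    · exact ⟨fun e => N.isTe.symm _ _ ((hrel l).1 (M.isTe.symm _ _ e)),
        fun e => M.isTe.symm _ _ ((hrel l).2 (N.isTe.symm _ _ e))⟩
    · exact ⟨fun e => N.isTe.refl _ (hmem.1 (M.isTe.mem_of_relE _ _ e).1),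
        fun e => M.isTe.refl _ (hmem.2 (N.isTe.mem_of_relE _ _ e).1)⟩
  free_left := by rwa [range_sum_elim_unit]
  free_right := by rwa [range_sum_elim_unit]
  atLeast := h.atLeast

theorem relE_iff_of_notMem {c : M} {d : N} (hc : c ∉ setP M) (hd : d ∉ setP N) (x : M) (y : N) :
    relE x c ↔ relE y d :=
  ⟨fun e => (hc (M.isTe.mem_of_relE _ _ e).2).elim,
    fun e => (hd (N.isTe.mem_of_relE _ _ e).2).elim⟩

/-- The partner is the point with the same definition over `b`. Freeness keeps both points out of
`P` unless they are already in the families. -/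
theorem hasExtension_of_mem_dcl [Finite ι] (h : Matching a b) {c : M}
    (hc : c ∈ dcl L (Set.range a)) : HasExtension a b {c} := by
  by_cases hca : c ∈ Set.range a
  · exact hasExtension_trivial h (by simpa using hca)
  obtain ⟨φ, hφ⟩ := mem_dcl_range.1 hc
  have h1 := (h.type (ex1 (uniqF φ))).1 (by
    rw [realize_ex1]
    exact ⟨c, realize_uniqF.2 hφ⟩)
  rw [realize_ex1] at h1
  obtain ⟨d, hd⟩ := h1
  rw [realize_uniqF] at hd
  have hd' : d ∈ dcl L (Set.range b) := mem_dcl_range.2 ⟨φ, hd⟩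
  have htype (ψ : L.Formula (ι ⊕ Unit)) : ψ.Realize (Sum.elim a fun _ => c) ↔
      ψ.Realize (Sum.elim b fun _ => d) := by
    have h2 := h.type (ex1 (φ ⊓ ψ))
    simpa [hφ, hd] using h2
  have hdb : d ∉ Set.range b := by
    rintro ⟨k, rfl⟩
    refine hca ⟨k, ?_⟩
    have := (htype (eqF (Sum.inl k) (Sum.inr ()))).2 (by simp)
    simpa using this
  have hcP : c ∉ setP M := fun hP => hca (h.free_left.mem hP hc)
  have hdP : d ∉ setP N := fun hP => hdb (h.free_right.mem hP hd')
  refine ⟨N, ElementaryEmbedding.refl _ _, ι ⊕ Unit, inferInstance, _, _, Sum.inl,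
    h.cons htype (iff_of_false hcP hdP) (fun k => relE_iff_of_notMem hcP hdP _ _)
      (h.free_left.insert_of_mem_dcl hc) (h.free_right.insert_of_mem_dcl hd'), rfl, rfl, ?_⟩
  rw [range_sum_elim_unit]
  simp

end

section

variable {M : TeModel.{u, v, w} T} {N : TeModel.{u, v, max u v v'} T} {ι : Type}
  {a : ι → M} {b : ι → N}

/-- Freeness makes a new `c` undefinable over `a`. Its partner must lie in a prescribed class: that
of `b j` if `c` is equivalent to `a j`, otherwise one that `b` misses. This class is dense, so
`exists_realization` applies. -/
theorem hasExtension_of_mem_setP [Finite ι] (hT : IsGood add T) (h : Matching a b) {c : M}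
    (hc : c ∈ setP M) : HasExtension a b {c} := by
  by_cases hca : c ∈ Set.range a
  · exact hasExtension_trivial h (by simpa using hca)
  have hq : ∃ q ∈ setP N, (∀ k, relE (a k) c ↔ relE (b k) q) := by
    by_cases hex : ∃ j, relE (a j) c
    · obtain ⟨j, hj⟩ := hex
      refine ⟨b j, (h.mem j).1 (M.isTe.mem_of_relE _ _ hj).1, fun k => ?_⟩
      rw [← h.rel]
      exact ⟨fun e => M.isTe.trans _ _ _ e (M.isTe.symm _ _ hj), fun e => M.isTe.trans _ _ _ e hj⟩
    · push Not at hex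
      obtain ⟨q, hq, hne⟩ := exists_new_class h hc hex
      exact ⟨q, hq, fun k => iff_of_false (hex k) (hne k)⟩
  obtain ⟨q, hq, hqrel⟩ := hq
  obtain ⟨N', i, d, htype, hd⟩ := exists_realization (N := N) hT h.type
    (fun hd => hca (h.free_left.mem hc hd)) {relF (Sum.inl q) (Sum.inr ())} fun s hs x y hxy => by
      obtain ⟨d, h1, h2⟩ := N.isTe.dense_class q hq x y hxy
      refine ⟨d, h2.1, h2.2, fun ψ hψ => ?_⟩
      obtain rfl := hs hψ
      simpa using h1
  have hd : relE (i q) d := by simpa using hd _ rfl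
  have hdP : d ∈ setP N' := (N'.isTe.mem_of_relE _ _ hd).2
  refine ⟨N', i, ι ⊕ Unit, inferInstance, Sum.elim a fun _ => c,
    Sum.elim (i ∘ b) fun _ => d, Sum.inl, (h.comp i).cons htype
    (iff_of_true hc hdP) (fun k => ?_) (h.free_left.insert_of_mem hc)
    ((h.comp i).free_right.insert_of_mem hdP), rfl, rfl, ?_⟩
  · rw [hqrel, ← map_relE i]
    exact ⟨fun e => N'.isTe.trans _ _ _ e hd,
      fun e => N'.isTe.trans _ _ _ e (N'.isTe.symm _ _ hd)⟩
  · rw [range_sum_elim_unit]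
    simp

/-- Finitely many conditions of being undefinable over `b` and `P` involve a bounded number of
elements of `P`, so `exists_notMem_dcl` satisfies them in every interval. -/
theorem hasExtension_of_notMem_dcl [Finite ι] (hT : IsGood add T) (h : Matching a b) {c : M}
    (hc : c ∉ dcl L (Set.range a ∪ setP M)) : HasExtension a b {c} := by
  classical
  let D : Set ((Le L).Formula (N ⊕ Unit)) := {ψ | ∃ (n : ℕ)
    (θ : L.Formula ((ι ⊕ Fin n) ⊕ Unit)), ψ = (genericF θ).relabel (Sum.map b id)}
  have hrel {A : Type _} (f : N → A) (d : A) : Sum.elim f (fun _ : Unit => d) ∘ Sum.map b id =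
      Sum.elim (f ∘ b) fun _ => d := by
    ext (_ | _) <;> rfl
  obtain ⟨N', i, d, htype, hd⟩ := exists_realization (N := N) hT h.type
    (fun hd => hc (dcl_mono Set.subset_union_left hd)) D fun s hs x y hxy => by
      have hs' (ψ) : ∃ n : ℕ, ψ ∈ s →
          ∃ θ : L.Formula ((ι ⊕ Fin n) ⊕ Unit), ψ = (genericF θ).relabel (Sum.map b id) := by
        by_cases hψ : ψ ∈ s
        · obtain ⟨n, θ, h⟩ := hs hψ
          exact ⟨n, fun _ => ⟨θ, h⟩⟩
        · exact ⟨0, fun h => (hψ h).elim⟩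
      choose n hn using hs'
      obtain ⟨d, h1, h2, h3⟩ := exists_notMem_dcl hT h.free_right (Set.finite_range b)
        (s.sup n) hxy
      refine ⟨d, h1, h2, fun ψ hψ => ?_⟩
      obtain ⟨θ, hθ⟩ := hn ψ hψ
      rw [hθ, Formula.realize_relabel, hrel, Function.id_comp, realize_genericF]
      rintro ⟨p, hp, hp'⟩
      refine h3 (n ψ) (Finset.le_sup hψ) p hp ?_
      rw [← Set.Sum.elim_range]
      exact mem_dcl_range.2 ⟨θ, hp'⟩
  have hd' : d ∉ dcl L (Set.range (i ∘ b) ∪ setP N') := by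
    rw [notMem_dcl_iff]
    intro n θ
    have := hd _ ⟨n, θ, rfl⟩
    rwa [Formula.realize_relabel, hrel] at this
  have hcP : c ∉ setP M := fun hP => hc (subset_dcl L _ (Or.inr hP))
  have hdP : d ∉ setP N' := fun hP => hd' (subset_dcl L _ (Or.inr hP))
  refine ⟨N', i, ι ⊕ Unit, inferInstance, Sum.elim a fun _ => c,
    Sum.elim (i ∘ b) fun _ => d, Sum.inl, (h.comp i).cons htype
    (iff_of_false hcP hdP) (fun k => relE_iff_of_notMem hcP hdP _ _)
    (h.free_left.insert_of_notMem_dcl hc) ((h.comp i).free_right.insert_of_notMem_dcl hd'),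
    rfl, rfl, ?_⟩
  rw [range_sum_elim_unit]
  simp

/-- The universe of `N` already absorbs those of the language, so extensions produced by compactness
stay in it and steps can be iterated. -/
theorem HasExtension.trans {C C' : Set M} (h : HasExtension a b C)
    (h' : ∀ (N' : TeModel.{u, v, max u v v'} T) (κ : Type) (_ : Finite κ) (a' : κ → M)
      (b' : κ → N'), Matching a' b' → Set.range a ⊆ Set.range a' → C ⊆ Set.range a' →
        HasExtension a' b' C') : HasExtension a b (C ∪ C') := by
  obtain ⟨N', i, κ, hκ, a', b', g, hm, ha, hb, hC⟩ := h
  obtain ⟨N'', i', κ', hκ', a'', b'', g', hm', ha', hb', hC'⟩ := h' N' κ hκ a' b' hm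
    (by rw [← ha]; exact Set.range_comp_subset_range _ _) hC
  refine ⟨N'', i'.comp i, κ', hκ', a'', b'', g' ∘ g, hm', ?_, ?_, Set.union_subset ?_ hC'⟩
  · rw [← Function.comp_assoc, ha', ha]
  · rw [← Function.comp_assoc, hb', Function.comp_assoc, hb]
    rfl
  · refine hC.trans ?_
    rw [← ha']
    exact Set.range_comp_subset_range _ _

theorem hasExtension_of_finite [Finite ι] (hT : IsGood add T) (h : Matching a b) {C : Set M}
    (hfin : C.Finite) (hC : C ⊆ setP M) : HasExtension a b C := by
  induction C, hfin using Set.Finite.induction_on with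
  | empty => exact hasExtension_trivial h (Set.empty_subset _)
  | @insert c C _ _ ih =>
    rw [Set.insert_eq, Set.union_comm]
    exact (ih ((Set.subset_insert _ _).trans hC)).trans fun N' κ _ a' b' h' _ _ =>
      hasExtension_of_mem_setP hT h' (hC (Set.mem_insert _ _))

/-- If `c` is definable over `a` and `P`, adding the finitely many elements of `P` needed makes it
definable over the family; otherwise it is generic. -/
theorem hasExtension [Finite ι] (hT : IsGood add T) (h : Matching a b) (c : M) :
    HasExtension a b {c} := by
  by_cases hc : c ∈ dcl L (Set.range a ∪ setP M)
  · obtain ⟨s, hs, hfin, hcs⟩ := exists_finite_of_mem_dcl hc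
    have h1 := (hasExtension_of_finite hT h (hfin.inter_of_left (setP M))
      Set.inter_subset_right).trans (C' := {c}) fun N' κ _ a' b' h' ha hC =>
        hasExtension_of_mem_dcl h' (dcl_mono (fun x hx => by
          rcases hs hx with hx' | hx'
          exacts [ha hx', hC ⟨hx, hx'⟩]) hcs)
    obtain ⟨N', i, κ, hκ, a', b', g, hm, ha, hb, hC⟩ := h1
    exact ⟨N', i, κ, hκ, a', b', g, hm, ha, hb, Set.subset_union_right.trans hC⟩
  · exact hasExtension_of_notMem_dcl hT h hc

end

omit [L.IsOrdered] in
theorem exists_onTerm {β : Type*} (t : (Le L).Term β) :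
    ∃ s : L.Term β, t = (LHom.sumInl : L →ᴸ Le L).onTerm s := by
  induction t with
  | var x => exact ⟨Term.var x, rfl⟩
  | func f ts ih =>
    choose s hs using ih
    rcases f with f | f
    · exact ⟨Term.func f s, by
        simp only [LHom.onTerm]
        congr 1
        exact funext hs⟩
    · exact f.elim

section

variable {M : TeModel.{u, v, w} T} {N : TeModel.{u, v, v'} T} {ι : Type} {a : ι → M} {b : ι → N}

/-- The value of a term is definable over the family, so by freeness a value in `P` is a member of
the family; this reduces atomic formulas in `P` and `E` to variables. -/
theorem Matching.exists_of_term_mem (h : Matching a b) {s : L.Term ι}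
    (hs : s.realize a ∈ setP M) : ∃ k, s.realize a = a k ∧ s.realize b = b k := by
  have hd : s.realize a ∈ dcl L (Set.range a) :=
    mem_dcl_range.2 ⟨(Term.var (Sum.inr ())).equal (s.relabel Sum.inl), fun z => by
      simp [Formula.realize_equal, Term.realize_relabel]⟩
  obtain ⟨k, hk⟩ := h.free_left.mem hs hd
  refine ⟨k, hk.symm, ?_⟩
  have := (h.type (s.equal (Term.var k))).1 (by simpa [Formula.realize_equal] using hk.symm)
  simpa [Formula.realize_equal] using this

theorem Matching.term_mem (h : Matching a b) {s : L.Term ι} (hs : s.realize a ∈ setP M) :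
    s.realize b ∈ setP N := by
  obtain ⟨k, h1, h2⟩ := h.exists_of_term_mem hs
  rw [h2, ← h.mem, ← h1]
  exact hs

theorem Matching.term_rel (h : Matching a b) {s t : L.Term ι}
    (hst : relE (s.realize a) (t.realize a)) : relE (s.realize b) (t.realize b) := by
  obtain ⟨hs, ht⟩ := M.isTe.mem_of_relE _ _ hst
  obtain ⟨k, h1, h2⟩ := h.exists_of_term_mem hs
  obtain ⟨l, h3, h4⟩ := h.exists_of_term_mem ht
  rw [h2, h4, ← h.rel, ← h1, ← h3]
  exact hst

end

/-- Matched families satisfy the same `L_e`-formulas. -/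
theorem Matching.realize_iff (hT : IsGood add T) {α : Type} {n : ℕ}
    (φ : (Le L).BoundedFormula α n) :
    ∀ {M N : TeModel.{u, v, max u v w} T} {ι : Type} [Finite ι] {a : ι → M} {b : ι → N}
      (_ : Matching a b) (g : α → ι) (g' : Fin n → ι),
      φ.Realize (a ∘ g) (a ∘ g') ↔ φ.Realize (b ∘ g) (b ∘ g') := by
  have term {N : TeModel.{u, v, max u v w} T} {ι : Type} (b : ι → N) {n : ℕ} (g : α → ι)
      (g' : Fin n → ι) (s : L.Term (α ⊕ Fin n)) :
      ((LHom.sumInl : L →ᴸ Le L).onTerm s).realize (Sum.elim (b ∘ g) (b ∘ g')) =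
        (s.relabel (Sum.elim g g')).realize b := by
    rw [LHom.realize_onTerm, Term.realize_relabel, Sum.comp_elim]
  induction φ with
  | falsum => intros; exact Iff.rfl
  | equal t₁ t₂ =>
    intro M N ι _ a b h g g'
    obtain ⟨s₁, rfl⟩ := exists_onTerm t₁
    obtain ⟨s₂, rfl⟩ := exists_onTerm t₂
    simp only [BoundedFormula.Realize, term]
    simpa only [Formula.realize_equal] using h.type ((s₁.relabel (Sum.elim g g')).equal
      (s₂.relabel (Sum.elim g g')))
  | @rel k l R ts =>
    intro M N ι _ a b h g g'
    choose s hs using fun i => exists_onTerm (ts i)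
    obtain rfl : ts = fun i => (LHom.sumInl : L →ᴸ Le L).onTerm (s i) := funext hs
    simp only [BoundedFormula.Realize, term]
    rcases R with R | R
    · have := h.type (R.formula fun i => (s i).relabel (Sum.elim g g'))
      simp only [Formula.realize_rel] at this
      exact this
    · cases R with
      | P =>
        change Structure.RelMap (symP L) _ ↔ Structure.RelMap (symP L) _
        rw [relMap_symP, relMap_symP]
        exact ⟨h.term_mem, h.symm.term_mem⟩
      | E =>
        change Structure.RelMap (symE L) _ ↔ Structure.RelMap (symE L) _
        rw [relMap_symE, relMap_symE]
        exact ⟨h.term_rel, h.symm.term_rel⟩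
  | imp φ ψ ih1 ih2 =>
    intro M N ι _ a b h g g'
    simp only [BoundedFormula.realize_imp, ih1 h g g', ih2 h g g']
  | @all n φ ih =>
    -- One direction suffices, as matchings are symmetric. A point `c` of `M` gets a partner in an
    -- elementary extension `N'` of `N`, where the universal formula still holds.
    have key {M N : TeModel.{u, v, max u v w} T} {ι : Type} [Finite ι] {a : ι → M} {b : ι → N}
        (h : Matching a b) (g : α → ι) (g' : Fin n → ι)
        (hN : φ.all.Realize (b ∘ g) (b ∘ g')) : φ.all.Realize (a ∘ g) (a ∘ g') := by
      rw [BoundedFormula.realize_all]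
      intro c
      obtain ⟨N', i, κ, hκ, a', b', f, hm, ha, hb, hC⟩ :=
        hasExtension.{u, v, w, max u v w} hT h c
      obtain ⟨k, hk⟩ := hC rfl
      have h1 := ih hm (f ∘ g) (Fin.snoc (f ∘ g') k)
      rw [Fin.comp_snoc, Fin.comp_snoc, ← Function.comp_assoc, ← Function.comp_assoc,
        ← Function.comp_assoc, ← Function.comp_assoc, ha, hb, hk] at h1
      rw [h1]
      rw [← i.map_boundedFormula, BoundedFormula.realize_all] at hN
      exact hN _
    intro M N ι _ a b h g g'
    exact ⟨key h.symm g g', key h g g'⟩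

/-- Models of `T_e` with the same number of classes are elementarily equivalent. -/
theorem realize_sentence_iff_of_atLeast (hT : IsGood add T) {M N : TeModel.{u, v, max u v w} T}
    (h : ∀ n, AtLeast M n ↔ AtLeast N n) (φ : (Le L).Sentence) : M ⊨ φ ↔ N ⊨ φ := by
  have hm : Matching (Empty.elim : Empty → M) (Empty.elim : Empty → N) :=
    { type := fun φ => by
        have h1 := hT.complete.realize_sentence_iff φ M
        have h2 := hT.complete.realize_sentence_iff φ N
        rw [← h2] at h1
        simpa only [Sentence.Realize, Subsingleton.elim (default : Empty → M) Empty.elim,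
          Subsingleton.elim (default : Empty → N) Empty.elim] using h1
      mem := fun k => k.elim
      rel := fun k => k.elim
      free_left := by rw [Set.range_eq_empty]; exact isFree_empty
      free_right := by rw [Set.range_eq_empty]; exact isFree_empty
      atLeast := h }
  have := hm.realize_iff hT φ id Fin.elim0
  simpa only [Sentence.Realize, Formula.Realize, Subsingleton.elim (default : Empty → M) Empty.elim,
    Subsingleton.elim (default : Empty → N) Empty.elim, Function.comp_id,
    Subsingleton.elim (default : Fin 0 → M) (Empty.elim ∘ Fin.elim0),
    Subsingleton.elim (default : Fin 0 → N) (Empty.elim ∘ Fin.elim0)] using this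

end BackAndForth

/-! ### Existence of models of `T_e` with prescribed numbers of classes. -/

section Consistency

open Cardinal

section Families

variable {L : FirstOrder.Language.{u, v}} {M : Type w} [L.Structure M]

/-- Well-founded recursion: the choice at `k` avoids the closure of the earlier choices, which are
at most as many as the predecessors of `k`. -/
theorem exists_forall_notMem_dcl {κ : Type w} [LinearOrder κ] [WellFoundedLT κ] (I : κ → Set M)
    (hI : ∀ k, ∀ B : Set M, #B ≤ #(Set.Iio k) → ∃ x ∈ I k, x ∉ dcl L B) :
    ∃ p : κ → M, ∀ k, p k ∈ I k ∧ p k ∉ dcl L (p '' Set.Iio k) := by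
  let B (k : κ) (f : ∀ l, l < k → M) : Set M := Set.range fun l : Set.Iio k => f l l.2
  choose g hg using fun k (f : ∀ l, l < k → M) => hI k (B k f) mk_range_le
  let p : κ → M := wellFounded_lt.fix g
  have hp (k) : p k = g k fun l _ => p l := wellFounded_lt.fix_eq _ _
  refine ⟨p, fun k => ?_⟩
  have h1 := hg k fun l _ => p l
  have h2 : B k (fun l _ => p l) = p '' Set.Iio k := Set.image_eq_range _ _ |>.symm
  rwa [← hp, h2] at h1

/-- Consider the largest index `m` of `F`. If `k` is below it, exchange turns a dependence of `p k`
into a dependence of `p m` on earlier points; if `k` is above it, all of `F` precedes `k`. -/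
theorem notMem_dcl_of_sequentially [L.IsOrdered] [LinearOrder M] [IsOMin L M] [IsDLO M]
    {κ : Type*} [LinearOrder κ] {p : κ → M} (hp : ∀ k, p k ∉ dcl L (p '' Set.Iio k))
    (F : Finset κ) : ∀ k ∉ F, p k ∉ dcl L (p '' F) := by
  induction F using Finset.induction_on_max with
  | empty =>
    intro k _ h
    exact hp k (dcl_mono (by simp) h)
  | insert m s hm ih =>
    intro k hk h
    simp only [Finset.mem_insert, not_or] at hk
    have hms : m ∉ s := fun h => (hm m h).false
    rcases lt_or_gt_of_ne hk.1 with hkm | hkm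
    · rw [Finset.coe_insert, Set.image_insert_eq] at h
      refine hp m (dcl_mono ?_ (exchange h (ih k hk.2)))
      rw [← Set.image_insert_eq]
      refine Set.image_mono ?_
      rintro x (rfl | hx)
      exacts [hkm, hm x hx]
    · refine hp k (dcl_mono (Set.image_mono fun x hx => ?_) h)
      rw [Finset.coe_insert] at hx
      rcases hx with rfl | hx
      exacts [hkm, (hm x hx).trans hkm]

/-- Definable elements are separated by their defining formulas, so formulas with parameters in `A`
are counted. -/
theorem mk_dcl_le {M : Type (max u v)} [L.Structure M] (A : Set M) :
    #(dcl L A) ≤ max ℵ₀ (#A + 1 + L.card) := by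
  let f : L.Formula (A ⊕ Unit) → Option M := fun φ => by
    classical
    exact if h : ∃ b, ∀ z, φ.Realize (Sum.elim Subtype.val fun _ => z) ↔ z = b then
      some h.choose else none
  have hf (b : dcl L A) : ∃ φ, f φ = some b.1 := by
    obtain ⟨b, hb⟩ := b
    rw [← Subtype.range_coe (s := A), mem_dcl_range] at hb
    obtain ⟨φ, hφ⟩ := hb
    refine ⟨φ, ?_⟩
    have h : ∃ b, ∀ z, φ.Realize (Sum.elim (Subtype.val : A → M) fun _ => z) ↔ z = b := ⟨b, hφ⟩
    simp only [f, dif_pos h, Option.some.injEq]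
    exact (hφ _).1 ((h.choose_spec _).2 rfl)
  choose g hg using hf
  have hinj : Function.Injective g := fun b c h => Subtype.ext (Option.some.inj (by
    rw [← hg, ← hg, h]))
  have h1 : #(L.Formula (A ⊕ Unit)) ≤ #(Σ n, L.BoundedFormula (A ⊕ Unit) n) :=
    mk_le_of_injective (f := fun φ => ⟨0, φ⟩) fun φ ψ h => by simpa using h
  refine ((mk_le_of_injective hinj).trans h1).trans (BoundedFormula.card_le.trans ?_)
  simp [Cardinal.mk_sum]

end Families

section Big

variable {L : FirstOrder.Language.{u, v}} [L.IsOrdered] {T : L.Theory} {add : L.Functions 2}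

theorem exists_map_finset {K X : Type*} [Infinite X] (s : Finset K) :
    ∃ f : Finset K → X, Set.InjOn f {t | t ⊆ s} := by
  classical
  let e := s.powerset.equivFin
  obtain ⟨x⟩ : Nonempty X := inferInstance
  refine ⟨fun t => if h : t ⊆ s then Infinite.natEmbedding X (e ⟨t, Finset.mem_powerset.2 h⟩)
    else x, fun t ht t' ht' h => ?_⟩
  simp only [Set.mem_ofPred_eq] at ht ht'
  simpa [ht, ht', Fin.val_inj] using h

/-- There are models of `T` in which the intervals are as large as the model. -/
theorem exists_model_big_intervals (hT : IsGood add T) :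
    ∃ (N : Type (max u v)) (_ : L.Structure N) (_ : Nonempty N) (_ : N ⊨ T) (_ : LinearOrder N)
      (_ : IsOMin L N) (_ : IsDLO N) (c : Cardinal.{max u v}), max ℵ₀ L.card < c ∧ #N ≤ c ∧
        ∀ a b : N, a < b → c ≤ #(Set.Ioo a b) := by
  classical
  obtain ⟨M0⟩ := hT.complete.1
  have hM0 : Infinite M0 := by
    obtain ⟨_, _, _⟩ := exists_linearOrder hT M0
    exact NoMaxOrder.infinite
  obtain ⟨M, hM⟩ := Theory.exists_model_card_eq ⟨M0, hM0⟩ (max ℵ₀ L.card) (le_max_left _ _)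
    (Cardinal.lift_le.2 (le_max_right _ _))
  obtain ⟨lo, om, dlo⟩ := exists_linearOrder hT M
  have hMi : Infinite M := NoMaxOrder.infinite
  let U : Ultrafilter (Finset M) := Ultrafilter.of Filter.atTop
  have hU (k : M) : ∀ᶠ s in (U : Filter (Finset M)), k ∈ s := by
    have h2 : ∀ᶠ s in (U : Filter (Finset M)), {k} ≤ s :=
      Filter.Eventually.filter_mono (Ultrafilter.of_le _) (Filter.eventually_ge_atTop _)
    filter_upwards [h2] with s hs
    exact hs (Finset.mem_singleton_self _)
  let N := (U : Filter (Finset M)).Product fun _ => (M : Type _)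
  have hNT : N ⊨ T := ((diagonal M U).theory_model_iff T).1 inferInstance
  obtain ⟨loN, omN, dloN⟩ := exists_linearOrder hT N
  refine ⟨N, inferInstance, inferInstance, hNT, loN, omN, dloN, 2 ^ #M, ?_, ?_, ?_⟩
  · rw [← hM]
    exact cantor _
  · refine mk_quotient_le.trans (le_of_eq ?_)
    rw [mk_pi, prod_const, lift_id, lift_id, mk_finset_of_infinite, power_self_eq]
    exact aleph0_le_mk M
  · intro a b hab
    let mk : (Finset M → M) → N := fun x => (x : (U : Filter (Finset M)).Product fun _ => M)
    have hltN (x y : Finset M → M) : mk x < mk y ↔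
        ∀ᶠ s in (U : Filter (Finset M)), x s < y s := by
      have h1 := Ultraproduct.realize_formula_cast (M := fun _ : Finset M => (M : Type _)) (u := U)
        (ltF 0 1 : L.Formula (Fin 2)) ![x, y]
      refine Iff.trans ?_ (h1.trans (by simp))
      exact (realize_ltF (L := L) (x := (0 : Fin 2)) (y := 1)
        (v := fun k => mk ((![x, y] : Fin 2 → Finset M → M) k))).symm
    have hmk (x : N) : ∃ y, mk y = x := Quotient.exists_rep x
    obtain ⟨a, rfl⟩ := hmk a
    obtain ⟨b, rfl⟩ := hmk b
    have hab' := (hltN a b).1 hab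
    have hc (s : Finset M) : ∃ f : Finset M → M, a s < b s →
        ∀ t ⊆ s, (a s < f t ∧ f t < b s) ∧ ∀ t' ⊆ s, f t = f t' → t = t' := by
      by_cases h : a s < b s
      · have : Infinite (Set.Ioo (a s) (b s)) := (Set.Ioo_infinite h).to_subtype
        obtain ⟨f, hf⟩ := exists_map_finset (X := Set.Ioo (a s) (b s)) s
        exact ⟨fun t => f t, fun _ t ht => ⟨(f t).2, fun t' ht' e => hf ht ht' (Subtype.ext e)⟩⟩
      · exact ⟨fun _ => a s, fun h' => (h h').elim⟩
    choose f hf using hc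
    rw [← mk_set]
    -- The map `g` is injective: any `k` belongs to almost every `s`, and `f s` separates the
    -- subsets `s ∩ A` and `s ∩ A'` if `k` is in only one of `A`, `A'`. So each interval has at
    -- least `2 ^ #M` points.
    let g (A : Set M) : N := mk fun s => f s (s.filter (· ∈ A))
    have hg (A : Set M) : g A ∈ Set.Ioo (mk a) (mk b) := by
      refine ⟨(hltN _ _).2 ?_, (hltN _ _).2 ?_⟩
      · filter_upwards [hab'] with s hs using (hf s hs _ (Finset.filter_subset _ _)).1.1
      · filter_upwards [hab'] with s hs using (hf s hs _ (Finset.filter_subset _ _)).1.2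
    refine mk_le_of_injective (f := fun A => (⟨g A, hg A⟩ : Set.Ioo (mk a) (mk b))) fun A A' h => ?_
    have h1 : ∀ᶠ s in (U : Filter (Finset M)),
        f s (s.filter (· ∈ A)) = f s (s.filter (· ∈ A')) := Quotient.exact (Subtype.ext_iff.1 h)
    ext k
    obtain ⟨s, ⟨hs1, hs2⟩, hs3⟩ := ((h1.and hab').and (hU k)).exists
    have h4 := (hf s hs2 _ (Finset.filter_subset _ _)).2 _ (Finset.filter_subset _ _) hs1
    have h5 := Finset.ext_iff.1 h4 k
    simpa [hs3] using h5

/-- There are models of `T_e` with any countable number of classes. -/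
theorem exists_teModel_atLeast_iff (hT : IsGood add T) (J : Type) [Countable J] [Nonempty J] :
    ∃ N : TeModel.{u, v, max u v} T, ∀ n, AtLeast N n ↔ Nonempty (Fin n ↪ J) := by
  obtain ⟨N, _, _, _, _, _, _, c, hc, hN, hI⟩ := exists_model_big_intervals hT
  have hc0 : ℵ₀ ≤ c := (le_max_left _ _).trans hc.le
  -- One requirement for each interval and class. In a well-order of least type each requirement has
  -- fewer than `c` predecessors; the closure of their points has fewer than `c` elements and cannot
  -- cover an interval.
  let ι := {x : N × N // x.1 < x.2} × ULift.{max u v} J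
  have hι : #ι ≤ c := by
    refine (mk_prod _ _).le.trans ?_
    rw [lift_id, lift_id]
    refine (mul_le_mul' ((mk_subtype_le _).trans ?_) (mk_le_aleph0.trans hc0)).trans
      (mul_eq_self hc0).le
    rw [mk_prod]
    simp only [lift_id]
    exact (mul_le_mul' hN hN).trans (mul_eq_self hc0).le
  obtain ⟨e⟩ : Nonempty ((#ι).ord.ToType ≃ ι) := Cardinal.eq.1 (by simp)
  obtain ⟨p, hp⟩ := exists_forall_notMem_dcl (L := L) (M := N)
    (fun k => Set.Ioo (e k).1.1.1 (e k).1.1.2) fun k B hB => by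
      by_contra! hcon
      have h1 : #B < c := hB.trans_lt ((by simpa using mk_Iio_lt k : _ < #ι).trans_le hι)
      have h2 : #(dcl L B) < c := by
        refine (mk_dcl_le B).trans_lt (max_lt ((le_max_left _ _).trans_lt hc) ?_)
        exact add_lt_of_lt hc0 (add_lt_of_lt hc0 h1 (one_lt_aleph0.trans_le hc0))
          ((le_max_right _ _).trans_lt hc)
      exact ((hI _ _ (e k).1.2).trans (mk_le_mk_of_subset hcon)).not_gt h2
  have hind (k) : p k ∉ dcl L (p '' {k}ᶜ) := by
    intro h
    obtain ⟨F, hF, hFfin, hks⟩ :=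
      Set.exists_subset_image_finite_and.1 (exists_finite_of_mem_dcl h)
    refine notMem_dcl_of_sequentially (fun k => (hp k).2) hFfin.toFinset k (fun h => ?_)
      (by simpa using hks)
    exact hF (hFfin.mem_toFinset.1 h) rfl
  have hinj : Function.Injective p := fun k l hkl => by
    by_contra hne
    exact hind k (subset_dcl L _ ⟨l, fun h => hne h.symm, hkl.symm⟩)
  let pe : peLanguage.Structure N :=
    { funMap := fun f => Empty.elim f
      RelMap := fun {n} R => match n, R with
        | _, PERel.P => fun x => ∃ k, p k = x 0
        | _, PERel.E => fun x => ∃ k l, p k = x 0 ∧ p l = x 1 ∧ (e k).2 = (e l).2 }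
  have hP (x : N) : x ∈ setP N ↔ ∃ k, p k = x := Iff.rfl
  have hE (x y : N) : relE x y ↔ ∃ k l, p k = x ∧ p l = y ∧ (e k).2 = (e l).2 := Iff.rfl
  have hEp (k l) : relE (p k) (p l) ↔ (e k).2 = (e l).2 := by
    rw [hE]
    constructor
    · rintro ⟨k', l', h1, h2, h3⟩
      rwa [← hinj h1, ← hinj h2]
    · exact fun h => ⟨k, l, rfl, rfl, h⟩
  have hmem (a b : N) (hab : a < b) (j : J) : ∃ k, a < p k ∧ p k < b ∧ (e k).2 = ⟨j⟩ := by
    refine ⟨e.symm ⟨⟨(a, b), hab⟩, ⟨j⟩⟩, ?_⟩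
    have := (hp (e.symm ⟨⟨(a, b), hab⟩, ⟨j⟩⟩)).1
    rw [e.apply_symm_apply] at this
    exact ⟨this.1, this.2, by simp⟩
  have hTe : IsTe T N := by
    refine ⟨‹_›, fun a b hab => ?_, ?_, ?_, ?_, ?_, ?_, ?_⟩
    · obtain ⟨k, h1, h2, -⟩ := hmem a b hab (Classical.arbitrary J)
      exact ⟨p k, ⟨k, rfl⟩, h1, h2⟩
    · rintro _ ⟨k, rfl⟩ h
      refine hind k (dcl_mono ?_ h)
      rintro _ ⟨⟨l, rfl⟩, hl⟩
      exact ⟨l, fun h => hl (congrArg p h), rfl⟩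
    · rintro _ _ ⟨k, l, h1, h2, -⟩
      exact ⟨⟨k, h1⟩, ⟨l, h2⟩⟩
    · rintro _ ⟨k, rfl⟩
      exact (hEp k k).2 rfl
    · rintro _ _ ⟨k, l, rfl, rfl, h⟩
      exact (hEp l k).2 h.symm
    · rintro _ _ z ⟨k, l, rfl, rfl, h⟩ ⟨l', m, h1, rfl, h2⟩
      rw [← hinj h1] at h
      exact (hEp k m).2 (h.trans h2)
    · rintro _ ⟨k, rfl⟩ a b hab
      obtain ⟨l, h1, h2, h3⟩ := hmem a b hab (e k).2.down
      exact ⟨p l, (hEp k l).2 h3.symm, h1, h2⟩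
  refine ⟨⟨N, hTe⟩, fun n => ⟨?_, ?_⟩⟩
  · rintro ⟨x, hx, hne⟩
    choose k hk using fun i => (hP _).1 (hx i)
    refine ⟨⟨fun i => (e (k i)).2.down, fun i j hij => ?_⟩⟩
    by_contra h
    refine hne i j h ?_
    rw [← hk i, ← hk j]
    exact (hEp _ _).2 (ULift.ext _ _ hij)
  · rintro ⟨f⟩
    obtain ⟨a⟩ : Nonempty N := inferInstance
    obtain ⟨b, hab⟩ := exists_gt a
    choose k _ _ hk using hmem a b hab
    refine ⟨fun i => p (k (f i)), fun i => ⟨_, rfl⟩, fun i j hij h => hij (f.injective ?_)⟩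
    have := (hEp _ _).1 h
    rw [hk, hk] at this
    exact congrArg ULift.down this

end Big

end Consistency

open Topology

/-! ### Boxes and definable interiors. -/

section Boxes

/-- `x` lies in the open box with the corners `c` and `d`. -/
def InBox {M κ : Type*} [LT M] (c d x : κ → M) : Prop := ∀ j, c j < x j ∧ x j < d j

theorem mem_nhds_iff_inBox {M κ : Type*} [LinearOrder M] [IsDLO M] [TopologicalSpace M]
    [OrderTopology M] [Finite κ] {s : Set (κ → M)} {x : κ → M} :
    s ∈ 𝓝 x ↔ ∃ c d, InBox c d x ∧ ∀ y, InBox c d y → y ∈ s := by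
  rw [nhds_pi, (Filter.hasBasis_pi fun j => nhds_basis_Ioo (x j)).mem_iff]
  constructor
  · rintro ⟨⟨I, f⟩, ⟨-, hf⟩, hs⟩
    classical
    choose l hl using fun j => exists_lt (x j)
    choose r hr using fun j => exists_gt (x j)
    refine ⟨fun j => if j ∈ I then (f j).1 else l j, fun j => if j ∈ I then (f j).2 else r j,
      fun j => ?_, fun y hy => hs fun j hj => ?_⟩
    · by_cases hj : j ∈ I
      · simpa [hj] using hf j hj
      · simpa [hj] using ⟨hl j, hr j⟩
    · have := hy j
      simp only [if_pos hj] at this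
      exact this
  · rintro ⟨c, d, h1, h2⟩
    exact ⟨⟨Set.univ, fun j => (c j, d j)⟩, ⟨Set.finite_univ, fun j _ => h1 j⟩,
      fun y hy => h2 y fun j => hy j trivial⟩

variable {L : FirstOrder.Language.{u, v}} [L.IsOrdered] {ι κ : Type*} [Finite κ]

/-- The formula saying that variables lie in a box. -/
noncomputable def boxF {α : Type*} (c d x : κ → α) : L.Formula α :=
  Formula.iInf fun j => ltF (c j) (x j) ⊓ ltF (x j) (d j)

/-- The formula saying that all points of the box with the given corners satisfy `φ`. -/
noncomputable def boxSubF (φ : L.Formula (ι ⊕ κ)) : L.Formula (ι ⊕ (κ ⊕ κ)) :=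
  Formula.iAlls κ ((boxF (Sum.inl ∘ Sum.inr ∘ Sum.inl) (Sum.inl ∘ Sum.inr ∘ Sum.inr)
    Sum.inr).imp (φ.relabel (Sum.map Sum.inl id)))

/-- The formula that defines the interior of the set defined by `φ`. -/
noncomputable def intF (φ : L.Formula (ι ⊕ κ)) : L.Formula (ι ⊕ κ) :=
  Formula.iExs (κ ⊕ κ) ((boxF (Sum.inr ∘ Sum.inl) (Sum.inr ∘ Sum.inr) (Sum.inl ∘ Sum.inr)) ⊓
    (boxSubF φ).relabel (Sum.map Sum.inl id))

variable {M : Type w} [L.Structure M] [LinearOrder M] [L.OrderedStructure M]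

@[simp]
theorem realize_boxF {α : Type*} {c d x : κ → α} {v : α → M} :
    (boxF c d x : L.Formula α).Realize v ↔ InBox (v ∘ c) (v ∘ d) (v ∘ x) := by
  simp [boxF, InBox]

theorem realize_boxSubF {φ : L.Formula (ι ⊕ κ)} {a : ι → M} {e : κ ⊕ κ → M} :
    (boxSubF φ).Realize (Sum.elim a e) ↔
      ∀ y, InBox (e ∘ Sum.inl) (e ∘ Sum.inr) y → φ.Realize (Sum.elim a y) := by
  have h (y : κ → M) : Sum.elim (Sum.elim a e) y ∘ Sum.map Sum.inl id = Sum.elim a y := by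
    ext (_ | _) <;> rfl
  simp only [boxSubF, Formula.realize_iAlls, Formula.realize_imp, realize_boxF,
    Formula.realize_relabel]
  refine forall_congr' fun y => ?_
  rw [show (fun k => Sum.elim (Sum.elim a e) y k) = Sum.elim (Sum.elim a e) y from rfl, h]
  exact Iff.rfl

theorem realize_intF [IsDLO M] [TopologicalSpace M] [OrderTopology M] {φ : L.Formula (ι ⊕ κ)}
    {a : ι → M} {x : κ → M} : (intF φ).Realize (Sum.elim a x) ↔
      ∀ᶠ y in 𝓝 x, φ.Realize (Sum.elim a y) := by
  have h (e : κ ⊕ κ → M) : Sum.elim (Sum.elim a x) e ∘ Sum.map Sum.inl id = Sum.elim a e := by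
    ext (_ | _) <;> rfl
  rw [Filter.Eventually, mem_nhds_iff_inBox]
  simp only [intF, Formula.realize_iExs, Formula.realize_inf, realize_boxF,
    Formula.realize_relabel]
  constructor
  · rintro ⟨e, h1, h2⟩
    rw [h, realize_boxSubF] at h2
    exact ⟨_, _, h1, h2⟩
  · rintro ⟨c, d, h1, h2⟩
    refine ⟨Sum.elim c d, h1, ?_⟩
    rw [h, realize_boxSubF]
    exact h2

theorem embedding_lt_iff {N : Type*} [L.Structure N] [LinearOrder N] [L.OrderedStructure N]
    (i : M ↪ₑ[L] N) {x y : M} : i x < i y ↔ x < y := by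
  have := i.map_formula (ltF 0 1) ![x, y]
  rw [realize_ltF, realize_ltF] at this
  exact this

end Boxes

/-! ### Independent tuples. -/

section Independent

variable {L : FirstOrder.Language.{u, v}} {M : Type w} [L.Structure M]

variable (L) in
/-- Each element of the sequence is not definable over `B` and the preceding elements. -/
def IsIndep (B : Set M) : {m : ℕ} → (Fin m → M) → Prop
  | 0, _ => True
  | _ + 1, e => IsIndep B (Fin.init e) ∧ e (Fin.last _) ∉ dcl L (B ∪ Set.range (Fin.init e))

variable {B B' : Set M}

theorem isIndep_snoc {m : ℕ} {e : Fin m → M} {x : M} :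
    IsIndep L B (Fin.snoc e x : Fin (m + 1) → M) ↔
      IsIndep L B e ∧ x ∉ dcl L (B ∪ Set.range e) := by
  simp [IsIndep]

theorem IsIndep.mono (hB : B ⊆ B') {m : ℕ} {e : Fin m → M} (h : IsIndep L B' e) :
    IsIndep L B e := by
  induction m with
  | zero => trivial
  | succ m ih =>
    exact ⟨ih h.1, fun hd => h.2 (dcl_mono (Set.union_subset_union_left _ hB) hd)⟩

theorem range_fin_snoc {m : ℕ} (e : Fin m → M) (x : M) :
    Set.range (Fin.snoc e x : Fin (m + 1) → M) = insert x (Set.range e) := by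
  ext y
  simp only [Set.mem_range, Fin.exists_fin_succ', Fin.snoc_castSucc, Fin.snoc_last,
    Set.mem_insert_iff, or_comm, eq_comm]

/-- By exchange, a dependence of an entry of `e` created by `c` would make `c` definable over `B`
and `e`. -/
theorem IsIndep.insert_of_notMem [L.IsOrdered] [LinearOrder M] [IsOMin L M] [IsDLO M] {m : ℕ}
    {e : Fin m → M} (h : IsIndep L B e) {c : M} (hc : c ∉ dcl L (B ∪ Set.range e)) :
    IsIndep L (insert c B) e := by
  induction m with
  | zero => trivial
  | succ m ih =>
    obtain ⟨e, x, rfl⟩ : ∃ e' x, e = Fin.snoc e' x := ⟨_, _, (Fin.snoc_init_self e).symm⟩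
    rw [isIndep_snoc] at h ⊢
    rw [range_fin_snoc] at hc
    refine ⟨ih h.1 fun hd => hc (dcl_mono ?_ hd), fun hd => hc ?_⟩
    · exact Set.union_subset_union_right _ (Set.subset_insert _ _)
    · rw [Set.insert_union] at hd
      have := exchange hd h.2
      rwa [← Set.union_insert] at this

theorem IsIndep.image {N : Type*} [L.Structure N] (i : M ↪ₑ[L] N) {m : ℕ} {e : Fin m → M}
    (h : IsIndep L B e) : IsIndep L (i '' B) (i ∘ e) := by
  induction m with
  | zero => trivial
  | succ m ih =>
    obtain ⟨e, x, rfl⟩ : ∃ e' x, e = Fin.snoc e' x := ⟨_, _, (Fin.snoc_init_self e).symm⟩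
    rw [isIndep_snoc] at h
    rw [Fin.comp_snoc, isIndep_snoc, Set.range_comp, ← Set.image_union, image_mem_dcl_image_iff]
    exact ⟨ih h.1, h.2⟩

/-- A maximal independent subfamily. -/
theorem exists_isIndep_comp {n : ℕ} (B : Set M) (a : Fin n → M) : ∃ (k : ℕ) (g : Fin k → Fin n),
    IsIndep L B (a ∘ g) ∧ ∀ j, a j ∈ dcl L (B ∪ Set.range (a ∘ g)) := by
  suffices h : ∀ s : Finset (Fin n), ∃ (k : ℕ) (g : Fin k → Fin n),
      IsIndep L B (a ∘ g) ∧ ∀ j ∈ s, a j ∈ dcl L (B ∪ Set.range (a ∘ g)) by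
    obtain ⟨k, g, h1, h2⟩ := h Finset.univ
    exact ⟨k, g, h1, fun j => h2 j (Finset.mem_univ j)⟩
  intro s
  induction s using Finset.induction_on with
  | empty => exact ⟨0, Fin.elim0, trivial, by simp⟩
  | insert j s _ ih =>
    obtain ⟨k, g, h1, h2⟩ := ih
    by_cases hj : a j ∈ dcl L (B ∪ Set.range (a ∘ g))
    · exact ⟨k, g, h1, by simpa using ⟨hj, h2⟩⟩
    · refine ⟨k + 1, Fin.snoc g j, ?_, ?_⟩
      · rw [Fin.comp_snoc, isIndep_snoc]
        exact ⟨h1, hj⟩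
      · rw [Fin.comp_snoc, range_fin_snoc]
        intro l hl
        rcases Finset.mem_insert.1 hl with rfl | hl
        · exact subset_dcl L _ (by simp)
        · exact dcl_mono (Set.union_subset_union_right _ (Set.subset_insert _ _)) (h2 l hl)

end Independent

/-! ### Independent points are interior points. -/

section Generic

variable {L : FirstOrder.Language.{u, v}} [L.IsOrdered] {T : L.Theory} {add : L.Functions 2}

/-- Intervals are infinite, so compactness applies. A point outside the elementary substructure is
undefinable over it, and so can be added to the parameters without spoiling independence. -/
theorem exists_new_between (hT : IsGood add T) {M : Type w} [L.Structure M] [LinearOrder M]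
    [IsOMin L M] [IsDLO M] (hM : M ⊨ T) {a b : M} (hab : a < b) :
    ∃ (N : Type (max u v w)) (_ : L.Structure N) (_ : LinearOrder N) (_ : IsOMin L N) (_ : IsDLO N)
      (_ : N ⊨ T) (i : M ↪ₑ[L] N) (x : N), i a < x ∧ x < i b ∧ x ∉ Set.range i := by
  classical
  have : Nonempty M := ⟨a⟩
  obtain ⟨N, str, i, x, hx⟩ := exists_elementary_extension (L := L) (N := M) (α := Unit)
    ({ltF (Sum.inl a) (Sum.inr ()), ltF (Sum.inr ()) (Sum.inl b)} ∪
      Set.range fun c => (eqF (Sum.inr ()) (Sum.inl c)).not) fun s hs => by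
    obtain ⟨F, hF⟩ : ∃ F : Finset M, ∀ c, (eqF (Sum.inr ()) (Sum.inl c)).not ∈ s → c ∈ F := by
      let f : M → L.Formula (M ⊕ Unit) := fun c => (eqF (Sum.inr ()) (Sum.inl c)).not
      have hf : Function.Injective f := by
        intro c d hcd
        by_contra hne
        have h1 : (f c).Realize (Sum.elim id fun _ => d) := by simpa [f] using Ne.symm hne
        rw [hcd] at h1
        simp [f] at h1
      exact ⟨s.preimage f hf.injOn, fun c hc => Finset.mem_preimage.2 hc⟩
    obtain ⟨x, ⟨hx1, hx2⟩, hx3⟩ := (Set.Ioo_infinite hab).exists_notMem_finset F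
    refine ⟨fun _ => x, fun φ hφ => ?_⟩
    rcases hs hφ with (rfl | rfl) | ⟨c, rfl⟩
    · simpa using hx1
    · simpa using hx2
    · simp only [Formula.realize_not, realize_eqF, Sum.elim_inr, Sum.elim_inl, id]
      rintro rfl
      exact hx3 (hF _ hφ)
  have : Nonempty N := ⟨x ()⟩
  have hN : N ⊨ T := (i.theory_model_iff T).1 hM
  obtain ⟨lo, om, dlo⟩ := exists_linearOrder hT N
  refine ⟨N, str, lo, om, dlo, hN, i, x (), ?_, ?_, ?_⟩
  · simpa using hx _ (Or.inl (Or.inl rfl))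
  · simpa using hx _ (Or.inl (Or.inr rfl))
  · rintro ⟨c, hc⟩
    have := hx _ (Or.inr ⟨c, rfl⟩)
    simp [hc] at this

/-- An independent point that belongs to a definable set is an interior point of this set. -/
theorem IsIndep.realize_intF (hT : IsGood add T) {m : ℕ} : ∀ {M : Type (max u v w)}
    [L.Structure M] [LinearOrder M] [IsOMin L M] [IsDLO M] (_ : M ⊨ T) {ι : Type v'}
    (φ : L.Formula (ι ⊕ Fin m)) {a : ι → M} {e : Fin m → M}, IsIndep L (Set.range a) e →
      φ.Realize (Sum.elim a e) → (intF φ).Realize (Sum.elim a e) := by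
  induction m with
  | zero =>
    intro M _ _ _ _ _ ι φ a e _ h
    let := Preorder.topology M
    have : OrderTopology M := ⟨rfl⟩
    rw [OpenCore.realize_intF]
    exact Filter.Eventually.of_forall fun y => by rwa [Subsingleton.elim y e]
  | succ m ih =>
    intro M _ _ _ _ hM ι φ a e he h
    obtain ⟨e, x, rfl⟩ : ∃ e' x, e = Fin.snoc e' x := ⟨_, _, (Fin.snoc_init_self e).symm⟩
    rw [isIndep_snoc] at he
    obtain ⟨he, hx⟩ := he
    have hsn {N : Type (max u v w)} (a : ι → N) (e : Fin m → N) (z : N) :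
        Sum.elim (Sum.elim a e) (fun _ : Unit => z) ∘ (Sum.elim (Sum.inl ∘ Sum.inl)
          (Fin.snoc (Sum.inl ∘ Sum.inr) (Sum.inr ())) : ι ⊕ Fin (m + 1) → (ι ⊕ Fin m) ⊕ Unit) =
          Sum.elim a (Fin.snoc e z : Fin (m + 1) → N) := by
      rw [Sum.comp_elim, Fin.comp_snoc]
      rfl
    let φ' : L.Formula ((ι ⊕ Fin m) ⊕ Unit) := φ.relabel (Sum.elim (Sum.inl ∘ Sum.inl)
      (Fin.snoc (Sum.inl ∘ Sum.inr) (Sum.inr ())))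
    obtain ⟨c, d, hc, hd, hcd⟩ := exists_nhd_of_notMem_dcl (L := L) (A := Set.range a ∪ Set.range e)
      hx φ' (a := Sum.elim a e) (by
        rw [← Set.Sum.elim_range]
        exact fun k => ⟨k, rfl⟩) (by
        rw [Formula.realize_relabel, hsn]
        exact h)
    have hcd' : ∀ z, c < z → z < d → φ.Realize (Sum.elim a (Fin.snoc e z : Fin (m + 1) → M)) := by
      intro z h1 h2
      have := hcd z h1 h2
      rwa [Formula.realize_relabel, hsn] at this
    let ψ : L.Formula ((ι ⊕ Fin 2) ⊕ Fin m) := all1 ((ltF (Sum.inl (Sum.inl (Sum.inr 0)))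
      (Sum.inr ())).imp ((ltF (Sum.inr ()) (Sum.inl (Sum.inl (Sum.inr 1)))).imp
        (φ.relabel (Sum.elim (Sum.inl ∘ Sum.inl ∘ Sum.inl)
          (Fin.snoc (Sum.inl ∘ Sum.inr) (Sum.inr ()))))))
    have hψ {N : Type (max u v w)} [L.Structure N] [LinearOrder N] [IsOMin L N] (a : ι → N)
        (c d : N) (e : Fin m → N) : ψ.Realize (Sum.elim (Sum.elim a ![c, d]) e) ↔
          ∀ z, c < z → z < d → φ.Realize (Sum.elim a (Fin.snoc e z : Fin (m + 1) → N)) := by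
      have h1 (z : N) : Sum.elim (Sum.elim (Sum.elim a ![c, d]) e) (fun _ : Unit => z) ∘
          (Sum.elim (Sum.inl ∘ Sum.inl ∘ Sum.inl) (Fin.snoc (Sum.inl ∘ Sum.inr) (Sum.inr ())) :
            ι ⊕ Fin (m + 1) → ((ι ⊕ Fin 2) ⊕ Fin m) ⊕ Unit) =
          Sum.elim a (Fin.snoc e z : Fin (m + 1) → N) := by
        rw [Sum.comp_elim, Fin.comp_snoc]
        rfl
      simp [ψ, h1]
    -- The bounds `c` and `d` may depend on `e`. They are replaced by points `c'` and `d'` nearer to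
    -- `x` and new to the preceding models, over which `e` stays independent. The induction
    -- hypothesis then gives a neighbourhood of `e` on which the fibres contain the fixed interval
    -- from `c'` to `d'`.
    obtain ⟨M1, _, _, _, _, hM1, i1, c', hc1, hc2, hc3⟩ := exists_new_between hT hM hc
    obtain ⟨M2, _, _, _, _, hM2, i2, d', hd1, hd2, hd3⟩ :=
      exists_new_between hT hM1 ((embedding_lt_iff i1).2 hd)
    rw [← embedding_lt_iff i2] at hc1 hc2
    have hB1 : IsIndep L (insert c' (i1 '' Set.range a)) (i1 ∘ e) := by
      refine (he.image i1).insert_of_notMem fun h => hc3 (dcl_image_subset i1 (dcl_mono ?_ h))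
      rw [Set.range_comp]
      exact Set.union_subset (Set.image_subset_range _ _) (Set.image_subset_range _ _)
    have hB2 : IsIndep L (insert d' (i2 '' insert c' (i1 '' Set.range a))) (i2 ∘ i1 ∘ e) := by
      refine (hB1.image i2).insert_of_notMem fun h => hd3 (dcl_image_subset i2 (dcl_mono ?_ h))
      rw [Set.range_comp]
      exact Set.union_subset (Set.image_subset_range _ _) (Set.image_subset_range _ _)
    have h1 : ψ.Realize (Sum.elim (Sum.elim (i2 ∘ i1 ∘ a) ![i2 (i1 c), i2 (i1 d)])
        (i2 ∘ i1 ∘ e)) := by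
      have h2 := ((i2.comp i1).map_formula ψ (Sum.elim (Sum.elim a ![c, d]) e)).2
        ((hψ _ _ _ _).2 hcd')
      convert h2 using 1
      ext ((_ | j) | _)
      · rfl
      · fin_cases j <;> rfl
      · rfl
    rw [hψ] at h1
    have h2 := ih hM2 ψ (a := Sum.elim (i2 ∘ i1 ∘ a) ![i2 c', d']) (e := i2 ∘ i1 ∘ e)
      (hB2.mono (by
        rintro _ ⟨j | j, rfl⟩
        · exact Or.inr ⟨_, Or.inr ⟨_, ⟨j, rfl⟩, rfl⟩, rfl⟩
        · fin_cases j
          · exact Or.inr ⟨_, Or.inl rfl, rfl⟩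
          · exact Or.inl rfl))
      ((hψ _ _ _ _).2 fun z hz1 hz2 => h1 z (hc1.trans hz1) (hz2.trans hd2))
    rw [← (i2.comp i1).map_formula]
    let := Preorder.topology M2
    have : OrderTopology M2 := ⟨rfl⟩
    have h3 : (i2.comp i1) ∘ Sum.elim a (Fin.snoc e x : Fin (m + 1) → M) =
        Sum.elim (i2 ∘ i1 ∘ a) (Fin.snoc (i2 ∘ i1 ∘ e) (i2 (i1 x)) : Fin (m + 1) → M2) := by
      rw [Sum.comp_elim, Fin.comp_snoc]
      rfl
    rw [h3, OpenCore.realize_intF]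
    rw [OpenCore.realize_intF] at h2
    have h4 : Filter.Tendsto (fun y : Fin (m + 1) → M2 => Fin.init y)
        (𝓝 (Fin.snoc (i2 ∘ i1 ∘ e) (i2 (i1 x)))) (𝓝 (i2 ∘ i1 ∘ e)) := by
      have : Continuous (fun y : Fin (m + 1) → M2 => (Fin.init y : Fin m → M2)) :=
        continuous_pi fun j => continuous_apply _
      have := this.tendsto (Fin.snoc (i2 ∘ i1 ∘ e) (i2 (i1 x)))
      rwa [Fin.init_snoc] at this
    have h5 : Filter.Tendsto (fun y : Fin (m + 1) → M2 => y (Fin.last m))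
        (𝓝 (Fin.snoc (i2 ∘ i1 ∘ e) (i2 (i1 x)))) (𝓝 (i2 (i1 x))) := by
      have := (continuous_apply (A := fun _ => M2) (Fin.last m)).tendsto
        (Fin.snoc (i2 ∘ i1 ∘ e) (i2 (i1 x)))
      rwa [Fin.snoc_last] at this
    filter_upwards [h4.eventually h2, h5.eventually (Ioo_mem_nhds hc2 hd1)] with y hy1 hy2
    have := (hψ _ _ _ _).1 hy1 _ hy2.1 hy2.2
    rwa [Fin.snoc_init_self] at this

end Generic

/-! ### Finite covers by compactness. -/

section Cover

variable {L : FirstOrder.Language.{u, v}}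

/-- Compactness: if each realization of `φ` in an elementary extension satisfies a formula in `D`,
then finitely many formulas in `D` suffice. -/
theorem exists_finset_cover {N : Type w} [Nonempty N] [L.Structure N] {α : Type}
    (φ : L.Formula (N ⊕ α)) (D : Set (L.Formula (N ⊕ α)))
    (h : ∀ (N' : Type (max u v w)) (_ : L.Structure N') (i : N ↪ₑ[L] N') (x : α → N'),
      φ.Realize (Sum.elim i x) → ∃ ψ ∈ D, ψ.Realize (Sum.elim i x)) :
    ∃ F : Finset (L.Formula (N ⊕ α)), (F : Set _) ⊆ D ∧
      ∀ x : α → N, φ.Realize (Sum.elim id x) → ∃ ψ ∈ F, ψ.Realize (Sum.elim id x) := by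
  classical
  by_contra! hcon
  obtain ⟨N', str, i, x, hx⟩ := exists_elementary_extension ({φ} ∪ Formula.not '' D) fun s hs => by
    have hf (ψ) : ∃ χ, ψ ∈ Formula.not '' D → χ ∈ D ∧ Formula.not χ = ψ := by
      by_cases hψ : ψ ∈ Formula.not '' D
      · obtain ⟨χ, h⟩ := hψ
        exact ⟨χ, fun _ => h⟩
      · exact ⟨⊤, fun h => (hψ h).elim⟩
    choose f hf using hf
    obtain ⟨x, hx, hxD⟩ := hcon ((s.filter (· ∈ Formula.not '' D)).image f) (by
      intro χ hχ
      obtain ⟨ψ, hψ, rfl⟩ := Finset.mem_image.1 hχ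
      exact (hf ψ (Finset.mem_filter.1 hψ).2).1)
    refine ⟨x, fun ψ hψ => ?_⟩
    rcases hs hψ with rfl | h
    · exact hx
    · rw [← (hf ψ h).2, Formula.realize_not]
      exact hxD _ (Finset.mem_image_of_mem _ (Finset.mem_filter.2 ⟨hψ, h⟩))
  obtain ⟨ψ, hψ, hψx⟩ := h N' str i x (hx φ (Or.inl rfl))
  exact hx _ (Or.inr ⟨ψ, hψ, rfl⟩) hψx

theorem definable_univ_iff {N : Type w} [L.Structure N] {α : Type*} {s : Set (α → N)} :
    (Set.univ : Set N).Definable L s ↔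
      ∃ φ : L.Formula (N ⊕ α), ∀ x, x ∈ s ↔ φ.Realize (Sum.elim id x) := by
  rw [Set.definable_iff_exists_formula_sum]
  constructor
  · rintro ⟨φ, hφ⟩
    refine ⟨φ.relabel (Sum.map Subtype.val id), fun x => ?_⟩
    rw [Formula.realize_relabel, Sum.elim_comp_map, hφ]
    rfl
  · rintro ⟨φ, hφ⟩
    refine ⟨φ.relabel (Sum.map (fun x => ⟨x, trivial⟩) id), ?_⟩
    ext x
    rw [hφ, Set.mem_ofPred_eq, Formula.realize_relabel, Sum.elim_comp_map]
    rfl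

end Cover

/-! ### `L`-definable sets from open `L`-definable sets. -/

section Constructible

variable {L : FirstOrder.Language.{u, v}} [L.IsOrdered] {T : L.Theory} {add : L.Functions 2}

/-- A point of a definable set in an elementary extension lies in a locally closed definable
subset. -/
theorem exists_open_diff (hT : IsGood add T) {M : Type w} [L.Structure M] [LinearOrder M]
    [IsOMin L M] [IsDLO M] {n : ℕ} (φ : L.Formula (M ⊕ Fin n)) {N : Type (max u v w)}
    [L.Structure N] [LinearOrder N] [IsOMin L N] [IsDLO N] (hN : N ⊨ T) (i : M ↪ₑ[L] N)
    {a : Fin n → N} (ha : φ.Realize (Sum.elim i a)) :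
    ∃ ω ω' : L.Formula (M ⊕ Fin n),
      (∀ x : Fin n → M, ω.Realize (Sum.elim id x) → (intF ω).Realize (Sum.elim id x)) ∧
      (∀ x : Fin n → M, ω'.Realize (Sum.elim id x) → (intF ω').Realize (Sum.elim id x)) ∧
      (∀ x : Fin n → M, ω.Realize (Sum.elim id x) → ¬ ω'.Realize (Sum.elim id x) →
        φ.Realize (Sum.elim id x)) ∧
      ω.Realize (Sum.elim i a) ∧ ¬ ω'.Realize (Sum.elim i a) := by
  obtain ⟨k, g, hind, hdcl⟩ := exists_isIndep_comp (L := L) (Set.range i) a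
  simp only [← Set.Sum.elim_range, mem_dcl_range] at hdcl
  choose θ hθ using hdcl
  -- The part of `φ` on which all coordinates are the functions `θ` of the independent ones; a point
  -- of it is determined by `x ∘ g`.
  let η : L.Formula (M ⊕ Fin n) := φ ⊓ Formula.iInf fun j => (uniqF (θ j)).relabel
    (Sum.elim (Sum.elim Sum.inl (Sum.inr ∘ g)) fun _ => Sum.inr j)
  have hη {N : Type _} [L.Structure N] (b : M → N) (x : Fin n → N) :
      η.Realize (Sum.elim b x) ↔ φ.Realize (Sum.elim b x) ∧
        ∀ j z, (θ j).Realize (Sum.elim (Sum.elim b (x ∘ g)) fun _ => z) ↔ z = x j := by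
    have h1 (j) : Sum.elim b x ∘ (Sum.elim (Sum.elim Sum.inl (Sum.inr ∘ g)) fun _ => Sum.inr j) =
        Sum.elim (Sum.elim b (x ∘ g)) fun _ : Unit => x j := by
      ext ((_ | _) | _) <;> rfl
    simp only [η, Formula.realize_inf, Formula.realize_iInf, Formula.realize_relabel, h1,
      realize_uniqF]
  let cl : L.Formula (M ⊕ Fin n) := (intF η.not).not
  have hcl {N : Type _} [L.Structure N] [LinearOrder N] [IsOMin L N] [IsDLO N]
      [TopologicalSpace N] [OrderTopology N] (b : M → N) (x : Fin n → N) :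
      cl.Realize (Sum.elim b x) ↔ ∃ᶠ y in 𝓝 x, η.Realize (Sum.elim b y) := by
    simp only [cl, Formula.realize_not, realize_intF]
    rfl
  have hηa : η.Realize (Sum.elim i a) := (hη _ _).2 ⟨ha, hθ⟩
  -- The tuples `t` in whose fibre the closure of `η` adds no point to `η`.
  let ν : L.Formula (M ⊕ Fin k) := Formula.iAlls (Fin n)
    ((Formula.iInf fun l => eqF (Sum.inr (g l)) (Sum.inl (Sum.inr l))).imp
      ((cl.imp η).relabel (Sum.map Sum.inl id)))
  have hν (t : Fin k → N) : ν.Realize (Sum.elim i t) ↔ ∀ y : Fin n → N, y ∘ g = t →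
      cl.Realize (Sum.elim i y) → η.Realize (Sum.elim i y) := by
    have h1 (y : Fin n → N) : Sum.elim (Sum.elim i t) y ∘ Sum.map Sum.inl id = Sum.elim i y := by
      ext (_ | _) <;> rfl
    simp only [ν, Formula.realize_iAlls, Formula.realize_imp, Formula.realize_iInf, realize_eqF,
      Formula.realize_relabel, h1, Sum.elim_inr, Sum.elim_inl, funext_iff, Function.comp_apply]
  -- Here `y` is in the closure of `η` over `a ∘ g`, and `ρ` says on which side of a new point `e` a
  -- coordinate lies. As `a ∘ g` is independent over `M` and `e`, near it the points of `η` have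
  -- `j`-th coordinate on the side of `a j`; but points of `η` near `y` have it on the side of `y
  -- j`.
  have key (y : Fin n → N) (hy : y ∘ g = a ∘ g) (hcy : cl.Realize (Sum.elim i y)) (j : Fin n)
      {N' : Type (max u v w)} [L.Structure N'] [LinearOrder N'] [IsOMin L N'] [IsDLO N']
      [TopologicalSpace N'] [OrderTopology N'] (hN' : N' ⊨ T) (i' : N ↪ₑ[L] N') (e : N')
      (he : e ∉ Set.range i') (ρ : L.Formula (Unit ⊕ Unit))
      (h1 : ρ.Realize (Sum.elim (fun _ => e) fun _ => i' (a j)))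
      (h2 : ∀ᶠ z in 𝓝 (i' (y j)), ¬ ρ.Realize (Sum.elim (fun _ => e) fun _ => z)) : False := by
    let μ : L.Formula ((M ⊕ Unit) ⊕ Fin k) := Formula.iExs (Fin n)
      ((Formula.iInf fun l => eqF (Sum.inr (g l)) (Sum.inl (Sum.inr l))) ⊓
        (η.relabel (Sum.map (Sum.inl ∘ Sum.inl) id) ⊓
          ρ.relabel (Sum.elim (Sum.inl ∘ Sum.inl ∘ Sum.inr) fun _ => Sum.inr j)))
    have hμ (t : Fin k → N') : μ.Realize (Sum.elim (Sum.elim (i' ∘ i) fun _ => e) t) ↔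
        ∃ x : Fin n → N', x ∘ g = t ∧ η.Realize (Sum.elim (i' ∘ i) x) ∧
          ρ.Realize (Sum.elim (fun _ => e) fun _ => x j) := by
      have h1 (y : Fin n → N') : Sum.elim (Sum.elim (Sum.elim (i' ∘ i) fun _ : Unit => e) t) y ∘
          Sum.map (Sum.inl ∘ Sum.inl) id = Sum.elim (i' ∘ i) y := by
        ext (_ | _) <;> rfl
      have h2 (y : Fin n → N') : Sum.elim (Sum.elim (Sum.elim (i' ∘ i) fun _ : Unit => e) t) y ∘
          (Sum.elim (Sum.inl ∘ Sum.inl ∘ Sum.inr) fun _ : Unit => Sum.inr j) =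
            Sum.elim (fun _ => e) fun _ => y j := by
        ext (_ | _) <;> rfl
      simp only [μ, Formula.realize_iExs, Formula.realize_inf, Formula.realize_iInf, realize_eqF,
        Formula.realize_relabel, h1, h2, Sum.elim_inr, Sum.elim_inl, funext_iff,
        Function.comp_apply]
    have hind' : IsIndep L (Set.range (Sum.elim (i' ∘ i) fun _ : Unit => e)) (i' ∘ a ∘ g) := by
      rw [range_sum_elim_unit, Set.range_comp]
      refine (hind.image i').insert_of_notMem fun h => he (dcl_image_subset i' (dcl_mono ?_ h))
      rw [Set.range_comp i' (a ∘ g)]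
      exact Set.union_subset (Set.image_subset_range _ _) (Set.image_subset_range _ _)
    have h3 := hind'.realize_intF hT hN' μ ((hμ _).2 ⟨i' ∘ a, rfl, by
      rw [← Sum.comp_elim, i'.map_formula]
      exact hηa, h1⟩)
    rw [realize_intF] at h3
    rw [← i'.map_formula, Sum.comp_elim, hcl] at hcy
    have h4 : Filter.Tendsto (fun z : Fin n → N' => z ∘ g) (𝓝 (i' ∘ y)) (𝓝 (i' ∘ a ∘ g)) := by
      rw [← hy]
      exact (continuous_pi fun l => continuous_apply (g l)).tendsto (i' ∘ y)
    have h5 : Filter.Tendsto (fun z : Fin n → N' => z j) (𝓝 (i' ∘ y)) (𝓝 (i' (y j))) :=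
      (continuous_apply j).tendsto (i' ∘ y)
    obtain ⟨z, hz1, hz2, hz3⟩ := (hcy.and_eventually ((h4.eventually h3).and
      (h5.eventually h2))).exists
    obtain ⟨x, hx1, hx2, hx3⟩ := (hμ _).1 hz2
    have h6 := (((hη _ _).1 hz1).2 j (z j)).2 rfl
    rw [← hx1] at h6
    rw [(((hη _ _).1 hx2).2 j (z j)).1 h6] at hz3
    exact hz3 hx3
  have hνa : ν.Realize (Sum.elim i (a ∘ g)) := by
    rw [hν]
    intro y hy hcy
    by_cases hya : y = a
    · rwa [hya]
    obtain ⟨j, hj⟩ := Function.ne_iff.1 hya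
    exfalso
    rcases lt_or_gt_of_ne hj with hlt | hlt
    · obtain ⟨N', _, _, _, _, hN', i', e, he1, he2, he3⟩ := exists_new_between hT hN hlt
      let := Preorder.topology N'
      have : OrderTopology N' := ⟨rfl⟩
      refine key y hy hcy j hN' i' e he3 (ltF (Sum.inl ()) (Sum.inr ())) (by simpa using he2) ?_
      filter_upwards [Iio_mem_nhds he1] with z hz
      simpa using hz.le
    · obtain ⟨N', _, _, _, _, hN', i', e, he1, he2, he3⟩ := exists_new_between hT hN hlt
      let := Preorder.topology N'
      have : OrderTopology N' := ⟨rfl⟩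
      refine key y hy hcy j hN' i' e he3 (ltF (Sum.inr ()) (Sum.inl ())) (by simpa using he1) ?_
      filter_upwards [Ioi_mem_nhds he2] with z hz
      simpa using hz.le
  -- The second open set is the complement of the closure of `η`, so the difference lies in the
  -- closure and hence in `η`. The first contains `a` because `ν` holds in a neighbourhood of `a ∘
  -- g`.
  refine ⟨intF (cl.imp η), intF η.not, ?_, ?_, ?_, ?_, ?_⟩
  · intro x hx
    let := Preorder.topology M
    have : OrderTopology M := ⟨rfl⟩
    simp only [realize_intF] at hx ⊢
    exact eventually_eventually_nhds.2 hx
  · intro x hx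
    let := Preorder.topology M
    have : OrderTopology M := ⟨rfl⟩
    simp only [realize_intF] at hx ⊢
    exact eventually_eventually_nhds.2 hx
  · intro x hx hx'
    let := Preorder.topology M
    have : OrderTopology M := ⟨rfl⟩
    rw [realize_intF] at hx
    have := hx.self_of_nhds
    rw [Formula.realize_imp] at this
    exact (Formula.realize_inf.1 (this hx')).1
  · let := Preorder.topology N
    have : OrderTopology N := ⟨rfl⟩
    have h1 := IsIndep.realize_intF.{u, v, w, w} hT hN ν hind hνa
    rw [realize_intF] at h1 ⊢
    have h4 : Filter.Tendsto (fun z : Fin n → N => z ∘ g) (𝓝 a) (𝓝 (a ∘ g)) :=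
      (continuous_pi fun l => continuous_apply (g l)).tendsto a
    filter_upwards [h4.eventually h1] with x hx
    rw [Formula.realize_imp]
    exact (hν _).1 hx x rfl
  · let := Preorder.topology N
    have : OrderTopology N := ⟨rfl⟩
    intro h
    rw [realize_intF] at h
    exact h.self_of_nhds hηa

end Constructible

/-! ### Tuples generic over a model and `P`. -/

section Generic

variable {L : FirstOrder.Language.{u, v}} [L.IsOrdered] {T : L.Theory} {add : L.Functions 2}

section Free

variable {N : TeModel.{u, v, w} T} {A : Set N}

theorem IsFree.union_of_subset (h : IsFree A) {Q : Set N} (hQ : Q ⊆ setP N) : IsFree (A ∪ Q) := by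
  intro p hp hd
  by_cases hpQ : p ∈ Q
  · exact Or.inr hpQ
  · refine Or.inl (h p hp (dcl_mono ?_ hd))
    rintro x ((hx | hx) | hx)
    · exact Or.inl hx
    · exact Or.inr ⟨hQ hx, fun h => hpQ (h ▸ hx)⟩
    · exact Or.inr hx

/-- Elements are adjoined one by one; an element definable over the set and `P` is accompanied by
the finitely many elements of `P` that define it. -/
theorem exists_isFree_superset {F : Set N} (hF : F.Finite) : ∃ A, F ⊆ A ∧ A.Finite ∧ IsFree A := by
  induction F, hF using Set.Finite.induction_on with
  | empty => exact ⟨∅, Set.Subset.rfl, Set.finite_empty, isFree_empty⟩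
  | @insert c F _ _ ih =>
    obtain ⟨A, hFA, hA, hfree⟩ := ih
    by_cases hc : c ∈ dcl L (A ∪ setP N)
    · obtain ⟨s, hs, hsf, hcs⟩ := exists_finite_of_mem_dcl hc
      refine ⟨insert c (A ∪ s ∩ setP N), Set.insert_subset_insert (hFA.trans Set.subset_union_left),
        (hA.union (hsf.inter_of_left _)).insert c,
        (hfree.union_of_subset Set.inter_subset_right).insert_of_mem_dcl (dcl_mono ?_ hcs)⟩
      intro x hx
      exact (hs hx).imp id fun h => ⟨hx, h⟩
    · exact ⟨insert c A, Set.insert_subset_insert hFA, hA.insert c, hfree.insert_of_notMem_dcl hc⟩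

omit [L.IsOrdered] in
theorem IsIndep.notMem {M : Type*} [L.Structure M] {B : Set M} {m : ℕ} {e : Fin m → M}
    (h : IsIndep L B e) (j : Fin m) : e j ∉ B := by
  induction m with
  | zero => exact j.elim0
  | succ m ih =>
    refine Fin.lastCases (fun hj => h.2 (subset_dcl L _ (Or.inl hj))) (fun j => ?_) j
    exact ih h.1 j

theorem IsFree.union_range (h : IsFree A) {m : ℕ} {e : Fin m → N}
    (he : IsIndep L (A ∪ setP N) e) : IsFree (A ∪ Set.range e) := by
  induction m with
  | zero => simpa using h
  | succ m ih =>
    obtain ⟨e, x, rfl⟩ : ∃ e' x, e = Fin.snoc e' x := ⟨_, _, (Fin.snoc_init_self e).symm⟩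
    rw [isIndep_snoc] at he
    rw [range_fin_snoc, Set.union_insert]
    refine (ih he.1).insert_of_notMem_dcl fun hd => he.2 ?_
    rwa [Set.union_right_comm] at hd

end Free

/-- Each interval of a model contains, in an elementary extension, a point that is not definable
over the model and `P`. -/
theorem exists_generic_point (hT : IsGood add T) {N : TeModel.{u, v, w} T} {a b : N}
    (hab : a < b) : ∃ (N' : TeModel.{u, v, max u v w} T) (i : N ↪ₑ[Le L] N') (x : N'),
      i a < x ∧ x < i b ∧ x ∉ dcl L (Set.range i ∪ setP N') := by
  classical
  let D : Set ((Le L).Formula (N ⊕ Unit)) :=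
    {ψ | ∃ (n : ℕ) (θ : L.Formula ((N ⊕ Fin n) ⊕ Unit)), ψ = genericF θ}
  -- Each condition has finitely many parameters `F` and concerns `n` elements of `P`. For finitely
  -- many conditions the parameters lie in a finite free set, and `exists_notMem_dcl` applies.
  have hD (ψ : (Le L).Formula (N ⊕ Unit)) : ∃ (n : ℕ) (F : Set N), F.Finite ∧ (ψ ∈ D → ∀ x : N,
      (∀ q : Fin n → N, (∀ j, q j ∈ setP N) → x ∉ dcl L (F ∪ Set.range q)) →
        ψ.Realize (Sum.elim id fun _ => x)) := by
    by_cases hψ : ψ ∈ D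
    · obtain ⟨n, θ, rfl⟩ := hψ
      obtain ⟨k, c, θ', hθ'⟩ := exists_finite_support
        (θ.relabel (Equiv.sumAssoc N (Fin n) Unit))
      refine ⟨n, Set.range c, Set.finite_range c, fun _ x hx => ?_⟩
      rw [realize_genericF]
      rintro ⟨q, hq, hqx⟩
      refine hx q hq ?_
      rw [← Set.Sum.elim_range, mem_dcl_range]
      refine ⟨θ'.relabel (Equiv.sumAssoc (Fin k) (Fin n) Unit).symm, fun z => ?_⟩
      rw [← hqx z, Formula.realize_relabel]
      have h1 := hθ' N id (Sum.elim q fun _ => z)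
      rw [Formula.realize_relabel] at h1
      have h2 : Sum.elim (Sum.elim c q) (fun _ : Unit => z) ∘
          (Equiv.sumAssoc (Fin k) (Fin n) Unit).symm =
          Sum.elim (id ∘ c) (Sum.elim q fun _ => z) := by
        ext (_ | _ | _) <;> rfl
      have h3 : Sum.elim id (Sum.elim q (fun _ : Unit => z)) ∘ Equiv.sumAssoc N (Fin n) Unit =
          Sum.elim (Sum.elim id q) (fun _ => z) := by
        ext ((_ | _) | _) <;> rfl
      rw [h2, ← h1, h3]
    · exact ⟨0, ∅, Set.finite_empty, fun h => (hψ h).elim⟩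
  choose n F hF hDx using hD
  obtain ⟨N', i, x, hx⟩ := exists_teModel_extension hT
    ({ltF (Sum.inl a) (Sum.inr ()), ltF (Sum.inr ()) (Sum.inl b)} ∪ D) fun s hs => by
      obtain ⟨A, hFA, hA, hfree⟩ := exists_isFree_superset
        (s.finite_toSet.biUnion fun ψ _ => hF ψ)
      obtain ⟨x, hx1, hx2, hx3⟩ := exists_notMem_dcl hT hfree hA (s.sup n) hab
      refine ⟨fun _ => x, fun ψ hψ => ?_⟩
      rcases hs hψ with (rfl | rfl) | h
      · simpa using hx1
      · simpa using hx2
      · exact hDx ψ h x fun q hq hd => hx3 (n ψ) (Finset.le_sup hψ) q hq (dcl_mono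
          (Set.union_subset_union_left _ ((Set.subset_biUnion_of_mem hψ).trans hFA)) hd)
  refine ⟨N', i, x (), ?_, ?_, ?_⟩
  · simpa using hx _ (Or.inl (Or.inl rfl))
  · simpa using hx _ (Or.inl (Or.inr rfl))
  · rw [notMem_dcl_iff]
    exact fun n θ => hx _ (Or.inr ⟨n, θ, rfl⟩)

variable (L) in
/-- The formulas saying that the variables are independent over the parameters and `P`. -/
noncomputable def indepFormulas (ι : Type w) : (m : ℕ) → Set ((Le L).Formula (ι ⊕ Fin m))
  | 0 => ∅
  | m + 1 => {γ | ∃ γ' ∈ indepFormulas ι m, γ = γ'.relabel (Sum.map id Fin.castSucc)} ∪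
      {γ | ∃ (n : ℕ) (θ : L.Formula (((ι ⊕ Fin m) ⊕ Fin n) ⊕ Unit)),
        γ = (genericF θ).relabel (Sum.elim (Sum.map id Fin.castSucc)
          fun _ => Sum.inr (Fin.last m))}

theorem isIndep_iff {N : TeModel.{u, v, v'} T} {ι : Type w} {b : ι → N} {m : ℕ} {e : Fin m → N} :
    IsIndep L (Set.range b ∪ setP N) e ↔
      ∀ γ ∈ indepFormulas L ι m, γ.Realize (Sum.elim b e) := by
  induction m with
  | zero => simp [IsIndep, indepFormulas]
  | succ m ih =>
    have h1 : Sum.elim b e ∘ Sum.map id Fin.castSucc = Sum.elim b (Fin.init e) := by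
      ext (_ | _) <;> rfl
    have h2 : Sum.elim b e ∘ (Sum.elim (Sum.map id Fin.castSucc)
          fun _ : Unit => Sum.inr (Fin.last m)) =
        Sum.elim (Sum.elim b (Fin.init e)) fun _ => e (Fin.last m) := by
      ext ((_ | _) | _) <;> rfl
    rw [IsIndep, ih, Set.union_right_comm, ← Set.Sum.elim_range, notMem_dcl_iff]
    constructor
    · rintro ⟨h3, h4⟩ γ (⟨γ', hγ', rfl⟩ | ⟨n, θ, rfl⟩)
      · rw [Formula.realize_relabel, h1]
        exact h3 γ' hγ'
      · rw [Formula.realize_relabel, h2]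
        exact h4 n θ
    · intro h
      refine ⟨fun γ' hγ' => ?_, fun n θ => ?_⟩
      · have := h _ (Or.inl ⟨γ', hγ', rfl⟩)
        rwa [Formula.realize_relabel, h1] at this
      · have := h _ (Or.inr ⟨n, θ, rfl⟩)
        rwa [Formula.realize_relabel, h2] at this

theorem isIndep_comp_iff {N : TeModel.{u, v, v'} T} {N' : TeModel.{u, v, u'} T}
    (i : N ↪ₑ[Le L] N') {ι : Type w} {b : ι → N} {m : ℕ} {e : Fin m → N} :
    IsIndep L (Set.range (i ∘ b) ∪ setP N') (i ∘ e) ↔ IsIndep L (Set.range b ∪ setP N) e := by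
  simp only [isIndep_iff, ← Sum.comp_elim, i.map_formula]

/-- The coordinates are chosen one at a time, each in a further elementary extension, to which
independence of the earlier ones passes. -/
theorem exists_generic_box (hT : IsGood add T) {N : TeModel.{u, v, w} T} {m : ℕ} {l r : Fin m → N}
    (hlr : ∀ j, l j < r j) : ∃ (N' : TeModel.{u, v, max u v w} T) (i : N ↪ₑ[Le L] N')
      (e : Fin m → N'), IsIndep L (Set.range i ∪ setP N') e ∧ InBox (i ∘ l) (i ∘ r) e := by
  induction m with
  | zero =>
    obtain ⟨N', i, -, -⟩ := exists_teModel_extension (N := N) (α := Empty) hT ∅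
      fun s hs => ⟨Empty.elim, fun φ hφ => (hs hφ).elim⟩
    exact ⟨N', i, Fin.elim0, trivial, fun j => j.elim0⟩
  | succ m ih =>
    obtain ⟨N', i, e, he, hb⟩ := ih fun j => hlr (Fin.castSucc j)
    obtain ⟨N'', i', x, h1, h2, hx⟩ := exists_generic_point hT ((map_lt i).2 (hlr (Fin.last m)))
    refine ⟨N'', i'.comp i, Fin.snoc (i' ∘ e) x, isIndep_snoc.2 ⟨?_, fun hd => hx (dcl_mono ?_ hd)⟩,
      ?_⟩
    · exact (isIndep_comp_iff i').2 he
    · rintro y ((⟨z, rfl⟩ | hy) | ⟨j, rfl⟩)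
      · exact Or.inl ⟨i z, rfl⟩
      · exact Or.inr hy
      · exact Or.inl ⟨e j, rfl⟩
    · refine fun j => Fin.lastCases ?_ (fun j => ?_) j
      · rw [Fin.snoc_last]
        exact ⟨h1, h2⟩
      · rw [Fin.snoc_castSucc]
        exact ⟨(map_lt i').2 (hb j).1, (map_lt i').2 (hb j).2⟩

/-- The finitely many parameters of `χ` lie in a finite free set. Adjoining the generic tuples,
which avoid `P`, keeps the families free, so agreement of `L`-types makes them a matching. -/
theorem realize_iff_of_isIndep (hT : IsGood add T) {N : TeModel.{u, v, w} T}
    {N₁ N₂ : TeModel.{u, v, max u v w} T} (i₁ : N ↪ₑ[Le L] N₁) (i₂ : N ↪ₑ[Le L] N₂) {m : ℕ}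
    {e₁ : Fin m → N₁} {e₂ : Fin m → N₂} (h₁ : IsIndep L (Set.range i₁ ∪ setP N₁) e₁)
    (h₂ : IsIndep L (Set.range i₂ ∪ setP N₂) e₂)
    (h : ∀ ψ : L.Formula (N ⊕ Fin m), ψ.Realize (Sum.elim i₁ e₁) → ψ.Realize (Sum.elim i₂ e₂))
    (χ : (Le L).Formula (N ⊕ Fin m)) :
    χ.Realize (Sum.elim i₁ e₁) ↔ χ.Realize (Sum.elim i₂ e₂) := by
  obtain ⟨k, b, χ', hχ⟩ := exists_finite_support χ
  obtain ⟨A, hbA, hA, hfree⟩ := exists_isFree_superset (Set.finite_range b)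
  obtain ⟨l, a, rfl⟩ := hA.fin_embedding
  choose g hg using fun j => hbA ⟨j, rfl⟩
  have h' (ψ : L.Formula (N ⊕ Fin m)) : ψ.Realize (Sum.elim i₁ e₁) ↔
      ψ.Realize (Sum.elim i₂ e₂) :=
    ⟨h ψ, fun h2 => by
      by_contra h1
      exact h ψ.not h1 h2⟩
  have hfr {N' : TeModel.{u, v, max u v w} T} (i : N ↪ₑ[Le L] N') {e : Fin m → N'}
      (he : IsIndep L (Set.range i ∪ setP N') e) : IsFree (Set.range (Sum.elim (i ∘ a) e)) := by
    rw [Set.Sum.elim_range]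
    refine ((isFree_range_comp_iff i).2 hfree).union_range (he.mono ?_)
    exact Set.union_subset_union_left _ (Set.range_comp_subset_range _ _)
  have hP₁ (j) : e₁ j ∉ setP N₁ := fun hj => h₁.notMem j (Or.inr hj)
  have hP₂ (j) : e₂ j ∉ setP N₂ := fun hj => h₂.notMem j (Or.inr hj)
  have hm : Matching (Sum.elim (i₁ ∘ a) e₁) (Sum.elim (i₂ ∘ a) e₂) :=
    { type := fun ψ => by
        have := h' (ψ.relabel (Sum.map a id))
        rwa [Formula.realize_relabel, Formula.realize_relabel, Sum.elim_comp_map,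
          Sum.elim_comp_map] at this
      mem := by
        rintro (j | j)
        · exact (map_mem_setP i₁).trans (map_mem_setP i₂).symm
        · exact iff_of_false (hP₁ j) (hP₂ j)
      rel := by
        rintro (j | j) (j' | j')
        · exact (map_relE i₁).trans (map_relE i₂).symm
        · exact relE_iff_of_notMem (hP₁ j') (hP₂ j') _ _
        · exact iff_of_false (fun h => hP₁ j (N₁.isTe.mem_of_relE _ _ h).1)
            fun h => hP₂ j (N₂.isTe.mem_of_relE _ _ h).1
        · exact relE_iff_of_notMem (hP₁ j') (hP₂ j') _ _
      free_left := hfr i₁ h₁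
      free_right := hfr i₂ h₂
      atLeast := fun n => (atLeast_iff i₁).trans (atLeast_iff i₂).symm }
  have key := hm.realize_iff hT χ' (Sum.map g id) Fin.elim0
  have hb : a ∘ g = b := funext hg
  rw [Sum.elim_comp_map, Sum.elim_comp_map, Function.comp_assoc, Function.comp_assoc, hb] at key
  rw [hχ, hχ]
  simpa only [Formula.Realize, Function.comp_id, Subsingleton.elim (default : Fin 0 → N₁)
    (Sum.elim (i₁ ∘ a) e₁ ∘ Fin.elim0), Subsingleton.elim (default : Fin 0 → N₂)
    (Sum.elim (i₂ ∘ a) e₂ ∘ Fin.elim0)] using key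

end Generic

/-! ### Open `L_e`-definable sets are `L`-definable. -/

section OpenSets

variable {L : FirstOrder.Language.{u, v}} [L.IsOrdered] {T : L.Theory} {add : L.Functions 2}

/-- Elementary extensions of models of `T_e` are models of `T_e`. -/
theorem isTe_of_embedding (hT : IsGood add T) {N : TeModel.{u, v, w} T} {N' : Type u'}
    [L.Structure N'] [peLanguage.Structure N'] (i : N ↪ₑ[Le L] N') :
    ∃ (_ : LinearOrder N') (_ : IsOMin L N') (_ : IsDLO N'), IsTe T N' := by
  have : Nonempty N' := ⟨i (Classical.arbitrary N)⟩
  exact exists_teModel hT N' ((i.theory_model_iff _).1 (model_Te_iff.2 N.isTe))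

section Corners

variable {ι : Type*} {n : ℕ} {N : Type w} [L.Structure N] [LinearOrder N] [L.OrderedStructure N]

/-- The formula saying that all points of a box satisfy `φ`; the corners of the box are the two
halves of the family of variables. -/
noncomputable def cornersF (φ : L.Formula (ι ⊕ Fin n)) : L.Formula (ι ⊕ Fin (n + n)) :=
  (boxSubF φ).relabel (Sum.map id (Sum.elim (Fin.castAdd n) (Fin.natAdd n)))

theorem realize_cornersF {φ : L.Formula (ι ⊕ Fin n)} {b : ι → N} {e : Fin (n + n) → N} :
    (cornersF φ).Realize (Sum.elim b e) ↔
      ∀ y, InBox (e ∘ Fin.castAdd n) (e ∘ Fin.natAdd n) y → φ.Realize (Sum.elim b y) := by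
  rw [cornersF, Formula.realize_relabel, Sum.elim_comp_map, realize_boxSubF]
  exact Iff.rfl

/-- The formula that defines the union of the boxes whose corners form an interior point of the set
defined by `ψ`. -/
noncomputable def unionF (ψ : L.Formula (ι ⊕ Fin (n + n))) : L.Formula (ι ⊕ Fin n) :=
  Formula.iExs (Fin (n + n)) ((intF ψ).relabel (Sum.map Sum.inl id) ⊓
    boxF (Sum.inr ∘ Fin.castAdd n) (Sum.inr ∘ Fin.natAdd n) (Sum.inl ∘ Sum.inr))

theorem realize_unionF {ψ : L.Formula (ι ⊕ Fin (n + n))} {b : ι → N} {x : Fin n → N} :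
    (unionF ψ).Realize (Sum.elim b x) ↔ ∃ e : Fin (n + n) → N,
      (intF ψ).Realize (Sum.elim b e) ∧ InBox (e ∘ Fin.castAdd n) (e ∘ Fin.natAdd n) x := by
  have h1 (e : Fin (n + n) → N) : Sum.elim (Sum.elim b x) e ∘ Sum.map Sum.inl id =
      Sum.elim b e := by
    ext (_ | _) <;> rfl
  simp only [unionF, Formula.realize_iExs, Formula.realize_inf, Formula.realize_relabel, h1,
    realize_boxF]
  exact Iff.rfl

end Corners

/-- The `L`-formulas that imply, for generic points in elementary extensions, the formula `χ`. -/
def genericConsequences {N : TeModel.{u, v, w} T} {m : ℕ} (χ : (Le L).Formula (N ⊕ Fin m)) :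
    Set (L.Formula (N ⊕ Fin m)) :=
  {ψ | ∀ (N' : TeModel.{u, v, max u v w} T) (i : N ↪ₑ[Le L] N') (e : Fin m → N'),
    IsIndep L (Set.range i ∪ setP N') e → ψ.Realize (Sum.elim i e) → χ.Realize (Sum.elim i e)}

/-- If no formula in the `L`-type of `e` forced `χ`, compactness would give a generic tuple with the
same `L`-type and without `χ`, against `realize_iff_of_isIndep`. -/
theorem exists_mem_genericConsequences (hT : IsGood add T) {N : TeModel.{u, v, w} T} {m : ℕ}
    {χ : (Le L).Formula (N ⊕ Fin m)} {N' : TeModel.{u, v, max u v w} T} {i : N ↪ₑ[Le L] N'}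
    {e : Fin m → N'} (he : IsIndep L (Set.range i ∪ setP N') e) (hχ : χ.Realize (Sum.elim i e)) :
    ∃ ψ ∈ genericConsequences χ, ψ.Realize (Sum.elim i e) := by
  classical
  by_contra! hcon
  let S : Set ((Le L).Formula (N ⊕ Fin m)) :=
    {γ | ∃ ψ : L.Formula (N ⊕ Fin m), ψ.Realize (Sum.elim i e) ∧ γ = liftF ψ}
  have hS (γ) : ∃ ψ : L.Formula (N ⊕ Fin m), ψ.Realize (Sum.elim i e) ∧ (γ ∈ S → γ = liftF ψ) := by
    by_cases hγ : γ ∈ S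
    · obtain ⟨ψ, h1, h2⟩ := hγ
      exact ⟨ψ, h1, fun _ => h2⟩
    · exact ⟨⊤, by simp, fun h => (hγ h).elim⟩
  choose f hf1 hf2 using hS
  obtain ⟨N₂, i₂, e₂, he₂⟩ := exists_teModel_extension hT (S ∪ indepFormulas L N m ∪ {χ.not})
    fun s hs => by
      have h1 : (Formula.iInf fun γ : s => f γ) ∉ genericConsequences χ := fun h => by
        refine hcon _ h ?_
        rw [Formula.realize_iInf]
        exact fun γ => hf1 γ
      simp only [genericConsequences, Set.mem_ofPred_eq, not_forall] at h1
      obtain ⟨N₃, i₃, e₃, h2, h3, h4⟩ := h1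
      rw [Formula.realize_iInf] at h3
      -- The counterexample lives in an extension `N₃`, but the existence of a solution of finitely
      -- many formulas over `N` descends to `N`.
      have h5 := i₃.map_formula (Formula.iExs (Fin m) (Formula.iInf fun γ : s => γ.1)) id
      simp only [Formula.realize_iExs, Formula.realize_iInf, Function.comp_id] at h5
      obtain ⟨x, hx⟩ := h5.1 ⟨e₃, fun γ => by
        rcases hs γ.2 with (h | h) | h
        · rw [hf2 γ h]
          exact (LHom.realize_onFormula (LHom.sumInl : L →ᴸ Le L) _).2 (h3 γ)
        · exact isIndep_iff.1 h2 _ h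
        · rw [Set.mem_singleton_iff.1 h]
          exact h4⟩
      exact ⟨x, fun γ hγ => hx ⟨γ, hγ⟩⟩
  refine he₂ χ.not (Or.inr rfl) ((realize_iff_of_isIndep hT i i₂ he (isIndep_iff.2 fun γ hγ =>
    he₂ γ (Or.inl (Or.inr hγ))) (fun ψ hψ => ?_) χ).1 hχ)
  exact (LHom.realize_onFormula (LHom.sumInl : L →ᴸ Le L) _).1
    (he₂ _ (Or.inl (Or.inl ⟨ψ, hψ, rfl⟩)))

theorem eventually_inBox {N : Type*} [LinearOrder N] [TopologicalSpace N] [OrderTopology N] {n : ℕ}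
    {e : Fin (n + n) → N} {x : Fin n → N} (h : InBox (e ∘ Fin.castAdd n) (e ∘ Fin.natAdd n) x) :
    ∀ᶠ e' in 𝓝 e, InBox (e' ∘ Fin.castAdd n) (e' ∘ Fin.natAdd n) x := by
  simp only [InBox, Filter.eventually_all]
  exact fun j => ((continuous_apply _).tendsto e |>.eventually (Iio_mem_nhds (h j).1)).and
    ((continuous_apply _).tendsto e |>.eventually (Ioi_mem_nhds (h j).2))

/-- The corners `e₀` need not be generic, but `ψ` holds near them. A generic tuple close to `e₀` in
an extension still bounds a box around `x`, and for it `ψ` implies that the box lies in `φ`. -/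
theorem realize_of_unionF (hT : IsGood add T) {N : TeModel.{u, v, w} T} {n : ℕ}
    {φ : (Le L).Formula (N ⊕ Fin n)} {ψ : L.Formula (N ⊕ Fin (n + n))}
    (hψ : ψ ∈ genericConsequences (cornersF φ)) {x : Fin n → N}
    (hx : (unionF ψ).Realize (Sum.elim id x)) : φ.Realize (Sum.elim id x) := by
  let := Preorder.topology N
  have : OrderTopology N := ⟨rfl⟩
  obtain ⟨e₀, h1, h2⟩ := realize_unionF.1 hx
  rw [realize_intF] at h1
  obtain ⟨c, d, h3, h4⟩ := mem_nhds_iff_inBox.1 (h1.and (eventually_inBox h2))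
  obtain ⟨N', i, e, he, hcd⟩ := exists_generic_box hT fun j => (h3 j).1.trans (h3 j).2
  let ψ' : L.Formula (N ⊕ Fin (n + n)) := ψ ⊓
    boxF (Sum.inr ∘ Fin.castAdd n) (Sum.inr ∘ Fin.natAdd n) (Sum.inl ∘ x)
  have h5 : (boxSubF ψ').Realize (Sum.elim id (Sum.elim c d)) := by
    rw [realize_boxSubF]
    intro y hy
    rw [Formula.realize_inf, realize_boxF]
    exact h4 y hy
  rw [← (reductEmb i).map_formula, Sum.comp_elim, Sum.comp_elim, realize_boxSubF] at h5
  have h6 := h5 e hcd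
  rw [Formula.realize_inf, realize_boxF] at h6
  have h7 := realize_cornersF.1 (hψ N' i e he h6.1) (i ∘ x) h6.2
  rw [← i.map_formula, Sum.comp_elim]
  exact h7

/-- Inside a box around `x` contained in `φ`, generic corners are chosen between `c` and `x` and
between `x` and `d`. Some `L`-formula forces their box into `φ`, and by genericity the corners are
interior to it. -/
theorem exists_realize_unionF (hT : IsGood add T) {N : TeModel.{u, v, w} T} {n : ℕ}
    {φ : (Le L).Formula (N ⊕ Fin n)}
    (hφ : ∀ x : Fin n → N, φ.Realize (Sum.elim id x) → (intF φ).Realize (Sum.elim id x))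
    {N' : TeModel.{u, v, max u v w} T} (i : N ↪ₑ[Le L] N') {x : Fin n → N'}
    (hx : φ.Realize (Sum.elim i x)) :
    ∃ ψ ∈ genericConsequences (cornersF φ), (unionF ψ).Realize (Sum.elim i x) := by
  let := Preorder.topology N'
  have : OrderTopology N' := ⟨rfl⟩
  have h1 := i.map_formula (Formula.iAlls (Fin n) (φ.imp (intF φ))) id
  simp only [Formula.realize_iAlls, Formula.realize_imp, Function.comp_id] at h1
  have h2 := h1.2 hφ x hx
  rw [realize_intF] at h2
  obtain ⟨c, d, h3, h4⟩ := mem_nhds_iff_inBox.1 h2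
  obtain ⟨N₂, i₂, e, he, hcd⟩ := exists_generic_box hT (l := Fin.append c x) (r := Fin.append x d)
    fun j => by
      refine Fin.addCases (fun j => ?_) (fun j => ?_) j
      · simpa using (h3 j).1
      · simpa only [Fin.append_right] using (h3 j).2
  have hlow (j : Fin n) : i₂ (c j) < e (Fin.castAdd n j) ∧ e (Fin.castAdd n j) < i₂ (x j) := by
    simpa using hcd (Fin.castAdd n j)
  have hup (j : Fin n) : i₂ (x j) < e (Fin.natAdd n j) ∧ e (Fin.natAdd n j) < i₂ (d j) := by
    simpa only [Function.comp_apply, Fin.append_right] using hcd (Fin.natAdd n j)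
  have he' : IsIndep L (Set.range (i₂.comp i) ∪ setP N₂) e :=
    he.mono (Set.union_subset_union_left _ (by rintro _ ⟨y, rfl⟩; exact ⟨i y, rfl⟩))
  have h5 : (cornersF φ).Realize (Sum.elim (i₂.comp i) e) := by
    rw [realize_cornersF]
    intro y hy
    have h6 : (boxSubF φ).Realize (Sum.elim i (Sum.elim c d)) := by
      rw [realize_boxSubF]
      exact h4
    rw [← i₂.map_formula, Sum.comp_elim, Sum.comp_elim, realize_boxSubF] at h6
    exact h6 y fun j => ⟨(hlow j).1.trans (hy j).1, (hy j).2.trans (hup j).2⟩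
  obtain ⟨ψ, hψ, hψe⟩ := exists_mem_genericConsequences hT he' h5
  refine ⟨ψ, hψ, ?_⟩
  rw [← (reductEmb i₂).map_formula, Sum.comp_elim, realize_unionF]
  refine ⟨e, IsIndep.realize_intF.{u, v, w, w} hT N₂.isTe.model ψ (he'.mono ?_) hψe, fun j => ?_⟩
  · exact Set.subset_union_left
  · exact ⟨(hlow j).2, (hup j).1⟩

/-- An open set that is definable in a model of `T_e` is definable in the reduct to `L`. -/
theorem exists_formula_of_open (hT : IsGood add T) {N : TeModel.{u, v, w} T} {n : ℕ}
    (φ : (Le L).Formula (N ⊕ Fin n))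
    (hφ : ∀ x : Fin n → N, φ.Realize (Sum.elim id x) → (intF φ).Realize (Sum.elim id x)) :
    ∃ ψ : L.Formula (N ⊕ Fin n), ∀ x : Fin n → N,
      ψ.Realize (Sum.elim id x) ↔ φ.Realize (Sum.elim id x) := by
  -- The sets `unionF ψ` lie in the given open set by `realize_of_unionF` and cover it in every
  -- elementary extension, so finitely many suffice.
  obtain ⟨F, hFD, hF⟩ := exists_finset_cover φ
    ((fun ψ => liftF (unionF ψ)) '' genericConsequences (cornersF φ)) (by
      intro N' str i x hx
      obtain ⟨s1, s2, rfl⟩ := exists_eq_sumStructure str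
      obtain ⟨lo, om, dlo, hTe⟩ := isTe_of_embedding hT i
      obtain ⟨ψ, hψ, hψx⟩ := exists_realize_unionF hT hφ (N' := ⟨N', hTe⟩) i hx
      exact ⟨_, ⟨ψ, hψ, rfl⟩, (LHom.realize_onFormula (LHom.sumInl : L →ᴸ Le L) _).2 hψx⟩)
  choose f hfW hf using fun ψ : F => hFD ψ.2
  refine ⟨Formula.iSup fun ψ : F => unionF (f ψ), fun x => ?_⟩
  rw [Formula.realize_iSup]
  constructor
  · rintro ⟨ψ, hψ⟩
    exact realize_of_unionF hT (hfW ψ) hψ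
  · intro hx
    obtain ⟨ψ, hψ, hψx⟩ := hF x hx
    refine ⟨⟨ψ, hψ⟩, (LHom.realize_onFormula (LHom.sumInl : L →ᴸ Le L) _).1 ?_⟩
    have h1 : liftF (unionF (f ⟨ψ, hψ⟩)) = ψ := hf ⟨ψ, hψ⟩
    rwa [← h1] at hψx

end OpenSets

/-! ### Interdefinability with the open core. -/

section Core

variable {L : FirstOrder.Language.{u, v}} [L.IsOrdered] {T : L.Theory} {add : L.Functions 2}

theorem orderTop_eq (L : FirstOrder.Language.{u, v}) [L.IsOrdered] (M : Type w) [L.Structure M]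
    [LinearOrder M] [L.OrderedStructure M] : orderTop L M = Preorder.topology M := by
  simp only [orderTop, Preorder.topology, lt_iff]
  rfl

theorem isOpenPow_iff {M : Type w} [L.Structure M]
    [LinearOrder M] [L.OrderedStructure M] [IsDLO M] {n : ℕ} {φ : L.Formula (M ⊕ Fin n)}
    {U : Set (Fin n → M)} (hφ : ∀ x, x ∈ U ↔ φ.Realize (Sum.elim id x)) :
    IsOpenPow L M U ↔ ∀ x : Fin n → M, φ.Realize (Sum.elim id x) →
      (intF φ).Realize (Sum.elim id x) := by
  let := Preorder.topology M
  have : OrderTopology M := ⟨rfl⟩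
  have h1 : IsOpenPow L M U ↔ IsOpen U := by
    rw [IsOpenPow, orderTop_eq L M]
  rw [h1, isOpen_iff_mem_nhds]
  refine forall_congr' fun x => ?_
  rw [hφ, realize_intF]
  refine imp_congr_right fun _ => ?_
  rw [Filter.Eventually]
  have h2 : U = {y | φ.Realize (Sum.elim id y)} := Set.ext hφ
  rw [h2]

/-- Induction on formulas of the core language: its relation symbols name open `L_e`-definable sets,
which are `L`-definable by `exists_formula_of_open`. -/
theorem definable_of_definable_core (hT : IsGood add T) {N : TeModel.{u, v, w} T} {n : ℕ}
    {s : Set (Fin n → N)} (hs : (Set.univ : Set N).Definable (coreLanguage (Le L) N) s) :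
    (Set.univ : Set N).Definable L s := by
  have key {α : Type w} {m : ℕ} (φ : (coreLanguage (Le L) N).BoundedFormula α m) :
      ∃ ψ : L.Formula (N ⊕ (α ⊕ Fin m)), ∀ (x : α → N) (y : Fin m → N),
        φ.Realize x y ↔ ψ.Realize (Sum.elim id (Sum.elim x y)) := by
    have hterm {β : Type w} (t : (coreLanguage (Le L) N).Term β) : ∃ b, t = Term.var b := by
      rcases t with b | ⟨f, _⟩
      · exact ⟨b, rfl⟩
      · exact Empty.elim f
    induction φ with
    | falsum => exact ⟨⊥, fun x y => Iff.rfl⟩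
    | equal t₁ t₂ =>
      obtain ⟨b₁, rfl⟩ := hterm t₁
      obtain ⟨b₂, rfl⟩ := hterm t₂
      exact ⟨eqF (Sum.inr b₁) (Sum.inr b₂), fun x y => by simp [BoundedFormula.Realize]⟩
    | rel R ts =>
      choose b hb using fun j => hterm (ts j)
      obtain ⟨φ, hφ⟩ := definable_univ_iff.1 R.2.2
      obtain ⟨ψ, hψ⟩ := exists_formula_of_open hT φ ((isOpenPow_iff hφ).1 R.2.1)
      refine ⟨ψ.relabel (Sum.map id b), fun x y => ?_⟩
      rw [Formula.realize_relabel, Sum.elim_comp_map, Function.comp_id, hψ, ← hφ]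
      simp only [BoundedFormula.Realize, hb, Term.realize_var]
      exact Iff.rfl
    | imp φ φ' ih ih' =>
      obtain ⟨ψ, hψ⟩ := ih
      obtain ⟨ψ', hψ'⟩ := ih'
      exact ⟨ψ.imp ψ', fun x y => by
        rw [BoundedFormula.realize_imp, hψ, hψ', Formula.realize_imp]⟩
    | @all m φ ih =>
      obtain ⟨ψ, hψ⟩ := ih
      refine ⟨all1 (ψ.relabel (Sum.elim (Sum.inl ∘ Sum.inl) (Sum.elim (Sum.inl ∘ Sum.inr ∘ Sum.inl)
        (Fin.snoc (Sum.inl ∘ Sum.inr ∘ Sum.inr) (Sum.inr ()))))), fun x y => ?_⟩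
      rw [BoundedFormula.realize_all, realize_all1]
      refine forall_congr' fun z => ?_
      rw [hψ, Formula.realize_relabel, Sum.comp_elim, Sum.comp_elim, Fin.comp_snoc]
      rfl
  rw [definable_univ_iff] at hs ⊢
  obtain ⟨φ, hφ⟩ := hs
  obtain ⟨ψ, hψ⟩ := key φ
  refine ⟨ψ.relabel (Sum.elim Sum.inl (Sum.elim id Fin.elim0)), fun x => ?_⟩
  rw [hφ, Formula.Realize, hψ, Formula.realize_relabel, Sum.comp_elim, Sum.comp_elim]
  rw [Subsingleton.elim (default : Fin 0 → N) (Sum.elim id x ∘ Fin.elim0)]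
  rfl

theorem definable_core_of_open {N : TeModel.{u, v, w} T} {n : ℕ}
    {ω : L.Formula (N ⊕ Fin n)}
    (hω : ∀ x : Fin n → N, ω.Realize (Sum.elim id x) → (intF ω).Realize (Sum.elim id x)) :
    (Set.univ : Set N).Definable (coreLanguage (Le L) N)
      {x : Fin n → N | ω.Realize (Sum.elim id x)} := by
  have h1 (x : Fin n → N) : x ∈ {x : Fin n → N | ω.Realize (Sum.elim id x)} ↔
      (liftF ω).Realize (Sum.elim id x) := by
    rw [LHom.realize_onFormula]
    exact Iff.rfl
  rw [definable_univ_iff]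
  let R : (coreLanguage (Le L) N).Relations n := ⟨_, (isOpenPow_iff h1).2 fun x hx => by
    let := Preorder.topology N
    have : OrderTopology N := ⟨rfl⟩
    rw [LHom.realize_onFormula] at hx
    have := hω x hx
    rw [realize_intF] at this ⊢
    simpa only [LHom.realize_onFormula] using this, definable_univ_iff.2 ⟨_, h1⟩⟩
  refine ⟨R.formula fun j => Term.var (Sum.inr j), fun x => ?_⟩
  rw [Formula.realize_rel]
  exact Iff.rfl

/-- By `exists_open_diff` and compactness the set is a finite union of differences of open
`L`-definable sets, each named by a core symbol. -/
theorem definable_core_of_definable (hT : IsGood add T) {N : TeModel.{u, v, w} T} {n : ℕ}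
    {s : Set (Fin n → N)} (hs : (Set.univ : Set N).Definable L s) :
    (Set.univ : Set N).Definable (coreLanguage (Le L) N) s := by
  obtain ⟨φ, hφ⟩ := definable_univ_iff.1 hs
  let D : Set (L.Formula (N ⊕ Fin n)) := {ψ | (Set.univ : Set N).Definable (coreLanguage (Le L) N)
      {x : Fin n → N | ψ.Realize (Sum.elim id x)} ∧
    ∀ x : Fin n → N, ψ.Realize (Sum.elim id x) → φ.Realize (Sum.elim id x)}
  obtain ⟨F, hFD, hF⟩ := exists_finset_cover φ D (by
    intro N' _ i x hx
    have : Nonempty N' := ⟨i (Classical.arbitrary N)⟩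
    have hN' : N' ⊨ T := (i.theory_model_iff T).1 N.isTe.model
    obtain ⟨lo, om, dlo⟩ := exists_linearOrder hT N'
    obtain ⟨ω, ω', h1, h2, h3, h4, h5⟩ := exists_open_diff hT φ hN' i hx
    refine ⟨ω ⊓ ω'.not, ⟨?_, ?_⟩, Formula.realize_inf.2 ⟨h4, h5⟩⟩
    · convert (definable_core_of_open h1).sdiff (definable_core_of_open h2) using 1
      ext x
      simp only [Set.mem_ofPred_eq, Set.mem_sdiff, Formula.realize_inf, Formula.realize_not]
    · intro x hx
      rw [Formula.realize_inf] at hx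
      exact h3 x hx.1 hx.2)
  have h1 : s = ⋃ ψ ∈ (Finset.univ : Finset F),
      {x : Fin n → N | ψ.1.Realize (Sum.elim id x)} := by
    ext x
    simp only [Set.mem_iUnion, Set.mem_ofPred_eq, hφ]
    constructor
    · intro h
      obtain ⟨ψ, hψ, hx⟩ := hF x h
      exact ⟨⟨ψ, hψ⟩, Finset.mem_univ _, hx⟩
    · rintro ⟨ψ, -, h⟩
      exact (hFD ψ.2).2 x h
  rw [h1]
  exact Set.definable_biUnion_finset (fun ψ => (hFD ψ.2).1) _

end Core

/-! ### Completeness and classification of completions. -/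

section Conclusion

variable {L : FirstOrder.Language.{u, v}} [L.IsOrdered] {T : L.Theory} {add : L.Functions 2}

theorem exists_teModel_realize_iff (hT : IsGood add T) (M : Type w) [Nonempty M]
    [str : (Le L).Structure M] (hM : M ⊨ Te T) :
    ∃ N : TeModel.{u, v, w} T, ∀ φ : (Le L).Sentence, M ⊨ φ ↔ N ⊨ φ := by
  obtain ⟨s1, s2, rfl⟩ := exists_eq_sumStructure str
  obtain ⟨lo, om, dlo, h⟩ := exists_teModel hT M hM
  exact ⟨⟨M, h⟩, fun φ => Iff.rfl⟩

/-- `T` is an open core of each extension of `T_e`. -/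
theorem isOpenCoreOf_of_subset (hT : IsGood add T) {T' : (Le L).Theory} (h : Te T ⊆ T') :
    IsOpenCoreOf.{u, v, u, v, w} T T' := by
  intro N _ str hN
  obtain ⟨s1, s2, rfl⟩ := exists_eq_sumStructure str
  obtain ⟨lo, om, dlo, hTe⟩ := exists_teModel hT N (hN.mono h)
  exact ⟨s1, hTe.model, fun n s => ⟨definable_of_definable_core hT (N := ⟨N, hTe⟩),
    definable_core_of_definable hT (N := ⟨N, hTe⟩)⟩⟩

/-- All models of `T'` have the same number of classes as `N`, so they satisfy the same sentences as
`N`. -/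
theorem isComplete_of_atLeast (hT : IsGood add T) {T' : (Le L).Theory} (h : Te T ⊆ T')
    {p : ℕ → Prop} (hp : ∀ N : TeModel.{u, v, max u v} T, N ⊨ T' ↔ ∀ k, AtLeast N k ↔ p k)
    (hex : ∃ N : TeModel.{u, v, max u v} T, ∀ k, AtLeast N k ↔ p k) : T'.IsComplete := by
  obtain ⟨N, hN⟩ := hex
  have : N ⊨ T' := (hp N).2 hN
  have key (φ : (Le L).Sentence) (hφ : N ⊨ φ) : T' ⊨ᵇ φ := by
    rw [Theory.models_sentence_iff]
    intro M
    obtain ⟨N', hN'⟩ := exists_teModel_realize_iff hT M (M.is_model.mono h)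
    have h1 : N' ⊨ T' := ⟨fun ψ hψ => (hN' ψ).1 (M.is_model.realize_of_mem ψ hψ)⟩
    rw [hN']
    exact (realize_sentence_iff_of_atLeast.{u, v, max u v} hT
      (fun k => (hN k).trans ((hp N').1 h1 k).symm) φ).1 hφ
  refine ⟨Theory.Model.isSatisfiable N, fun φ => ?_⟩
  by_cases hφ : N ⊨ φ
  · exact Or.inl (key φ hφ)
  · exact Or.inr (key φ.not ((Sentence.realize_not N).2 hφ))

theorem AtLeast.mono {N : Type w} [peLanguage.Structure N] {m n : ℕ} (h : AtLeast N n)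
    (hmn : m ≤ n) : AtLeast N m := by
  obtain ⟨x, h1, h2⟩ := h
  exact ⟨x ∘ Fin.castLE hmn, fun i => h1 _, fun i j hij => h2 _ _ fun h => hij (by simpa using h)⟩

theorem model_teInf_iff (N : TeModel.{u, v, w} T) : N ⊨ TeInf T ↔ ∀ k, AtLeast N k ↔ True := by
  rw [TeInf, Theory.model_union_iff, model_Te_iff, Theory.model_iff {σ | _}]
  simp only [iff_true]
  constructor
  · exact fun h k => realize_atLeastSentence.1 (h.2 _ ⟨k, rfl⟩)
  · rintro h
    refine ⟨N.isTe, ?_⟩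
    rintro _ ⟨k, rfl⟩
    exact realize_atLeastSentence.2 (h k)

theorem model_teN_iff (N : TeModel.{u, v, w} T) {n : ℕ} :
    N ⊨ TeN T n ↔ ∀ k, AtLeast N k ↔ k ≤ n := by
  rw [TeN, Theory.model_union_iff, model_Te_iff, Theory.model_singleton_iff, Sentence.realize_inf,
    Sentence.realize_not, realize_atLeastSentence, realize_atLeastSentence]
  constructor
  · rintro ⟨-, h1, h2⟩ k
    refine ⟨fun h => ?_, h1.mono⟩
    by_contra hk
    exact h2 (h.mono (by omega))
  · exact fun h => ⟨N.isTe, (h n).2 le_rfl, fun h' => by simpa using (h _).1 h'⟩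

theorem isComplete_teInf (hT : IsGood add T) : (TeInf T).IsComplete := by
  refine isComplete_of_atLeast hT Set.subset_union_left model_teInf_iff ?_
  obtain ⟨N, hN⟩ := exists_teModel_atLeast_iff hT ℕ
  exact ⟨N, fun k => (hN k).trans (iff_true_intro ⟨Fin.valEmbedding⟩)⟩

theorem isComplete_teN (hT : IsGood add T) {n : ℕ} (hn : 0 < n) : (TeN T n).IsComplete := by
  refine isComplete_of_atLeast hT Set.subset_union_left (fun N => model_teN_iff N) ?_
  have : Nonempty (Fin n) := ⟨⟨0, hn⟩⟩
  obtain ⟨N, hN⟩ := exists_teModel_atLeast_iff hT (Fin n)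
  refine ⟨N, fun k => (hN k).trans ⟨fun ⟨f⟩ => ?_, fun h => ⟨Fin.castLEEmb h⟩⟩⟩
  simpa using Fintype.card_le_of_embedding f

/-- A model of `T_e` is a model of one of the theories `T_{e,n}`, `T_{e,∞}`. -/
theorem TeModel.model_teInf_or_teN (N : TeModel.{u, v, w} T) :
    N ⊨ TeInf T ∨ ∃ n, 0 < n ∧ N ⊨ TeN T n := by
  classical
  by_cases h : ∀ k, AtLeast N k
  · exact Or.inl ((model_teInf_iff N).2 fun k => iff_true_intro (h k))
  push Not at h
  obtain ⟨a, b, hab⟩ := exists_pair_lt N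
  obtain ⟨p, hp, -⟩ := N.isTe.dense a b hab
  have h1 : AtLeast N 1 := ⟨fun _ => p, fun _ => hp,
    fun i j hij => (hij (Subsingleton.elim i j)).elim⟩
  -- The least count that is not attained is neither `0` nor `1`, since `P` is nonempty; its
  -- predecessor is the number of classes.
  obtain ⟨n, hn⟩ : ∃ n, Nat.find h = n + 1 := Nat.exists_eq_succ_of_ne_zero fun h0 => by
    have := Nat.find_spec h
    rw [h0] at this
    exact this (h1.mono zero_le_one)
  have hn1 : ¬ AtLeast N (n + 1) := hn ▸ Nat.find_spec h
  have hn2 : AtLeast N n := not_not.1 (Nat.find_min h (by omega))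
  refine Or.inr ⟨n, Nat.pos_of_ne_zero ?_, (model_teN_iff N).2 fun k => ⟨fun hk => ?_, hn2.mono⟩⟩
  · rintro rfl
    exact hn1 h1
  · by_contra hkn
    exact hn1 (hk.mono (by omega))

omit [L.IsOrdered] in
theorem models_iff_of_common_model {T₁ T₂ : (Le L).Theory} (h₁ : T₁.IsComplete)
    (h₂ : T₂.IsComplete) (N : Type w) [Nonempty N] [(Le L).Structure N] (hN₁ : N ⊨ T₁)
    (hN₂ : N ⊨ T₂) (φ : (Le L).Sentence) : T₁ ⊨ᵇ φ ↔ T₂ ⊨ᵇ φ :=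
  (h₁.realize_sentence_iff φ N).symm.trans (h₂.realize_sentence_iff φ N)

end Conclusion

end OpenCore

theorem theoremC {L : FirstOrder.Language.{u, v}} [L.IsOrdered] (add : L.Functions 2)
    (T : L.Theory) (hcomplete : T.IsComplete)
    (hgroup : OpenCore.Extends T (OpenCore.denselyOrderedGroupTheory add))
    (homin : OpenCore.IsOMinimal T) :
    ((OpenCore.TeInf T).IsComplete ∧ OpenCore.IsOpenCoreOf.{u, v, u, v, w} T (OpenCore.TeInf T)) ∧
    (∀ n : ℕ, 0 < n →
      (OpenCore.TeN T n).IsComplete ∧ OpenCore.IsOpenCoreOf.{u, v, u, v, w} T (OpenCore.TeN T n)) ∧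
    (∀ T' : (OpenCore.Le L).Theory, T'.IsComplete → OpenCore.Extends T' (OpenCore.Te T) →
      (∀ φ : (OpenCore.Le L).Sentence, T' ⊨ᵇ φ ↔ OpenCore.TeInf T ⊨ᵇ φ) ∨
      ∃ n : ℕ, 0 < n ∧ ∀ φ : (OpenCore.Le L).Sentence, T' ⊨ᵇ φ ↔ OpenCore.TeN T n ⊨ᵇ φ) := by
  have hT : OpenCore.IsGood add T := ⟨hcomplete, hgroup, homin⟩
  refine ⟨⟨OpenCore.isComplete_teInf hT,
    OpenCore.isOpenCoreOf_of_subset hT Set.subset_union_left⟩, fun n hn =>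
    ⟨OpenCore.isComplete_teN hT hn, OpenCore.isOpenCoreOf_of_subset hT Set.subset_union_left⟩,
    fun T' hT' hext => ?_⟩
  -- Any model of `T'` is also a model of one of the listed theories, and two complete theories with
  -- a common model have the same consequences.
  obtain ⟨M⟩ := hT'.1
  obtain ⟨N, hN⟩ := OpenCore.exists_teModel_realize_iff hT M (OpenCore.model_of_extends hext M)
  have hNT' : N ⊨ T' := ⟨fun ψ hψ => (hN ψ).1 (M.is_model.realize_of_mem ψ hψ)⟩
  rcases N.model_teInf_or_teN with h | ⟨n, hn, h⟩
  · exact Or.inl (OpenCore.models_iff_of_common_model hT' (OpenCore.isComplete_teInf hT) N hNT' h)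
  · exact Or.inr ⟨n, hn, OpenCore.models_iff_of_common_model hT' (OpenCore.isComplete_teN hT hn) N
      hNT' h⟩
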